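/- Let $(G;A,B)$ be a double Lie group: $G$ is a (finite-dimensional, Hausdorff, second countable) real Lie group, and $A,B\subseteq G$ are closed Lie subgroups with $A\cap B=\{e\}$ and $G=AB$. Every $g\in G$ can be written uniquely as $g=a_L(g)b_R(g)=b_L(g)a_R(g)$ with $a_L(g),a_R(g)\in A$ and $b_L(g),b_R(g)\in B$. Let $G_A$ be the differential groupoid over $A$ with underlying manifold $G$, left (target) projection $a_L$, right (source) projection $a_R$, composition $(b_1a)(ab_2)=b_1ab_2$ and inverse $s(g)=a_R(g)b_R(g)^{-1}$. Its left and right fibers through $g$ are $gB$ and $Bg$, with tangent spaces $T^l_g$ and $T^r_g$ at $g$. Let $\mathcal A(G_A)$ be the complex vector space of smooth, compactly supported sections $\omega$ of the line bundle over $G$ with fibers $\Omega^{1/2}(T^l_g)\otimes\Omega^{1/2}(T^r_g)$, where $\Omega^{1/2}$ denotes complex half-densities. For $v\in\Lambda^{\max}T^l_g$ and $w\in\Lambda^{\max}T^r_g$ write $\omega(g)(v\otimes w)\in\mathbb C$ for the value of $\omega$. The star operation is $\omega^*(g)(v\otimes w)=\overline{\omega(s(g))(s(w)\otimes s(v))}$.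 For the product, fix a nonzero real half-density $\mu_0$ on $T_eB$, let $\mu_L^2$ be the left-invariant density on $B$ with value $\mu_0^2$ at $e$, put $\lambda_0(g)(v)=\mu_0(g^{-1}v)$, $\rho_0(g)(w)=\lambda_0(s(g))(s(w))$ and $\omega_0=\lambda_0\otimes\rho_0$. Every $\omega\in\mathcal A(G_A)$ is $\omega=f\omega_0$ for a unique $f\in C_c^\infty(G)$, and $(f_1\omega_0)(f_2\omega_0)=(f_1*f_2)\,\omega_0$ with $$(f_1*f_2)(g)=\int_B\mu_L^2(b)\,f_1\big(a_L(g)b\big)\,f_2\big(b_L(a_L(g)b)^{-1}g\big).$$ Let $\mathfrak g=\mathfrak a\oplus\mathfrak b$ be the decomposition of the Lie algebra of $G$ into those of $A$ and $B$, let $g_1:\mathfrak a\to\mathfrak a$ and $g_4:\mathfrak b\to\mathfrak b$ be the diagonal blocks of $\mathrm{Ad}(g)$, and put $Q(g)=\dfrac{\det \mathrm{Ad}(g)}{\det(g_1)\det(g_4)}\in\mathbb R\setminus\{0\}$. For $z\in\mathbb C$ and $\omega\in\mathcal A(G_A)$ define $$\tau_z(\omega)=|Q|^{iz}\omega,\qquad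 R(\omega)(g)(v\otimes w)=\omega(g^{-1})(w^{-1}\otimes v^{-1}),\qquad \kappa=R\circ\tau_{i/2},$$ where $v^{-1},w^{-1}$ are the images of $v,w$ under the tangent map of the inversion $g\mapsto g^{-1}$. **Proposition 5.1.** 1. $z\mapsto\tau_z$ is a complex one-parameter group of automorphisms of $\mathcal A(G_A)$: each $\tau_z$ is a linear bijection of $\mathcal A(G_A)$ onto itself with $\tau_z(\omega_1\omega_2)=\tau_z(\omega_1)\tau_z(\omega_2)$, and $\tau_0=\mathrm{id}$, $\tau_{z+w}=\tau_z\tau_w$ for all $z,w\in\mathbb C$. 2. $\tau_z\circ *=*\circ\tau_{\bar z}$ for all $z\in\mathbb C$. 3. $R$ is an involutive $*$-antiautomorphism of $\mathcal A(G_A)$: it is a linear bijection of $\mathcal A(G_A)$ onto itself with $R\circ R=\mathrm{id}$, $R(\omega_1\omega_2)=R(\omega_2)R(\omega_1)$ and $R(\omega^*)=R(\omega)^*$. 4. $R\circ\tau_z=\tau_z\circ R$ for all $z\in\mathbb C$. 5. $\kappa(\omega_1\omega_2)=\kappa(\omega_2)\kappa(\omega_1)$ for all $\omega_1,\omega_2\in\mathcal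 A(G_A)$. 6. $\kappa\circ *\circ\kappa\circ *=\mathrm{id}$. -/

import Mathlib

open scoped Manifold ContDiff Topology

noncomputable section

namespace DLG

/-! ### Linear algebra -/

section LinearAlgebra

variable {V : Type*} [AddCommGroup V] [Module ℝ V]

/-- The projection of `V` onto `p` along `q`, as a map `V → p`. It is meant for complementary
subspaces `p`, `q` (the value `0` in the remaining case is never used below). -/
def projOnto (p q : Submodule ℝ V) : V →ₗ[ℝ] p :=
  open Classical in if h : IsCompl p q then p.projectionOnto q h else 0

/-- The diagonal block `p → p` of an endomorphism of `V = p ⊕ q`. -/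
def diagBlock (p q : Submodule ℝ V) (T : V →ₗ[ℝ] V) : p →ₗ[ℝ] p :=
  projOnto p q ∘ₗ T ∘ₗ p.subtype

/-- `β` is an element of `Ω^{1/2}(L) ⊗ Ω^{1/2}(R)` for `n`-dimensional subspaces `L, R ⊆ V`.
A half-density on `L` is a function `d` of `n`-tuples of vectors of `L` with
`d (v M) = |det M|^{1/2} d (v)` for every matrix `M`, and an element of the
(one-dimensional) tensor product is a function of two such tuples `v`, `w`, written
`β (v ⊗ w)`, which is a half-density in each of them. So that `β` can be stored as a function of
tuples of vectors of `V`, it is extended by `0` to the tuples that do not lie in `L`, resp. `R`. -/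
structure IsBidensityAt {n : ℕ} (L R : Submodule ℝ V)
    (β : (Fin n → V) → (Fin n → V) → ℂ) : Prop where
  left : ∀ (M : Matrix (Fin n) (Fin n) ℝ) (v w : Fin n → V), (∀ i, v i ∈ L) → (∀ i, w i ∈ R) →
    β (fun j => ∑ i, M i j • v i) w = (√|M.det| : ℝ) * β v w
  right : ∀ (M : Matrix (Fin n) (Fin n) ℝ) (v w : Fin n → V), (∀ i, v i ∈ L) → (∀ i, w i ∈ R) →
    β v (fun j => ∑ i, M i j • w i) = (√|M.det| : ℝ) * β v w
  support : ∀ v w : Fin n → V, β v w ≠ 0 → (∀ i, v i ∈ L) ∧ (∀ i, w i ∈ R)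

end LinearAlgebra

/-! ### Double Lie groups -/

variable {EG EA EB : Type*}
  [NormedAddCommGroup EG] [NormedSpace ℝ EG]
  [NormedAddCommGroup EA] [NormedSpace ℝ EA]
  [NormedAddCommGroup EB] [NormedSpace ℝ EB]
  {G : Type*} [Group G] [TopologicalSpace G] [ChartedSpace EG G]

/-- `(G; A, B)` is a double Lie group: `A`, `B` are closed (Lie) subgroups of the Lie group `G`
with `A ∩ B = {e}` and `G = A B`. The manifold structures of `A` and `B` are those of embedded
submanifolds of `G`: their topology is the subspace topology and the inclusion is a smooth
immersion. -/
structure IsDoubleLieGroup (EG EA EB : Type*)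
    [NormedAddCommGroup EG] [NormedSpace ℝ EG]
    [NormedAddCommGroup EA] [NormedSpace ℝ EA]
    [NormedAddCommGroup EB] [NormedSpace ℝ EB]
    {G : Type*} [Group G] [TopologicalSpace G] [ChartedSpace EG G]
    (A B : Subgroup G) [ChartedSpace EA A] [ChartedSpace EB B] : Prop where
  lieGroup : LieGroup 𝓘(ℝ, EG) ∞ G
  lieGroup_left : LieGroup 𝓘(ℝ, EA) ∞ A
  lieGroup_right : LieGroup 𝓘(ℝ, EB) ∞ B
  isClosed_left : IsClosed (A : Set G)
  isClosed_right : IsClosed (B : Set G)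
  contMDiff_left : ContMDiff 𝓘(ℝ, EA) 𝓘(ℝ, EG) ∞ (fun a : A => (a : G))
  contMDiff_right : ContMDiff 𝓘(ℝ, EB) 𝓘(ℝ, EG) ∞ (fun b : B => (b : G))
  immersion_left : ∀ a : A,
    Function.Injective (mfderiv 𝓘(ℝ, EA) 𝓘(ℝ, EG) (fun a : A => (a : G)) a)
  immersion_right : ∀ b : B,
    Function.Injective (mfderiv 𝓘(ℝ, EB) 𝓘(ℝ, EG) (fun b : B => (b : G)) b)
  inf_eq_bot : A ⊓ B = ⊥
  exists_mul : ∀ g : G, ∃ (a : A) (b : B), g = a * b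

/-- The adjoint representation: `Ad g` is the tangent map at `e` of `x ↦ g x g⁻¹`. -/
def Ad (EG : Type*) [NormedAddCommGroup EG] [NormedSpace ℝ EG]
    {G : Type*} [Group G] [TopologicalSpace G] [ChartedSpace EG G] (g : G) :
    TangentSpace 𝓘(ℝ, EG) (1 : G) →ₗ[ℝ] TangentSpace 𝓘(ℝ, EG) (1 : G) :=
  (mfderiv 𝓘(ℝ, EG) 𝓘(ℝ, EG) (fun x : G => g * x * g⁻¹) 1 : EG →L[ℝ] EG).toLinearMap

/-- The Lie algebra of a Lie subgroup `S` of `G`, as a subspace of `𝔤 = T_e G`. -/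
def subLieAlgebra (EG ES : Type*)
    [NormedAddCommGroup EG] [NormedSpace ℝ EG] [NormedAddCommGroup ES] [NormedSpace ℝ ES]
    {G : Type*} [Group G] [TopologicalSpace G] [ChartedSpace EG G]
    (S : Subgroup G) [ChartedSpace ES S] : Submodule ℝ (TangentSpace 𝓘(ℝ, EG) (1 : G)) :=
  LinearMap.range
    (mfderiv 𝓘(ℝ, ES) 𝓘(ℝ, EG) (fun s : S => (s : G)) 1 : ES →L[ℝ] EG).toLinearMap

namespace IsDoubleLieGroup

variable {A B : Subgroup G} [ChartedSpace EA A] [ChartedSpace EB B]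

theorem exists_mul' (h : IsDoubleLieGroup EG EA EB A B) (g : G) :
    ∃ (b : B) (a : A), g = b * a := by
  obtain ⟨a, b, hab⟩ := h.exists_mul g⁻¹
  refine ⟨b⁻¹, a⁻¹, ?_⟩
  rw [← inv_inv g, hab]
  simp

/-! The four projections of a double Lie group: `g = a_L(g) b_R(g) = b_L(g) a_R(g)`. -/

def aL (h : IsDoubleLieGroup EG EA EB A B) (g : G) : A := (h.exists_mul g).choose

def bR (h : IsDoubleLieGroup EG EA EB A B) (g : G) : B := (h.exists_mul g).choose_spec.choose

def bL (h : IsDoubleLieGroup EG EA EB A B) (g : G) : B := (h.exists_mul' g).choose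

def aR (h : IsDoubleLieGroup EG EA EB A B) (g : G) : A := (h.exists_mul' g).choose_spec.choose

/-- The function `Q(g) = det (Ad g) / (det g₁ · det g₄)`, where `g₁ : 𝔞 → 𝔞` and `g₄ : 𝔟 → 𝔟` are
the diagonal blocks of `Ad g` in the decomposition `𝔤 = 𝔞 ⊕ 𝔟`. -/
def Q (_h : IsDoubleLieGroup EG EA EB A B) (g : G) : ℝ :=
  LinearMap.det (Ad EG g) /
    (LinearMap.det (diagBlock (subLieAlgebra EG EA A) (subLieAlgebra EG EB B) (Ad EG g)) *
      LinearMap.det (diagBlock (subLieAlgebra EG EB B) (subLieAlgebra EG EA A) (Ad EG g)))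

/-! ### The groupoid `G_A` and its bidensities

`G_A` is the groupoid over `A` with underlying manifold `G`, left (target) projection `a_L`, right
(source) projection `a_R`, composition `(b₁ a) (a b₂) = b₁ a b₂` and inverse `s_A`. The left fiber
through `g` is `g B`, the right fiber through `g` is `B g`. -/

/-- The inverse `s_A(g) = a_R(g) b_R(g)⁻¹` of the groupoid `G_A`. -/
def sA (h : IsDoubleLieGroup EG EA EB A B) (g : G) : G := h.aR g * (h.bR g : G)⁻¹

/-- The tangent map at `e` of `B → g B ⊆ G`, `b ↦ g b`; it sends `Y ∈ T_e B` to `g Y`. -/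
def leftTrans (_h : IsDoubleLieGroup EG EA EB A B) (g : G) :
    TangentSpace 𝓘(ℝ, EB) (1 : B) →ₗ[ℝ] TangentSpace 𝓘(ℝ, EG) g :=
  (mfderiv 𝓘(ℝ, EB) 𝓘(ℝ, EG) (fun b : B => g * (b : G)) 1 : EB →L[ℝ] EG).toLinearMap

/-- The tangent map at `e` of `B → B g ⊆ G`, `b ↦ b g`; it sends `Y ∈ T_e B` to `Y g`. -/
def rightTrans (_h : IsDoubleLieGroup EG EA EB A B) (g : G) :
    TangentSpace 𝓘(ℝ, EB) (1 : B) →ₗ[ℝ] TangentSpace 𝓘(ℝ, EG) g :=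
  (mfderiv 𝓘(ℝ, EB) 𝓘(ℝ, EG) (fun b : B => (b : G) * g) 1 : EB →L[ℝ] EG).toLinearMap

/-- The tangent space `T^l_g G_A` at `g` of the left fiber `g B`. -/
def leftTangent (h : IsDoubleLieGroup EG EA EB A B) (g : G) :
    Submodule ℝ (TangentSpace 𝓘(ℝ, EG) g) := LinearMap.range (h.leftTrans g)

/-- The tangent space `T^r_g G_A` at `g` of the right fiber `B g`. -/
def rightTangent (h : IsDoubleLieGroup EG EA EB A B) (g : G) :
    Submodule ℝ (TangentSpace 𝓘(ℝ, EG) g) := LinearMap.range (h.rightTrans g)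

/-- Functions `η` of a point `g` and of two `(dim B)`-tuples `v`, `w` of tangent vectors at `g`.
Bidensities are such functions, `η g v w` being the number `η(g)(v ⊗ w)`. -/
abbrev Sect (_h : IsDoubleLieGroup EG EA EB A B) : Type _ :=
  (g : G) → (Fin (Module.finrank ℝ EB) → TangentSpace 𝓘(ℝ, EG) g) →
    (Fin (Module.finrank ℝ EB) → TangentSpace 𝓘(ℝ, EG) g) → ℂ

/-- The linear space `𝒜(G_A)` of compactly supported smooth sections of
`Ω^{1/2}(e_L) ⊗ Ω^{1/2}(e_R)`. Smoothness is tested on the frames `g X`, `Y g` that come from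
tuples `X`, `Y` of vectors of `T_e B`; for bases these are smooth global frames of the two
bundles of tangent spaces of the fibers. -/
def bidensities (h : IsDoubleLieGroup EG EA EB A B) : Submodule ℂ h.Sect where
  carrier := {η |
    (∀ g, IsBidensityAt (h.leftTangent g) (h.rightTangent g) (η g)) ∧
    (∀ X Y : Fin (Module.finrank ℝ EB) → TangentSpace 𝓘(ℝ, EB) (1 : B),
      ContMDiff 𝓘(ℝ, EG) 𝓘(ℝ, ℂ) ∞
        (fun g : G => η g (fun i => h.leftTrans g (X i)) (fun i => h.rightTrans g (Y i)))) ∧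
    ∃ K : Set G, IsCompact K ∧ ∀ g ∉ K, η g = 0}
  add_mem' := by
    rintro η₁ η₂ ⟨h₁, s₁, K₁, k₁, c₁⟩ ⟨h₂, s₂, K₂, k₂, c₂⟩
    refine ⟨fun g => ⟨fun M v w hv hw => ?_, fun M v w hv hw => ?_, fun v w hvw => ?_⟩,
      fun X Y => (s₁ X Y).add (s₂ X Y), K₁ ∪ K₂, k₁.union k₂, fun g hg => ?_⟩
    · simp only [Pi.add_apply, (h₁ g).left M v w hv hw, (h₂ g).left M v w hv hw, mul_add]
    · simp only [Pi.add_apply, (h₁ g).right M v w hv hw, (h₂ g).right M v w hv hw, mul_add]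
    · by_cases h0 : η₁ g v w = 0
      · refine (h₂ g).support v w fun h0' => hvw ?_
        simp only [Pi.add_apply, h0, h0', add_zero]
      · exact (h₁ g).support v w h0
    · simp only [Set.mem_union, not_or] at hg
      simp only [Pi.add_apply, c₁ g hg.1, c₂ g hg.2, add_zero]
  zero_mem' := by
    refine ⟨fun g => ⟨fun M v w _ _ => ?_, fun M v w _ _ => ?_, fun v w hvw => ?_⟩,
      fun X Y => contMDiff_const, ∅, isCompact_empty, fun g _ => rfl⟩
    · simp
    · simp
    · exact absurd rfl hvw
  smul_mem' := by
    rintro c η ⟨h₁, s₁, K₁, k₁, c₁⟩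
    refine ⟨fun g => ⟨fun M v w hv hw => ?_, fun M v w hv hw => ?_, fun v w hvw => ?_⟩,
      fun X Y => ?_, K₁, k₁, fun g hg => ?_⟩
    · simp only [Pi.smul_apply, (h₁ g).left M v w hv hw, smul_eq_mul]; ring
    · simp only [Pi.smul_apply, (h₁ g).right M v w hv hw, smul_eq_mul]; ring
    · refine (h₁ g).support v w fun h0 => hvw ?_
      simp only [Pi.smul_apply, h0, smul_zero]
    · have hm : ContMDiff 𝓘(ℝ, ℂ) 𝓘(ℝ, ℂ) ∞ (fun z : ℂ => c * z) :=
        (contDiff_const.mul contDiff_id).contMDiff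
      exact hm.comp (s₁ X Y)
    · simp only [Pi.smul_apply, c₁ g hg, smul_zero]

/-- The star operation `η*(x)(v ⊗ w) = conj (η(s(x))(s(w) ⊗ s(v)))`, where `s = s_A` and `s(v)` is
the image of `v` under the tangent map of `s`. -/
def star (h : IsDoubleLieGroup EG EA EB A B) (η : h.Sect) : h.Sect := fun x v w =>
  (starRingEnd ℂ) (η (h.sA x)
    (fun i => mfderiv 𝓘(ℝ, EG) 𝓘(ℝ, EG) h.sA x (w i))
    (fun i => mfderiv 𝓘(ℝ, EG) 𝓘(ℝ, EG) h.sA x (v i)))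

/-! ### Multiplication of bidensities

A basis `X` of `T_e B` determines the real half-density `μ₀` on `T_e B` with `μ₀(X) = 1`; up to
sign every nonzero real half-density is of this form, and a change of sign of `μ₀` affects none of
the objects below. -/

/-- The left-invariant half-density `λ₀(g)(v) = μ₀(g⁻¹ v)` along the left fibers, that is
`λ₀(g)(g Y) = μ₀(Y) = |det_X Y|^{1/2}`, extended by `0` to tuples outside `T^l_g G_A`. -/
def lambda0 (h : IsDoubleLieGroup EG EA EB A B)
    (X : Module.Basis (Fin (Module.finrank ℝ EB)) ℝ (TangentSpace 𝓘(ℝ, EB) (1 : B)))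
    (g : G) (v : Fin (Module.finrank ℝ EB) → TangentSpace 𝓘(ℝ, EG) g) : ℝ :=
  open Classical in
  if hv : ∃ Y : Fin (Module.finrank ℝ EB) → TangentSpace 𝓘(ℝ, EB) (1 : B),
      ∀ i, v i = h.leftTrans g (Y i) then √|X.det hv.choose| else 0

/-- The right-invariant half-density along the right fibers that corresponds to `λ₀` under the
groupoid inverse `s = s_A`: `ρ₀(g)(w) = λ₀(s(g))(s(w))`. -/
def rho0 (h : IsDoubleLieGroup EG EA EB A B)
    (X : Module.Basis (Fin (Module.finrank ℝ EB)) ℝ (TangentSpace 𝓘(ℝ, EB) (1 : B)))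
    (g : G) (w : Fin (Module.finrank ℝ EB) → TangentSpace 𝓘(ℝ, EG) g) : ℝ :=
  h.lambda0 X (h.sA g) (fun i => mfderiv 𝓘(ℝ, EG) 𝓘(ℝ, EG) h.sA g (w i))

/-- `η₀ = λ₀ ⊗ ρ₀`. -/
def omega0 (h : IsDoubleLieGroup EG EA EB A B)
    (X : Module.Basis (Fin (Module.finrank ℝ EB)) ℝ (TangentSpace 𝓘(ℝ, EB) (1 : B))) : h.Sect :=
  fun g v w => ((h.lambda0 X g v * h.rho0 X g w : ℝ) : ℂ)

/-- The function `f` with `η = f η₀` (evaluate both sides on `g X ⊗ X g`). -/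
def coeff (h : IsDoubleLieGroup EG EA EB A B)
    (X : Module.Basis (Fin (Module.finrank ℝ EB)) ℝ (TangentSpace 𝓘(ℝ, EB) (1 : B)))
    (η : h.Sect) (g : G) : ℂ :=
  η g (fun i => h.leftTrans g (X i)) (fun i => h.rightTrans g (X i)) /
    h.omega0 X g (fun i => h.leftTrans g (X i)) (fun i => h.rightTrans g (X i))

/-- `ν` is the measure on `B` given by the left-invariant density `μ_L²` with value `μ₀² = |det_X|`
at `e`: it is the left Haar measure for which, in the preferred chart `φ` at `e` (the one that
identifies `T_e B` with the model space), the parallelepiped at `φ(e)` with edges `r X_i` has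
measure asymptotic to its volume `r^n` as `r → 0+`. -/
structure IsLeftDensityMeasure (_h : IsDoubleLieGroup EG EA EB A B)
    (X : Module.Basis (Fin (Module.finrank ℝ EB)) ℝ (TangentSpace 𝓘(ℝ, EB) (1 : B)))
    [MeasurableSpace B] (ν : MeasureTheory.Measure B) : Prop where
  isHaarMeasure : ν.IsHaarMeasure
  normalized : Filter.Tendsto
    (fun r : ℝ => ν.real ((chartAt EB (1 : B)).symm ''
        ((fun t : EB => chartAt EB (1 : B) 1 + r • t) '' parallelepiped (fun i => (X i : EB)))) /
      r ^ Module.finrank ℝ EB) (𝓝[>] 0) (𝓝 1)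

/-- The product of `𝒜(G_A)`: `(f₁ η₀) (f₂ η₀) = (f₁ * f₂) η₀`, where `f₁ * f₂` is the convolution
`(f₁ * f₂)(g) = ∫_{F_l(g)} λ₀²(y) f₁(y) f₂(s(y) g)` over the left fiber of `g`; in terms of
the points `y = a_L(g) b`, `b ∈ B`, of the fiber this is
`∫_B μ_L²(b) f₁(a_L(g) b) f₂(b_L(a_L(g) b)⁻¹ g)`. -/
def mul (h : IsDoubleLieGroup EG EA EB A B)
    (X : Module.Basis (Fin (Module.finrank ℝ EB)) ℝ (TangentSpace 𝓘(ℝ, EB) (1 : B)))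
    [MeasurableSpace B] (ν : MeasureTheory.Measure B) (η₁ η₂ : h.Sect) : h.Sect := fun g v w =>
  (∫ b : B, h.coeff X η₁ (h.aL g * (b : G)) *
    h.coeff X η₂ ((h.bL (h.aL g * (b : G)) : G)⁻¹ * g) ∂ν) * h.omega0 X g v w

/-! ### The maps `τ_z`, `R`, `κ` -/

/-- `τ_z η = |Q|^{iz} η`. -/
def tau (h : IsDoubleLieGroup EG EA EB A B) (z : ℂ) (η : h.Sect) : h.Sect := fun g v w =>
  ((|h.Q g| : ℝ) : ℂ) ^ (Complex.I * z) * η g v w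

/-- `R(η)(g)(v ⊗ w) = η(g⁻¹)(w⁻¹ ⊗ v⁻¹)`, where `v⁻¹`, `w⁻¹` are the images of `v`, `w` under the
tangent map of the group inversion `g ↦ g⁻¹`. -/
def R (h : IsDoubleLieGroup EG EA EB A B) (η : h.Sect) : h.Sect := fun g v w =>
  η g⁻¹
    (fun i => mfderiv 𝓘(ℝ, EG) 𝓘(ℝ, EG) (fun x : G => x⁻¹) g (w i))
    (fun i => mfderiv 𝓘(ℝ, EG) 𝓘(ℝ, EG) (fun x : G => x⁻¹) g (v i))

/-- `κ = R τ_{i/2}`. -/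
def kappa (h : IsDoubleLieGroup EG EA EB A B) (η : h.Sect) : h.Sect :=
  h.R (h.tau (Complex.I / 2) η)

end IsDoubleLieGroup

/-- `T` restricts to a linear bijection of the space `𝒜` onto itself. -/
structure IsLinearBijectionOn {V : Type*} [AddCommGroup V] [Module ℂ V] (𝒜 : Submodule ℂ V)
    (T : V → V) : Prop where
  bijOn : Set.BijOn T 𝒜 𝒜
  map_add : ∀ x ∈ 𝒜, ∀ y ∈ 𝒜, T (x + y) = T x + T y
  map_smul : ∀ c : ℂ, ∀ x ∈ 𝒜, T (c • x) = c • T x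

end DLG

end

noncomputable section

namespace DLG

/-! ### Diagonal blocks -/

section DiagBlock

variable {V : Type*} [AddCommGroup V] [Module ℝ V] {p q : Submodule ℝ V}

/-! Everything is governed by the determinants `blockA`, `blockB` of the two diagonal blocks of
`Ad`. Since `Ad a` preserves `𝔞` and `Ad b` preserves `𝔟`, the first is multiplicative along `g =
b_L a_R` and the second along `g = a_L b_R`, while `det Ad` is multiplicative throughout. In `Q` the
`B`-blocks cancel, leaving `Q = blockA(a_L) blockA(b_R) / (blockA(a_R) blockA(b_L))`
(`Q_eq_blockA`). In a groupoid product `b_L` and `b_R` multiply and the intermediate base point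
drops out, so `Q` is a cocycle (`Q_mul_Q`) with `Q ∘ s_A = Q⁻¹` and `Q(g⁻¹) = Q(g)`. Hence
`|Q|^{iz}` can be moved under the convolution integral, and the claims on `τ_z` alone, with the star
or with `R` are algebra.

Group inversion exchanges left and right fibers, reverses groupoid products and commutes with `s_A`;
the last fact makes `R` commute with the star. For antimultiplicativity, `R` multiplies the standard
bidensity by `modR(g) = |blockB(a_L) blockB(a_R)|^{1/2}` (`ev_R_omega0`), and the convolution at
`g⁻¹` is carried to the left fiber of `g`, with points `y = a_L(g) b`, by `b ↦ b_L(g)⁻¹ b_L(y)`. The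
Haar Jacobian of this map is `|blockB(a_R(y))|` (`integral_bL_inv_mul_bL`), which is exactly the
defect of multiplicativity of `modR` (`modR_mul_modR`). The claims on `κ` are formal consequences.

The analytic input is `𝔤 = 𝔞 ⊕ 𝔟` (`isCompl_subLieAlgebra`), smoothness of the four projections
(`contMDiffAt_aL_bR_one`), and the change of variables for Haar measure under a diffeomorphism
(`map_withDensity_trivDer`), obtained from Lebesgue measure in the chart at `e`. -/

theorem projOnto_of_isCompl (hpq : IsCompl p q) :
    projOnto p q = p.projectionOnto q hpq := by
  simp [projOnto, hpq]

theorem diagBlock_apply (hpq : IsCompl p q) (T : V →ₗ[ℝ] V) (x : p) :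
    diagBlock p q T x = p.projectionOnto q hpq (T x) := by
  simp [diagBlock, projOnto_of_isCompl hpq]

theorem diagBlock_id (hpq : IsCompl p q) : diagBlock p q LinearMap.id = LinearMap.id := by
  ext x; simp [diagBlock_apply hpq]

/-- The block on `p` is multiplicative if the right factor preserves `p`. -/
theorem diagBlock_comp_of_right (hpq : IsCompl p q) (T S : V →ₗ[ℝ] V)
    (hS : ∀ x ∈ p, S x ∈ p) :
    diagBlock p q (T ∘ₗ S) = diagBlock p q T ∘ₗ diagBlock p q S := by
  ext x
  simp only [LinearMap.comp_apply, diagBlock_apply hpq,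
    Submodule.projectionOnto_apply_of_mem_left hpq (hS x x.2)]

/-- The block on `p` is multiplicative if the left factor preserves the complement `q`. -/
theorem diagBlock_comp_of_left (hpq : IsCompl p q) (T S : V →ₗ[ℝ] V)
    (hT : ∀ x ∈ q, T x ∈ q) :
    diagBlock p q (T ∘ₗ S) = diagBlock p q T ∘ₗ diagBlock p q S := by
  ext x
  simp only [LinearMap.comp_apply, diagBlock_apply hpq]
  congr 1
  -- The two sides differ by the projection of `T` applied to `S x` minus its `p`-component. That
  -- vector lies in `q`, and `T` keeps it there.
  rw [← sub_eq_zero, ← map_sub, ← map_sub]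
  rw [Submodule.projectionOnto_apply_eq_zero_iff]
  apply hT
  rw [← Submodule.projectionOnto_apply_eq_zero_iff hpq]
  simp [Submodule.projectionOnto_projection]

/-- `T` is block triangular: its determinant is that of the restriction to `p` times that of the
induced map on `V / p`, and `V / p ≃ q` turns the latter into the `q`-block. -/
theorem det_eq_det_diagBlock_mul [FiniteDimensional ℝ V] (hpq : IsCompl p q) (T : V →ₗ[ℝ] V)
    (hT : ∀ x ∈ p, T x ∈ p) :
    LinearMap.det T = LinearMap.det (diagBlock p q T) * LinearMap.det (diagBlock q p T) := by
  rw [LinearMap.det_eq_det_mul_det p T hT]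
  congr 1
  · congr 1
    ext x
    simp [diagBlock_apply hpq, Submodule.projectionOnto_apply_of_mem_left hpq (hT x x.2)]
  · rw [← LinearMap.det_conj (p.mapQ p T hT) (Submodule.quotientEquivOfIsCompl p q hpq)]
    congr 1
    ext x
    simp [diagBlock_apply hpq.symm]

theorem det_eq_det_diagBlock_mul' [FiniteDimensional ℝ V] (hpq : IsCompl p q) (T : V →ₗ[ℝ] V)
    (hT : ∀ x ∈ q, T x ∈ q) :
    LinearMap.det T = LinearMap.det (diagBlock p q T) * LinearMap.det (diagBlock q p T) := by
  rw [det_eq_det_diagBlock_mul hpq.symm T hT, mul_comm]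

/-- `ι ∘ D` is the projection onto `p` along `q`, so `ι` conjugates `D T ι` to the block. This
allows derivatives of smooth maps to replace the abstract inclusion and projection. -/
theorem det_diagBlock_eq_det_comp (hpq : IsCompl p q) {W : Type*} [AddCommGroup W] [Module ℝ W]
    (ι : W →ₗ[ℝ] V) (D : V →ₗ[ℝ] W) (hι : LinearMap.range ι = p) (hDι : ∀ w, D (ι w) = w)
    (hD : ∀ x ∈ q, D x = 0) (T : V →ₗ[ℝ] V) :
    LinearMap.det (diagBlock p q T) = LinearMap.det (D ∘ₗ T ∘ₗ ι) := by
  subst hι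
  have hinj : Function.Injective ι := Function.LeftInverse.injective hDι
  rw [← LinearMap.det_conj (D ∘ₗ T ∘ₗ ι) (LinearEquiv.ofInjective ι hinj)]
  congr 1
  ext ⟨_, w, rfl⟩
  have hw : (LinearEquiv.ofInjective ι hinj).symm ⟨ι w, w, rfl⟩ = w := by
    rw [LinearEquiv.symm_apply_eq]; rfl
  simp only [LinearMap.comp_apply, LinearEquiv.coe_coe, hw, diagBlock_apply hpq]
  have key : ∀ y : V, ι (D y) = ((LinearMap.range ι).projectionOnto q hpq y : V) := by
    intro y
    obtain ⟨u, hu⟩ := ((LinearMap.range ι).projectionOnto q hpq y).2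
    have h1 : y - ι u ∈ q := by
      rw [← Submodule.projectionOnto_apply_eq_zero_iff hpq, map_sub, sub_eq_zero]
      apply Subtype.ext
      rw [← hu, Submodule.projectionOnto_apply_of_mem_left hpq ⟨u, rfl⟩]
    have h2 := hD _ h1
    rw [map_sub, hDι, sub_eq_zero] at h2
    rw [h2, hu]
  exact (key _).symm

end DiagBlock

/-! ### Bidensities at a point -/

section Bidensity

variable {V W : Type*} [AddCommGroup V] [Module ℝ V] [AddCommGroup W] [Module ℝ W] {n : ℕ}

/-- One value on a pair of frames determines the bidensity on all frames: the coordinate matrices of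
`Y` and `Z` in the basis `X` go into the two scaling rules. -/
theorem IsBidensityAt.apply_comp {L R : Submodule ℝ V} {β : (Fin n → V) → (Fin n → V) → ℂ}
    (hβ : IsBidensityAt L R β) (X : Module.Basis (Fin n) ℝ W) (l r : W →ₗ[ℝ] V)
    (hl : ∀ w, l w ∈ L) (hr : ∀ w, r w ∈ R) (Y Z : Fin n → W) :
    β (fun i => l (Y i)) (fun i => r (Z i)) =
      (√|X.det Y| : ℝ) * (√|X.det Z| : ℝ) * β (fun i => l (X i)) (fun i => r (X i)) := by
  have key : ∀ (f : W →ₗ[ℝ] V) (U : Fin n → W),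
      (fun j => f (U j)) = fun j => ∑ i, X.toMatrix U i j • f (X i) := by
    intro f U
    funext j
    conv_lhs => rw [← X.sum_toMatrix_smul_self U j]
    simp only [map_sum, map_smul]
  rw [key l Y, key r Z, hβ.left _ _ _ (fun i => hl _), hβ.right _ _ _ (fun i => hl _)
    (fun i => hr _), Module.Basis.det_apply, Module.Basis.det_apply]
  · ring
  · intro j
    rw [← congrFun (key r Z) j]
    exact hr _

end Bidensity

/-! ### Derivatives as maps between model spaces -/

section Derivative

variable {EM EN EP : Type*} [NormedAddCommGroup EM] [NormedSpace ℝ EM]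
  [NormedAddCommGroup EN] [NormedSpace ℝ EN] [NormedAddCommGroup EP] [NormedSpace ℝ EP]
  {M N P : Type*} [TopologicalSpace M] [ChartedSpace EM M] [TopologicalSpace N]
  [ChartedSpace EN N] [TopologicalSpace P] [ChartedSpace EP P]

/-- The tangent map of `f` at `x`, as a continuous linear map between the model spaces. -/
def tder (EM EN : Type*) [NormedAddCommGroup EM] [NormedSpace ℝ EM]
    [NormedAddCommGroup EN] [NormedSpace ℝ EN] {M N : Type*} [TopologicalSpace M]
    [ChartedSpace EM M] [TopologicalSpace N] [ChartedSpace EN N] (f : M → N) (x : M) :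
    EM →L[ℝ] EN :=
  mfderiv 𝓘(ℝ, EM) 𝓘(ℝ, EN) f x

theorem tder_comp {f : M → N} {g : N → P} {x : M}
    (hg : MDifferentiableAt 𝓘(ℝ, EN) 𝓘(ℝ, EP) g (f x))
    (hf : MDifferentiableAt 𝓘(ℝ, EM) 𝓘(ℝ, EN) f x) :
    tder EM EP (fun y => g (f y)) x = (tder EN EP g (f x)).comp (tder EM EN f x) :=
  mfderiv_comp x hg hf

theorem tder_comp_of_eq {f : M → N} {g : N → P} {x : M} {y : N} (hy : f x = y)
    (hg : MDifferentiableAt 𝓘(ℝ, EN) 𝓘(ℝ, EP) g y)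
    (hf : MDifferentiableAt 𝓘(ℝ, EM) 𝓘(ℝ, EN) f x) :
    tder EM EP (fun y => g (f y)) x = (tder EN EP g y).comp (tder EM EN f x) := by
  subst hy; exact tder_comp hg hf

theorem tder_id (x : M) : tder EM EM (fun y : M => y) x = ContinuousLinearMap.id ℝ EM :=
  mfderiv_id

theorem tder_const (x : M) (c : N) : tder EM EN (fun _ : M => c) x = 0 :=
  mfderiv_const

end Derivative

/-! ### One-parameter curves and dimension counts -/

section Curves

variable {ES EG : Type*} [NormedAddCommGroup ES] [NormedSpace ℝ ES]
  [NormedAddCommGroup EG] [NormedSpace ℝ EG]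
  {S : Type*} [Group S] [TopologicalSpace S] [ChartedSpace ES S]
  {G : Type*} [Group G] [TopologicalSpace G] [ChartedSpace EG G]

/-- A tangent vector at the identity of a Lie group is carried by a smooth homomorphism `φ` to
the initial velocity of a curve `φ ∘ γ` that is integral for a left-invariant vector field. -/
theorem exists_isMIntegralCurveAt_comp [FiniteDimensional ℝ ES]
    [LieGroup 𝓘(ℝ, ES) ∞ S] [LieGroup 𝓘(ℝ, EG) ∞ G] (φ : S →* G)
    (hφ : ContMDiff 𝓘(ℝ, ES) 𝓘(ℝ, EG) ∞ φ) (x : TangentSpace 𝓘(ℝ, ES) (1 : S))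
    (v : TangentSpace 𝓘(ℝ, EG) (1 : G))
    (hv : (mfderiv 𝓘(ℝ, ES) 𝓘(ℝ, EG) φ 1 : ES →L[ℝ] EG) x = v) :
    ∃ γ : ℝ → S, γ 0 = 1 ∧
      IsMIntegralCurveAt (I := 𝓘(ℝ, EG)) (φ ∘ γ)
        (mulInvariantVectorField (I := 𝓘(ℝ, EG)) v) 0 := by
  have : CompleteSpace ES := FiniteDimensional.complete ℝ ES
  have : LieGroup 𝓘(ℝ, ES) (minSmoothness ℝ 3) S := by
    rw [minSmoothness_of_isRCLikeNormedField]; infer_instance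
  have : LieGroup 𝓘(ℝ, EG) (minSmoothness ℝ 3) G := by
    rw [minSmoothness_of_isRCLikeNormedField]; infer_instance
  have : IsManifold 𝓘(ℝ, ES) 1 S := IsManifold.of_le (n := ∞) (by simp)
  have hx := contMDiff_mulInvariantVectorField (I := 𝓘(ℝ, ES)) (G := S) x
  obtain ⟨γ, h0, hγ⟩ := exists_isMIntegralCurveAt_of_contMDiffAt_boundaryless
    (I := 𝓘(ℝ, ES)) (v := mulInvariantVectorField x) (x₀ := (1 : S)) 0
    ((hx.of_le (by simp)).contMDiffAt)
  refine ⟨γ, h0, hγ.mono fun t ht => ?_⟩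
  have hφd : MDifferentiable 𝓘(ℝ, ES) 𝓘(ℝ, EG) φ := hφ.mdifferentiable (by simp)
  have h1 := ((hφd (γ t)).hasMFDerivAt).comp t ht
  have hL : MDifferentiableAt 𝓘(ℝ, ES) 𝓘(ℝ, ES) (fun b => γ t * b) (1 : S) :=
    (contMDiff_mul_left (n := ∞)).mdifferentiableAt (by simp)
  have hL' : MDifferentiableAt 𝓘(ℝ, EG) 𝓘(ℝ, EG) (fun b => φ (γ t) * b) (1 : G) :=
    (contMDiff_mul_left (n := ∞)).mdifferentiableAt (by simp)
  -- Differentiating this identity at `1` shows that `φ` carries the left-invariant field of `x` to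
  -- that of `v` along `γ`.
  have e1 : (fun b => φ (γ t * b)) = fun b => φ (γ t) * φ b := by
    funext b; simp
  have e2 := tder_comp_of_eq (EM := ES) (f := fun b => γ t * b) (g := φ) (mul_one _) (hφd _) hL
  rw [e1, tder_comp_of_eq (EM := ES) (f := φ) (g := fun b => φ (γ t) * b) (map_one _) hL'
    (hφd _)] at e2
  have e3 : tder EG EG (fun b => φ (γ t) * b) 1 (tder ES EG φ 1 x) =
      tder ES EG φ (γ t) (tder ES ES (fun b => γ t * b) 1 x) :=
    congrArg (fun F : ES →L[ℝ] EG => F x) e2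
  subst hv
  refine h1.congr_mfderiv ?_
  ext
  have e4 : ∀ (w : EG), (ContinuousLinearMap.smulRight (1 : ℝ →L[ℝ] ℝ) w) 1 = w := by simp
  have e5 : ∀ (w : ES), (ContinuousLinearMap.smulRight (1 : ℝ →L[ℝ] ℝ) w) 1 = w := by simp
  refine (Eq.trans ?_ e3.symm).trans (e4 _).symm
  exact congrArg (tder ES EG φ (γ t)) (e5 _)

end Curves

section Dimension

variable {EM HM EN : Type*} [NormedAddCommGroup EM] [NormedSpace ℝ EM] [FiniteDimensional ℝ EM]
  [TopologicalSpace HM] {I : ModelWithCorners ℝ EM HM} [I.Boundaryless]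
  [NormedAddCommGroup EN] [NormedSpace ℝ EN] [FiniteDimensional ℝ EN]
  {M N : Type*} [TopologicalSpace M] [ChartedSpace HM M] [IsManifold I 1 M]
  [SecondCountableTopology M] [TopologicalSpace N] [ChartedSpace EN N]
  [IsManifold 𝓘(ℝ, EN) 1 N]

/-- A `C¹` map of a second countable manifold onto a manifold does not raise the dimension. -/
theorem finrank_le_of_surjective_contMDiff [Nonempty N] (f : M → N) (hf : ContMDiff I 𝓘(ℝ, EN) 1 f)
    (hs : Function.Surjective f) : Module.finrank ℝ EN ≤ Module.finrank ℝ EM := by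
  obtain ⟨y⟩ := ‹Nonempty N›
  set c := extChartAt 𝓘(ℝ, EN) y with hc
  set s : Set M := f ⁻¹' c.source with hsdef
  have hopen : IsOpen s := (isOpen_extChartAt_source y).preimage hf.continuous
  -- In charts the map is `C¹` on a small ball, and a `C¹` map on a convex set does not raise the
  -- Hausdorff dimension.
  have key : ∀ x ∈ s, ∃ U ∈ 𝓝 x, dimH ((c ∘ f) '' U) ≤ Module.finrank ℝ EM := by
    intro x hx
    have h1 : ContMDiffAt 𝓘(ℝ, EM) 𝓘(ℝ, EN) 1 (c ∘ f ∘ (extChartAt I x).symm)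
        (extChartAt I x x) := by
      have hsymm : ContMDiffAt 𝓘(ℝ, EM) I 1 (extChartAt I x).symm (extChartAt I x x) :=
        (contMDiffOn_extChartAt_symm x).contMDiffAt (extChartAt_target_mem_nhds x)
      refine ContMDiffAt.comp (I' := 𝓘(ℝ, EN)) _ ?_ (hf.contMDiffAt.comp _ hsymm)
      apply contMDiffAt_extChartAt'
      simpa [hsdef, hc] using hx
    rw [contMDiffAt_iff_contDiffAt] at h1
    obtain ⟨u, hu, hcd⟩ := h1.contDiffOn (m := 1) le_rfl (by simp)
    obtain ⟨r, hr, hball⟩ := Metric.mem_nhds_iff.1 hu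
    refine ⟨(extChartAt I x).source ∩ extChartAt I x ⁻¹' Metric.ball (extChartAt I x x) r,
      Filter.inter_mem (extChartAt_source_mem_nhds x)
        ((continuousAt_extChartAt x).preimage_mem_nhds (Metric.ball_mem_nhds _ hr)), ?_⟩
    have hsub : (c ∘ f) '' ((extChartAt I x).source ∩
        extChartAt I x ⁻¹' Metric.ball (extChartAt I x x) r) ⊆
        (c ∘ f ∘ (extChartAt I x).symm) '' Metric.ball (extChartAt I x x) r := by
      rintro _ ⟨z, ⟨hz1, hz2⟩, rfl⟩
      exact ⟨extChartAt I x z, hz2, by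
        simp only [Function.comp_apply, (extChartAt I x).left_inv hz1]⟩
    calc _ ≤ _ := dimH_mono hsub
      _ ≤ _ := (hcd.mono hball).dimH_image_le (convex_ball _ _) subset_rfl
      _ ≤ _ := dimH_mono (Set.subset_univ _)
      _ = _ := Real.dimH_univ_eq_finrank EM
  choose! U hU hdim using key
  -- Countably many such neighbourhoods suffice, and the Hausdorff dimension of a countable union is
  -- the supremum. The images cover the target of a chart, whose Hausdorff dimension is that of
  -- `EN`.
  obtain ⟨t, hts, htc, hcov⟩ := TopologicalSpace.countable_cover_nhdsWithin
    (fun x hx => mem_nhdsWithin_of_mem_nhds (hU x hx))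
  have hsub : c.target ⊆ ⋃ x ∈ t, (c ∘ f) '' U x := by
    intro e he
    obtain ⟨x, hx⟩ := hs (c.symm e)
    have hxs : x ∈ s := by simpa [hsdef, hx] using c.map_target he
    obtain ⟨z, hz, hxz⟩ := Set.mem_iUnion₂.1 (hcov hxs)
    exact Set.mem_iUnion₂.2 ⟨z, hz, x, hxz, by simp [hx, c.right_inv he]⟩
  have h2 : (Module.finrank ℝ EN : ENNReal) ≤ Module.finrank ℝ EM := by
    rw [← Real.dimH_of_mem_nhds (extChartAt_target_mem_nhds (I := 𝓘(ℝ, EN)) y)]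
    refine (dimH_mono hsub).trans ?_
    rw [dimH_bUnion htc]
    exact iSup₂_le fun x hx => hdim x (hts hx)
  exact_mod_cast h2

end Dimension

/-! ### The Lie algebra of a double Lie group is the direct sum of those of its factors -/

namespace IsDoubleLieGroup

variable {EG EA EB : Type*}
  [NormedAddCommGroup EG] [NormedSpace ℝ EG]
  [NormedAddCommGroup EA] [NormedSpace ℝ EA]
  [NormedAddCommGroup EB] [NormedSpace ℝ EB]
  {G : Type*} [Group G] [TopologicalSpace G] [ChartedSpace EG G]
  {A B : Subgroup G} [ChartedSpace EA A] [ChartedSpace EB B]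

theorem injective_tder_left (h : IsDoubleLieGroup EG EA EB A B) (a : A) :
    Function.Injective (tder EA EG (fun a : A => (a : G)) a) := h.immersion_left a

theorem injective_tder_right (h : IsDoubleLieGroup EG EA EB A B) (b : B) :
    Function.Injective (tder EB EG (fun b : B => (b : G)) b) := h.immersion_right b

theorem eq_one_of_coe_eq (h : IsDoubleLieGroup EG EA EB A B) {a : A} {b : B}
    (hab : (a : G) = b) : a = 1 ∧ b = 1 := by
  have h1 : (a : G) ∈ A ⊓ B := ⟨a.2, hab ▸ b.2⟩
  rw [h.inf_eq_bot, Subgroup.mem_bot] at h1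
  exact ⟨Subtype.ext h1, Subtype.ext (hab ▸ h1)⟩

/-- A common vector `v` generates integral curves of the same left-invariant field of `G`, one
inside `A` and one inside `B`. By uniqueness they agree near `0`, hence stay in `A ∩ B = {e}`; the
curve is constant and `v = 0`. -/
theorem disjoint_subLieAlgebra [FiniteDimensional ℝ EG] [FiniteDimensional ℝ EA]
    [FiniteDimensional ℝ EB] (h : IsDoubleLieGroup EG EA EB A B) :
    Disjoint (subLieAlgebra EG EA A) (subLieAlgebra EG EB B) := by
  have := h.lieGroup
  have := h.lieGroup_left
  have := h.lieGroup_right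
  have : LieGroup 𝓘(ℝ, EG) (minSmoothness ℝ 3) G := by
    rw [minSmoothness_of_isRCLikeNormedField]; infer_instance
  have : IsManifold 𝓘(ℝ, EG) 1 G := IsManifold.of_le (n := ∞) (by simp)
  rw [Submodule.disjoint_def]
  rintro v ⟨x, hx⟩ ⟨y, hy⟩
  obtain ⟨γ, h0, hγ⟩ := exists_isMIntegralCurveAt_comp A.subtype h.contMDiff_left x v hx
  obtain ⟨δ, h0', hδ⟩ := exists_isMIntegralCurveAt_comp B.subtype h.contMDiff_right y v hy
  have hvf := contMDiff_mulInvariantVectorField (I := 𝓘(ℝ, EG)) (G := G) v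
  have heq := isMIntegralCurveAt_eventuallyEq_of_contMDiffAt_boundaryless
    ((hvf.of_le (by simp)).contMDiffAt) hγ hδ (by simp [h0, h0'])
  have hconst : (A.subtype ∘ γ) =ᶠ[𝓝 0] fun _ => (1 : G) := by
    filter_upwards [heq] with t ht
    have := (h.eq_one_of_coe_eq (a := γ t) (b := δ t) ht).1
    simp [this]
  have h1 := hγ.hasMFDerivAt.congr_of_eventuallyEq hconst.symm
  have h2 := hasMFDerivAt_unique h1 (hasMFDerivAt_const (1 : G) (0 : ℝ))
  have h3 : mulInvariantVectorField (I := 𝓘(ℝ, EG)) v (1 : G) = (0 : EG) := by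
    have h4 := congrArg (fun F : ℝ →L[ℝ] EG => F 1) h2
    have e4 : ∀ (w : EG), (ContinuousLinearMap.smulRight (1 : ℝ →L[ℝ] ℝ) w) 1 = w := by simp
    have h5 : (mulInvariantVectorField (I := 𝓘(ℝ, EG)) v ((A.subtype ∘ γ) 0) : EG) = 0 :=
      (e4 _).symm.trans h4
    have h6 : (A.subtype ∘ γ) 0 = 1 := by simp [h0]
    rwa [h6] at h5
  have h7 : tder EG EG (fun g : G => 1 * g) 1 v = 0 := h3
  simp only [one_mul, tder_id] at h7
  exact h7

/-- The multiplication map `A × B → G` of a double Lie group. -/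
def mulMap (_h : IsDoubleLieGroup EG EA EB A B) (p : A × B) : G := p.1 * p.2

theorem contMDiff_mulMap (h : IsDoubleLieGroup EG EA EB A B) :
    ContMDiff (𝓘(ℝ, EA).prod 𝓘(ℝ, EB)) 𝓘(ℝ, EG) ∞ h.mulMap := by
  have := h.lieGroup
  exact (h.contMDiff_left.comp contMDiff_fst).mul (h.contMDiff_right.comp contMDiff_snd)

/-- Since `G = A B`, multiplication is a smooth surjection from the second countable manifold `A ×
B`. -/
theorem finrank_le [FiniteDimensional ℝ EG] [FiniteDimensional ℝ EA]
    [FiniteDimensional ℝ EB] [SecondCountableTopology G] (h : IsDoubleLieGroup EG EA EB A B) :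
    Module.finrank ℝ EG ≤ Module.finrank ℝ EA + Module.finrank ℝ EB := by
  have := h.lieGroup
  have := h.lieGroup_left
  have := h.lieGroup_right
  have : IsManifold 𝓘(ℝ, EG) 1 G := IsManifold.of_le (n := ∞) (by simp)
  have : IsManifold 𝓘(ℝ, EA) 1 A := IsManifold.of_le (n := ∞) (by simp)
  have : IsManifold 𝓘(ℝ, EB) 1 B := IsManifold.of_le (n := ∞) (by simp)
  have : SecondCountableTopology A := inferInstanceAs (SecondCountableTopology (A : Set G))
  have : SecondCountableTopology B := inferInstanceAs (SecondCountableTopology (B : Set G))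
  rw [← Module.finrank_prod]
  refine finrank_le_of_surjective_contMDiff (I := 𝓘(ℝ, EA).prod 𝓘(ℝ, EB)) h.mulMap
    (h.contMDiff_mulMap.of_le (by simp)) fun g => ?_
  obtain ⟨a, b, hab⟩ := h.exists_mul g
  exact ⟨(a, b), hab.symm⟩

/-- The sum is direct, so its dimension is `dim A + dim B`, which is at least `dim G`. -/
theorem isCompl_subLieAlgebra [FiniteDimensional ℝ EG] [FiniteDimensional ℝ EA]
    [FiniteDimensional ℝ EB] [SecondCountableTopology G] (h : IsDoubleLieGroup EG EA EB A B) :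
    IsCompl (subLieAlgebra EG EA A) (subLieAlgebra EG EB B) := by
  have hd := h.disjoint_subLieAlgebra
  refine ⟨hd, codisjoint_iff.2 ?_⟩
  have : FiniteDimensional ℝ (TangentSpace 𝓘(ℝ, EG) (1 : G)) :=
    inferInstanceAs (FiniteDimensional ℝ EG)
  apply Submodule.eq_top_of_finrank_eq
  have h1 := Submodule.finrank_sup_add_finrank_inf_eq
    (subLieAlgebra EG EA A) (subLieAlgebra EG EB B)
  have h2 : Module.finrank ℝ (subLieAlgebra EG EA A) = Module.finrank ℝ EA :=
    LinearMap.finrank_range_of_inj (h.injective_tder_left 1)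
  have h3 : Module.finrank ℝ (subLieAlgebra EG EB B) = Module.finrank ℝ EB :=
    LinearMap.finrank_range_of_inj (h.injective_tder_right 1)
  rw [hd.eq_bot, finrank_bot, h2, h3] at h1
  have h4 := h.finrank_le
  have h5 := Submodule.finrank_le (subLieAlgebra EG EA A ⊔ subLieAlgebra EG EB B)
  have h6 : Module.finrank ℝ (TangentSpace 𝓘(ℝ, EG) (1 : G)) = Module.finrank ℝ EG := rfl
  omega

end IsDoubleLieGroup

namespace IsDoubleLieGroup

variable {EG EA EB : Type*}
  [NormedAddCommGroup EG] [NormedSpace ℝ EG]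
  [NormedAddCommGroup EA] [NormedSpace ℝ EA]
  [NormedAddCommGroup EB] [NormedSpace ℝ EB]
  {G : Type*} [Group G] [TopologicalSpace G] [ChartedSpace EG G]
  {A B : Subgroup G} [ChartedSpace EA A] [ChartedSpace EB B]

/-! ### Algebra of the four projections -/

theorem aL_mul_bR (h : IsDoubleLieGroup EG EA EB A B) (g : G) : (h.aL g : G) * h.bR g = g :=
  (h.exists_mul g).choose_spec.choose_spec.symm

theorem bL_mul_aR (h : IsDoubleLieGroup EG EA EB A B) (g : G) : (h.bL g : G) * h.aR g = g :=
  (h.exists_mul' g).choose_spec.choose_spec.symm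

theorem mul_left_inj (h : IsDoubleLieGroup EG EA EB A B) {a a' : A} {b b' : B}
    (hab : (a : G) * b = a' * b') : a = a' ∧ b = b' := by
  have h1 : ((a'⁻¹ * a : A) : G) = ((b' * b⁻¹ : B) : G) := by
    push_cast
    rw [eq_mul_inv_iff_mul_eq, mul_assoc, hab]; group
  obtain ⟨h2, h3⟩ := h.eq_one_of_coe_eq h1
  exact ⟨(inv_mul_eq_one.1 h2).symm, (mul_inv_eq_one.1 h3).symm⟩

theorem mul_right_inj (h : IsDoubleLieGroup EG EA EB A B) {a a' : A} {b b' : B}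
    (hab : (b : G) * a = b' * a') : b = b' ∧ a = a' := by
  have h1 : ((a⁻¹ : A) : G) * ((b⁻¹ : B) : G) = ((a'⁻¹ : A) : G) * ((b'⁻¹ : B) : G) := by
    push_cast
    rw [← mul_inv_rev, hab, mul_inv_rev]
  obtain ⟨h2, h3⟩ := h.mul_left_inj h1
  exact ⟨inv_injective h3, inv_injective h2⟩

theorem aL_eq (h : IsDoubleLieGroup EG EA EB A B) {g : G} {a : A} {b : B}
    (hg : g = a * b) : h.aL g = a :=
  (h.mul_left_inj ((h.aL_mul_bR g).trans hg)).1

theorem bR_eq (h : IsDoubleLieGroup EG EA EB A B) {g : G} {a : A} {b : B}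
    (hg : g = a * b) : h.bR g = b :=
  (h.mul_left_inj ((h.aL_mul_bR g).trans hg)).2

theorem bL_eq (h : IsDoubleLieGroup EG EA EB A B) {g : G} {b : B} {a : A}
    (hg : g = b * a) : h.bL g = b :=
  (h.mul_right_inj ((h.bL_mul_aR g).trans hg)).1

theorem aR_eq (h : IsDoubleLieGroup EG EA EB A B) {g : G} {b : B} {a : A}
    (hg : g = b * a) : h.aR g = a :=
  (h.mul_right_inj ((h.bL_mul_aR g).trans hg)).2

/-- Inverting one factorization of `g⁻¹` gives the other one of `g`; smoothness of `b_L` and `a_R`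
is deduced this way from that of `b_R` and `a_L`. -/
theorem bL_eq_inv (h : IsDoubleLieGroup EG EA EB A B) (g : G) : h.bL g = (h.bR g⁻¹)⁻¹ :=
  h.bL_eq (a := (h.aL g⁻¹)⁻¹) (by
    push_cast; rw [← mul_inv_rev, h.aL_mul_bR, inv_inv])

theorem aR_eq_inv (h : IsDoubleLieGroup EG EA EB A B) (g : G) : h.aR g = (h.aL g⁻¹)⁻¹ :=
  h.aR_eq (b := (h.bR g⁻¹)⁻¹) (by
    push_cast; rw [← mul_inv_rev, h.aL_mul_bR, inv_inv])

/-- This equivariance reduces local questions about the projections to the identity element. -/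
theorem aL_mul_mul (h : IsDoubleLieGroup EG EA EB A B) (a : A) (g : G) (b : B) :
    h.aL (a * g * b) = a * h.aL g :=
  h.aL_eq (b := h.bR g * b) (by
    push_cast; conv_lhs => rw [← h.aL_mul_bR g]
    simp only [mul_assoc])

theorem bR_mul_mul (h : IsDoubleLieGroup EG EA EB A B) (a : A) (g : G) (b : B) :
    h.bR (a * g * b) = h.bR g * b :=
  h.bR_eq (a := a * h.aL g) (by
    push_cast; conv_lhs => rw [← h.aL_mul_bR g]
    simp only [mul_assoc])

/-! ### Projections of `s_A(g)`, `g⁻¹` and of a product in the groupoid -/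

/-- The definition exhibits the `A B` factorization of `s_A(g)`; this form exhibits the `B A`
factorization. -/
theorem sA_eq (h : IsDoubleLieGroup EG EA EB A B) (g : G) :
    h.sA g = (h.bL g : G)⁻¹ * h.aL g := by
  rw [sA, eq_inv_mul_iff_mul_eq, ← mul_assoc, h.bL_mul_aR, mul_inv_eq_iff_eq_mul, h.aL_mul_bR]

theorem aL_sA (h : IsDoubleLieGroup EG EA EB A B) (g : G) : h.aL (h.sA g) = h.aR g :=
  h.aL_eq (b := (h.bR g)⁻¹) (by push_cast; rfl)

theorem bR_sA (h : IsDoubleLieGroup EG EA EB A B) (g : G) : h.bR (h.sA g) = (h.bR g)⁻¹ :=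
  h.bR_eq (a := h.aR g) (by push_cast; rfl)

theorem bL_sA (h : IsDoubleLieGroup EG EA EB A B) (g : G) : h.bL (h.sA g) = (h.bL g)⁻¹ :=
  h.bL_eq (a := h.aL g) (by push_cast; exact h.sA_eq g)

theorem aR_sA (h : IsDoubleLieGroup EG EA EB A B) (g : G) : h.aR (h.sA g) = h.aL g :=
  h.aR_eq (b := (h.bL g)⁻¹) (by push_cast; exact h.sA_eq g)

theorem sA_sA (h : IsDoubleLieGroup EG EA EB A B) (g : G) : h.sA (h.sA g) = g := by
  rw [sA, aR_sA, bR_sA]; push_cast; rw [inv_inv, aL_mul_bR]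

theorem aL_inv (h : IsDoubleLieGroup EG EA EB A B) (g : G) : h.aL g⁻¹ = (h.aR g)⁻¹ := by
  rw [aR_eq_inv, inv_inv]

theorem bR_inv (h : IsDoubleLieGroup EG EA EB A B) (g : G) : h.bR g⁻¹ = (h.bL g)⁻¹ := by
  rw [bL_eq_inv, inv_inv]

theorem bL_inv (h : IsDoubleLieGroup EG EA EB A B) (g : G) : h.bL g⁻¹ = (h.bR g)⁻¹ := by
  rw [bL_eq_inv, inv_inv]

theorem aR_inv (h : IsDoubleLieGroup EG EA EB A B) (g : G) : h.aR g⁻¹ = (h.aL g)⁻¹ := by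
  rw [aR_eq_inv, inv_inv]

/-- This commutation is what makes `R` compatible with the star operation. -/
theorem sA_inv (h : IsDoubleLieGroup EG EA EB A B) (g : G) : h.sA g⁻¹ = (h.sA g)⁻¹ := by
  rw [sA_eq h g, sA, aR_inv, bR_inv]; push_cast; group

/-- With `y = a_L(g) b`, the left-hand side is the groupoid product `s_A(y) g` that occurs in the
convolution. The right-hand side is its `A B` factorization; in particular its target is `a_R(y)`.
-/
theorem bL_inv_mul_eq (h : IsDoubleLieGroup EG EA EB A B) (g : G) (b : B) :
    (h.bL (h.aL g * (b : G)) : G)⁻¹ * g =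
      h.aR (h.aL g * (b : G)) * ((b⁻¹ * h.bR g : B) : G) := by
  rw [inv_mul_eq_iff_eq_mul, ← mul_assoc, bL_mul_aR]
  push_cast
  rw [mul_assoc, mul_inv_cancel_left, aL_mul_bR]

theorem bL_coe_right (h : IsDoubleLieGroup EG EA EB A B) (b : B) : h.bL b = b :=
  h.bL_eq (a := 1) (by simp)

theorem bL_coe_left (h : IsDoubleLieGroup EG EA EB A B) (a : A) : h.bL a = 1 :=
  h.bL_eq (a := a) (by simp)

theorem bR_coe_right (h : IsDoubleLieGroup EG EA EB A B) (b : B) : h.bR b = b :=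
  h.bR_eq (a := 1) (by simp)

theorem bR_coe_left (h : IsDoubleLieGroup EG EA EB A B) (a : A) : h.bR a = 1 :=
  h.bR_eq (a := a) (by simp)

/-! ### Smoothness of the projections -/

variable [FiniteDimensional ℝ EG] [FiniteDimensional ℝ EA] [FiniteDimensional ℝ EB]
  [SecondCountableTopology G]

/-- The inverse function theorem applies to multiplication `A × B → G` in charts, since its
derivative at `(e, e)` is `(u, v) ↦ u + v` on `𝔞 ⊕ 𝔟 = 𝔤`. Uniqueness of the factorization
identifies the components of the local inverse with the projections. -/
theorem contMDiffAt_aL_bR_one (h : IsDoubleLieGroup EG EA EB A B) :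
    ContMDiffAt 𝓘(ℝ, EG) 𝓘(ℝ, EA) ∞ h.aL 1 ∧ ContMDiffAt 𝓘(ℝ, EG) 𝓘(ℝ, EB) ∞ h.bR 1 := by
  have := h.lieGroup
  have := h.lieGroup_left
  have := h.lieGroup_right
  have : CompleteSpace EA := FiniteDimensional.complete ℝ EA
  have : CompleteSpace EB := FiniteDimensional.complete ℝ EB
  set c := extChartAt 𝓘(ℝ, EG) (1 : G) with hc
  set cA := extChartAt 𝓘(ℝ, EA) (1 : A) with hcA
  set cB := extChartAt 𝓘(ℝ, EB) (1 : B) with hcB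
  have hsA : ContMDiffAt 𝓘(ℝ, EA) 𝓘(ℝ, EA) ∞ cA.symm (cA 1) :=
    (contMDiffOn_extChartAt_symm (1 : A)).contMDiffAt (extChartAt_target_mem_nhds (1 : A))
  have hsB : ContMDiffAt 𝓘(ℝ, EB) 𝓘(ℝ, EB) ∞ cB.symm (cB 1) :=
    (contMDiffOn_extChartAt_symm (1 : B)).contMDiffAt (extChartAt_target_mem_nhds (1 : B))
  have hcs : ContMDiffAt 𝓘(ℝ, EG) 𝓘(ℝ, EG) ∞ c 1 := contMDiffAt_extChartAt
  have hA1 : cA.symm (cA 1) = 1 := extChartAt_to_inv (I := 𝓘(ℝ, EA)) (1 : A)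
  have hB1 : cB.symm (cB 1) = 1 := extChartAt_to_inv (I := 𝓘(ℝ, EB)) (1 : B)
  let F : EA × EB → EG := fun p => c ((cA.symm p.1 : G) * (cB.symm p.2 : G))
  let p0 : EA × EB := (cA 1, cB 1)
  have hF0 : F p0 = c 1 := by simp [F, p0, hA1, hB1]
  have hcs' : ContMDiffAt 𝓘(ℝ, EG) 𝓘(ℝ, EG) ∞ c ((cA.symm p0.1 : G) * (cB.symm p0.2 : G)) := by
    simpa [p0, hA1, hB1] using hcs
  have hfst : ContMDiffAt 𝓘(ℝ, EA × EB) 𝓘(ℝ, EG) ∞ (fun p : EA × EB => (cA.symm p.1 : G)) p0 :=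
    h.contMDiff_left.contMDiffAt.comp p0 (ContMDiffAt.comp p0 hsA contDiff_fst.contMDiff.contMDiffAt)
  have hsnd : ContMDiffAt 𝓘(ℝ, EA × EB) 𝓘(ℝ, EG) ∞ (fun p : EA × EB => (cB.symm p.2 : G)) p0 :=
    h.contMDiff_right.contMDiffAt.comp p0 (ContMDiffAt.comp p0 hsB contDiff_snd.contMDiff.contMDiffAt)
  have hF : ContDiffAt ℝ ∞ F p0 :=
    contMDiffAt_iff_contDiffAt.1 (ContMDiffAt.comp p0 hcs' (hfst.mul hsnd))
  have hFd : HasFDerivAt F (fderiv ℝ F p0) p0 := (hF.differentiableAt (by simp)).hasFDerivAt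
  have hdA : ∀ u, fderiv ℝ F p0 (u, 0) = tder EA EG (fun a : A => (a : G)) 1 u := by
    intro u
    have h1 : HasFDerivAt (fun x : EA => F (x, cB 1))
        ((fderiv ℝ F p0).comp (ContinuousLinearMap.inl ℝ EA EB)) (cA 1) :=
      HasFDerivAt.comp (g := F) (f := fun x : EA => (x, cB 1)) (cA 1) hFd
        (hasFDerivAt_prodMk_left (𝕜 := ℝ) (cA 1) (cB 1))
    have h2 : (fun x : EA => F (x, cB 1)) =
        writtenInExtChartAt 𝓘(ℝ, EA) 𝓘(ℝ, EG) (1 : A) (fun a : A => (a : G)) := by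
      funext x
      simp only [F, hB1, OneMemClass.coe_one, mul_one]
      rfl
    have h3 : tder EA EG (fun a : A => (a : G)) 1 = fderiv ℝ (fun x : EA => F (x, cB 1)) (cA 1) := by
      rw [h2, tder, (h.contMDiff_left.mdifferentiable (by simp) 1).mfderiv]
      simp only [modelWithCornersSelf_coe, Set.range_id, fderivWithin_univ]
      rfl
    rw [h3, h1.fderiv]; rfl
  have hdB : ∀ u, fderiv ℝ F p0 (0, u) = tder EB EG (fun b : B => (b : G)) 1 u := by
    intro u
    have h1 : HasFDerivAt (fun x : EB => F (cA 1, x))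
        ((fderiv ℝ F p0).comp (ContinuousLinearMap.inr ℝ EA EB)) (cB 1) :=
      HasFDerivAt.comp (g := F) (f := fun x : EB => (cA 1, x)) (cB 1) hFd
        (hasFDerivAt_prodMk_right (𝕜 := ℝ) (cA 1) (cB 1))
    have h2 : (fun x : EB => F (cA 1, x)) =
        writtenInExtChartAt 𝓘(ℝ, EB) 𝓘(ℝ, EG) (1 : B) (fun b : B => (b : G)) := by
      funext x
      simp only [F, hA1, OneMemClass.coe_one, one_mul]
      rfl
    have h3 : tder EB EG (fun b : B => (b : G)) 1 = fderiv ℝ (fun x : EB => F (cA 1, x)) (cB 1) := by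
      rw [h2, tder, (h.contMDiff_right.mdifferentiable (by simp) 1).mfderiv]
      simp only [modelWithCornersSelf_coe, Set.range_id, fderivWithin_univ]
      rfl
    rw [h3, h1.fderiv]; rfl
  have hd : ∀ u v, fderiv ℝ F p0 (u, v) = tder EA EG (fun a : A => (a : G)) 1 u +
      tder EB EG (fun b : B => (b : G)) 1 v := by
    intro u v
    rw [← hdA, ← hdB, ← map_add]; simp
  have hcompl := h.isCompl_subLieAlgebra
  -- Injectivity uses `𝔞 ∩ 𝔟 = 0` together with the two immersions; surjectivity uses `𝔞 + 𝔟 = 𝔤`.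
  have hbij : Function.Bijective (fderiv ℝ F p0) := by
    constructor
    · rw [injective_iff_map_eq_zero]
      rintro ⟨u, v⟩ huv
      rw [hd] at huv
      have h1 : tder EA EG (fun a : A => (a : G)) 1 u = 0 := by
        refine Submodule.disjoint_def.1 hcompl.disjoint
          (tder EA EG (fun a : A => (a : G)) 1 u) ⟨u, rfl⟩ ⟨-v, ?_⟩
        refine (map_neg (tder EB EG (fun b : B => (b : G)) 1) v).trans ?_
        exact (eq_neg_of_add_eq_zero_left huv).symm
      have h2 : tder EB EG (fun b : B => (b : G)) 1 v = 0 := by rwa [h1, zero_add] at huv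
      rw [h.injective_tder_left 1 (h1.trans (map_zero _).symm),
        h.injective_tder_right 1 (h2.trans (map_zero _).symm)]
      rfl
    · intro w
      have h1 : ∀ w : TangentSpace 𝓘(ℝ, EG) (1 : G),
          ∃ y ∈ subLieAlgebra EG EA A, ∃ z ∈ subLieAlgebra EG EB B, y + z = w := by
        intro w
        rw [← Submodule.mem_sup, hcompl.sup_eq_top]; trivial
      obtain ⟨_, ⟨u, rfl⟩, _, ⟨v, rfl⟩, huv⟩ := h1 w
      exact ⟨(u, v), (hd u v).trans huv⟩
  let e : (EA × EB) ≃L[ℝ] EG :=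
    LinearEquiv.toContinuousLinearEquiv
      (LinearEquiv.ofBijective ((fderiv ℝ F p0 : EA × EB →L[ℝ] EG) : EA × EB →ₗ[ℝ] EG) hbij)
  have hFe : HasFDerivAt F (e : EA × EB →L[ℝ] EG) p0 := by
    convert! hFd using 1
  let H := hF.localInverse hFe (by simp)
  have hH : ContDiffAt ℝ ∞ H (c 1) := by
    rw [← hF0]; exact hF.to_localInverse hFe (by simp)
  have hH0 : H (c 1) = p0 := by
    rw [← hF0]; exact hF.localInverse_apply_image hFe (by simp)
  have hHr : ∀ᶠ y in 𝓝 (c 1), F (H y) = y := by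
    rw [← hF0]
    exact (hF.hasStrictFDerivAt' hFe (by simp)).eventually_right_inverse
  have hHc : ContMDiffAt 𝓘(ℝ, EG) 𝓘(ℝ, EA × EB) ∞ (fun g : G => H (c g)) 1 :=
    ContMDiffAt.comp (1 : G) (g := H) hH.contMDiffAt hcs
  have hσA : ContMDiffAt 𝓘(ℝ, EG) 𝓘(ℝ, EA) ∞ (fun g : G => cA.symm (H (c g)).1) 1 := by
    refine ContMDiffAt.comp (I' := 𝓘(ℝ, EA)) (1 : G) (g := cA.symm) ?_
      (ContMDiffAt.comp (1 : G) (g := Prod.fst) contDiff_fst.contMDiff.contMDiffAt hHc)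
    simpa [hH0] using hsA
  have hσB : ContMDiffAt 𝓘(ℝ, EG) 𝓘(ℝ, EB) ∞ (fun g : G => cB.symm (H (c g)).2) 1 := by
    refine ContMDiffAt.comp (I' := 𝓘(ℝ, EB)) (1 : G) (g := cB.symm) ?_
      (ContMDiffAt.comp (1 : G) (g := Prod.snd) contDiff_snd.contMDiff.contMDiffAt hHc)
    simpa [hH0] using hsB
  -- `F (H y) = y` is an identity between chart values. It yields one in `G` only where the product
  -- stays in the chart domain, on which the chart is injective.
  have hmul : ∀ᶠ g : G in 𝓝 1,
      ((cA.symm (H (c g)).1 : G) * (cB.symm (H (c g)).2 : G)) ∈ c.source := by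
    have hcont : ContinuousAt
        (fun g : G => (cA.symm (H (c g)).1 : G) * (cB.symm (H (c g)).2 : G)) 1 :=
      ((h.contMDiff_left.contMDiffAt.comp (1 : G) hσA).mul
        (h.contMDiff_right.contMDiffAt.comp (1 : G) hσB)).continuousAt
    apply hcont.preimage_mem_nhds
    simp only [hH0, p0, hA1, hB1, OneMemClass.coe_one, mul_one]
    exact extChartAt_source_mem_nhds (I := 𝓘(ℝ, EG)) (1 : G)
  have hev : ∀ᶠ g : G in 𝓝 1,
      g = (cA.symm (H (c g)).1 : G) * (cB.symm (H (c g)).2 : G) := by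
    filter_upwards [hmul, hcs.continuousAt.eventually hHr,
      extChartAt_source_mem_nhds (I := 𝓘(ℝ, EG)) (1 : G)] with g h1 h2 h3
    exact (c.injOn h1 h3 h2).symm
  exact ⟨hσA.congr_of_eventuallyEq (hev.mono fun g hg => h.aL_eq hg),
    hσB.congr_of_eventuallyEq (hev.mono fun g hg => h.bR_eq hg)⟩

/-- Left translation by `a_L(g)⁻¹` and right translation by `b_R(g)⁻¹` bring `g` to `e`, and `a_L`
changes under them only by a left translation in `A`. -/
theorem contMDiff_aL (h : IsDoubleLieGroup EG EA EB A B) :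
    ContMDiff 𝓘(ℝ, EG) 𝓘(ℝ, EA) ∞ h.aL := by
  have := h.lieGroup
  have := h.lieGroup_left
  intro g
  have h1 : h.aL = fun x => h.aL g * h.aL (((h.aL g : G)⁻¹ * x) * (h.bR g : G)⁻¹) := by
    funext x
    have := h.aL_mul_mul (h.aL g) (((h.aL g : G)⁻¹ * x) * (h.bR g : G)⁻¹) (h.bR g)
    rw [← this]; congr 1; group
  rw [h1]
  refine contMDiffAt_const.mul (ContMDiffAt.comp (I' := 𝓘(ℝ, EG)) g (g := h.aL) ?_
    ((contMDiffAt_const.mul contMDiffAt_id).mul contMDiffAt_const))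
  have h2 : ((h.aL g : G)⁻¹ * g) * (h.bR g : G)⁻¹ = 1 := by
    rw [mul_inv_eq_one, inv_mul_eq_iff_eq_mul, h.aL_mul_bR]
  simp only [h2]
  exact h.contMDiffAt_aL_bR_one.1

theorem contMDiff_bR (h : IsDoubleLieGroup EG EA EB A B) :
    ContMDiff 𝓘(ℝ, EG) 𝓘(ℝ, EB) ∞ h.bR := by
  have := h.lieGroup
  have := h.lieGroup_right
  intro g
  have h1 : h.bR = fun x => h.bR (((h.aL g : G)⁻¹ * x) * (h.bR g : G)⁻¹) * h.bR g := by
    funext x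
    have := h.bR_mul_mul (h.aL g) (((h.aL g : G)⁻¹ * x) * (h.bR g : G)⁻¹) (h.bR g)
    rw [← this]; congr 1; group
  rw [h1]
  refine ContMDiffAt.mul (ContMDiffAt.comp (I' := 𝓘(ℝ, EG)) g (g := h.bR) ?_
    ((contMDiffAt_const.mul contMDiffAt_id).mul contMDiffAt_const)) contMDiffAt_const
  have h2 : ((h.aL g : G)⁻¹ * g) * (h.bR g : G)⁻¹ = 1 := by
    rw [mul_inv_eq_one, inv_mul_eq_iff_eq_mul, h.aL_mul_bR]
  simp only [h2]
  exact h.contMDiffAt_aL_bR_one.2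

theorem contMDiff_aR (h : IsDoubleLieGroup EG EA EB A B) :
    ContMDiff 𝓘(ℝ, EG) 𝓘(ℝ, EA) ∞ h.aR := by
  have := h.lieGroup
  have := h.lieGroup_left
  rw [show h.aR = fun g => (h.aL g⁻¹)⁻¹ from funext h.aR_eq_inv]
  exact (h.contMDiff_aL.comp (contMDiff_inv _ _)).inv

theorem contMDiff_bL (h : IsDoubleLieGroup EG EA EB A B) :
    ContMDiff 𝓘(ℝ, EG) 𝓘(ℝ, EB) ∞ h.bL := by
  have := h.lieGroup
  have := h.lieGroup_right
  rw [show h.bL = fun g => (h.bR g⁻¹)⁻¹ from funext h.bL_eq_inv]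
  exact (h.contMDiff_bR.comp (contMDiff_inv _ _)).inv

theorem contMDiff_sA (h : IsDoubleLieGroup EG EA EB A B) :
    ContMDiff 𝓘(ℝ, EG) 𝓘(ℝ, EG) ∞ h.sA := by
  have := h.lieGroup
  exact (h.contMDiff_left.comp h.contMDiff_aR).mul
    (h.contMDiff_right.comp h.contMDiff_bR).inv

end IsDoubleLieGroup

/-! ### The adjoint representation -/

/-- By the Leibniz formula this is a polynomial in matrix entries that are linear in `T`. -/
theorem contDiff_det_comp {E W : Type*} [NormedAddCommGroup E] [NormedSpace ℝ E]
    [FiniteDimensional ℝ E] [AddCommGroup W] [Module ℝ W] [FiniteDimensional ℝ W]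
    (ι : W →ₗ[ℝ] E) (D : E →ₗ[ℝ] W) :
    ContDiff ℝ ∞ (fun T : E →L[ℝ] E => LinearMap.det (D ∘ₗ (T : E →ₗ[ℝ] E) ∘ₗ ι)) := by
  set b := Module.finBasis ℝ W
  simp_rw [← LinearMap.det_toMatrix b, Matrix.det_apply]
  refine ContDiff.sum fun σ _ => ContDiff.const_smul _ (contDiff_prod fun i _ => ?_)
  simp only [LinearMap.toMatrix_apply, LinearMap.comp_apply]
  exact (LinearMap.toContinuousLinearMap (b.coord (σ i) ∘ₗ D)).contDiff.comp
    (contDiff_id.clm_apply (contDiff_const (c := ι (b i))))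

section Ad

/-- With constant base points no change of trivialization occurs. Smoothness of a family of
derivatives can thus be read as smoothness of a map into a fixed space of linear maps. -/
theorem inTangentCoordinates_const_const {E F M N P : Type*} [NormedAddCommGroup E]
    [NormedSpace ℝ E] [NormedAddCommGroup F] [NormedSpace ℝ F] [TopologicalSpace M]
    [ChartedSpace E M] [IsManifold 𝓘(ℝ, E) 1 M] [TopologicalSpace N] [ChartedSpace F N]
    [IsManifold 𝓘(ℝ, F) 1 N] (x : M) (y : N) (φ : P → E →L[ℝ] F) (p₀ : P) :
    inTangentCoordinates 𝓘(ℝ, E) 𝓘(ℝ, F) (fun _ => x) (fun _ => y) φ p₀ = φ := by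
  funext p
  rw [inTangentCoordinates_eq]
  · ext v
    simp only [ContinuousLinearMap.comp_apply]
    rw [(tangentBundleCore 𝓘(ℝ, E) M).coordChange_self _ _ (mem_chart_source E x),
      (tangentBundleCore 𝓘(ℝ, F) N).coordChange_self _ _ (mem_chart_source F y)]
  · exact mem_chart_source E x
  · exact mem_chart_source F y

variable {EG : Type*} [NormedAddCommGroup EG] [NormedSpace ℝ EG]
  {G : Type*} [Group G] [TopologicalSpace G] [ChartedSpace EG G] [LieGroup 𝓘(ℝ, EG) ∞ G]

theorem mdifferentiable_conj (g : G) :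
    MDifferentiable 𝓘(ℝ, EG) 𝓘(ℝ, EG) (fun x : G => g * x * g⁻¹) :=
  ((contMDiff_const.mul contMDiff_id).mul contMDiff_const :
    ContMDiff 𝓘(ℝ, EG) 𝓘(ℝ, EG) ∞ fun x : G => g * x * g⁻¹).mdifferentiable (by simp)

omit [LieGroup 𝓘(ℝ, EG) ∞ G] in
theorem Ad_one : Ad EG (1 : G) = LinearMap.id := by
  ext v
  have h1 : tder EG EG (fun x : G => 1 * x * 1⁻¹) 1 v = v := by
    simp only [one_mul, inv_one, mul_one, tder_id]
    rfl
  exact h1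

theorem Ad_mul (g k : G) : Ad EG (g * k) = Ad EG g ∘ₗ Ad EG k := by
  ext v
  have h1 := tder_comp_of_eq (EM := EG) (EN := EG) (EP := EG) (x := (1 : G)) (y := 1)
    (f := fun x : G => k * x * k⁻¹) (g := fun x : G => g * x * g⁻¹) (by simp)
    (mdifferentiable_conj g 1) (mdifferentiable_conj k 1)
  have h2 : (fun x : G => g * k * x * (g * k)⁻¹) = fun x => g * (k * x * k⁻¹) * g⁻¹ := by
    funext x; group
  rw [← h2] at h1
  exact congrArg (fun F : EG →L[ℝ] EG => F v) h1

theorem det_Ad_mul (g k : G) :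
    LinearMap.det (Ad EG (g * k)) = LinearMap.det (Ad EG g) * LinearMap.det (Ad EG k) := by
  rw [Ad_mul, LinearMap.det_comp]

theorem det_Ad_ne_zero (g : G) : LinearMap.det (Ad EG g) ≠ 0 := by
  intro h0
  have h1 := det_Ad_mul (EG := EG) g g⁻¹
  rw [mul_inv_cancel, Ad_one, LinearMap.det_id, h0, zero_mul] at h1
  exact one_ne_zero h1

/-- Conjugation by `s` maps `S` to itself, so the inclusion intertwines conjugation in `S` with
conjugation in `G`; differentiate at `1`. -/
theorem Ad_mem_subLieAlgebra {ES : Type*} [NormedAddCommGroup ES] [NormedSpace ℝ ES]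
    {S : Subgroup G} [ChartedSpace ES S] [LieGroup 𝓘(ℝ, ES) ∞ S]
    (hS : ContMDiff 𝓘(ℝ, ES) 𝓘(ℝ, EG) ∞ (fun s : S => (s : G))) (s : S)
    {v : TangentSpace 𝓘(ℝ, EG) (1 : G)} (hv : v ∈ subLieAlgebra EG ES S) :
    Ad EG (s : G) v ∈ subLieAlgebra EG ES S := by
  obtain ⟨x, rfl⟩ := hv
  refine ⟨tder ES ES (fun t : S => s * t * s⁻¹) 1 x, ?_⟩
  have hd := hS.mdifferentiable (by simp)
  have h1 := tder_comp_of_eq (EM := ES) (EN := ES) (EP := EG) (x := (1 : S)) (y := 1)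
    (f := fun t : S => s * t * s⁻¹) (g := fun t : S => (t : G)) (by simp)
    (hd 1) (mdifferentiable_conj s 1)
  have h2 := tder_comp_of_eq (EM := ES) (EN := EG) (EP := EG) (x := (1 : S)) (y := 1)
    (f := fun t : S => (t : G)) (g := fun x : G => (s : G) * x * (s : G)⁻¹) (by simp)
    (mdifferentiable_conj (s : G) 1) (hd 1)
  push_cast at h1
  rw [h2] at h1
  exact congrArg (fun F : ES →L[ℝ] EG => F x) h1.symm

theorem contMDiff_Ad : ContMDiff 𝓘(ℝ, EG) 𝓘(ℝ, EG →L[ℝ] EG) ∞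
    (fun g : G => tder EG EG (fun x : G => g * x * g⁻¹) 1) := by
  have : IsManifold 𝓘(ℝ, EG) 1 G := IsManifold.of_le (n := ∞) (by simp)
  intro g₀
  have h1 : ContMDiff (𝓘(ℝ, EG).prod 𝓘(ℝ, EG)) 𝓘(ℝ, EG) ∞
      (Function.uncurry fun g x : G => g * x * g⁻¹) :=
    (contMDiff_fst.mul contMDiff_snd).mul contMDiff_fst.inv
  have h2 := ContMDiffAt.mfderiv (m := ∞) (x₀ := g₀) (fun g x : G => g * x * g⁻¹)
    (fun _ => (1 : G)) h1.contMDiffAt contMDiffAt_const (by simp)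
  -- The derivative at `1` takes values at the base point `g * 1 * g⁻¹`, which must be recognized as
  -- constant before the tangent coordinates become trivial.
  have e : (fun g : G => g * 1 * g⁻¹) = fun _ => 1 := by funext g; simp
  have h3 := congrArg (fun F : G → G => inTangentCoordinates 𝓘(ℝ, EG) 𝓘(ℝ, EG)
    (fun _ : G => (1 : G)) F (fun g => tder EG EG (fun x : G => g * x * g⁻¹) 1) g₀) e
  rw [← inTangentCoordinates_const_const (1 : G) (1 : G)
    (fun g => tder EG EG (fun x : G => g * x * g⁻¹) 1) g₀]
  rw [← h3]
  exact h2

end Ad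

namespace IsDoubleLieGroup

variable {EG EA EB : Type*}
  [NormedAddCommGroup EG] [NormedSpace ℝ EG]
  [NormedAddCommGroup EA] [NormedSpace ℝ EA]
  [NormedAddCommGroup EB] [NormedSpace ℝ EB]
  {G : Type*} [Group G] [TopologicalSpace G] [ChartedSpace EG G]
  {A B : Subgroup G} [ChartedSpace EA A] [ChartedSpace EB B]

/-! ### The diagonal blocks of `Ad` and the function `Q` -/

/-- The determinant of the block of `Ad g` on the Lie algebra of `A`. -/
def blockA (_h : IsDoubleLieGroup EG EA EB A B) (g : G) : ℝ :=
  LinearMap.det (diagBlock (subLieAlgebra EG EA A) (subLieAlgebra EG EB B) (Ad EG g))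

/-- The determinant of the block of `Ad g` on the Lie algebra of `B`. -/
def blockB (_h : IsDoubleLieGroup EG EA EB A B) (g : G) : ℝ :=
  LinearMap.det (diagBlock (subLieAlgebra EG EB B) (subLieAlgebra EG EA A) (Ad EG g))

theorem Q_eq (h : IsDoubleLieGroup EG EA EB A B) (g : G) :
    h.Q g = LinearMap.det (Ad EG g) / (h.blockA g * h.blockB g) := rfl

theorem Ad_mem_left (h : IsDoubleLieGroup EG EA EB A B) (a : A) :
    ∀ v ∈ subLieAlgebra EG EA A, Ad EG (a : G) v ∈ subLieAlgebra EG EA A := by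
  have := h.lieGroup
  have := h.lieGroup_left
  exact fun v hv => Ad_mem_subLieAlgebra h.contMDiff_left a hv

theorem Ad_mem_right (h : IsDoubleLieGroup EG EA EB A B) (b : B) :
    ∀ v ∈ subLieAlgebra EG EB B, Ad EG (b : G) v ∈ subLieAlgebra EG EB B := by
  have := h.lieGroup
  have := h.lieGroup_right
  exact fun v hv => Ad_mem_subLieAlgebra h.contMDiff_right b hv

theorem finiteDimensional_tangentSpace_one [FiniteDimensional ℝ EG] (_h : IsDoubleLieGroup EG EA EB A B) :
    FiniteDimensional ℝ (TangentSpace 𝓘(ℝ, EG) (1 : G)) :=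
  inferInstanceAs (FiniteDimensional ℝ EG)

variable [FiniteDimensional ℝ EG] [FiniteDimensional ℝ EA] [FiniteDimensional ℝ EB]
  [SecondCountableTopology G]

/-- `Ad a` preserves `𝔞`, so the `𝔞`-block is multiplicative with a right factor from `A`. In the
same way it is multiplicative with a left factor from `B`, since `Ad b` preserves the complement
`𝔟`. -/
theorem blockA_mul_coe (h : IsDoubleLieGroup EG EA EB A B) (g : G) (a : A) :
    h.blockA (g * a) = h.blockA g * h.blockA a := by
  have := h.lieGroup
  rw [blockA, Ad_mul, diagBlock_comp_of_right h.isCompl_subLieAlgebra _ _ (h.Ad_mem_left a),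
    LinearMap.det_comp]; rfl

theorem blockA_coe_mul (h : IsDoubleLieGroup EG EA EB A B) (b : B) (g : G) :
    h.blockA (b * g) = h.blockA b * h.blockA g := by
  have := h.lieGroup
  rw [blockA, Ad_mul, diagBlock_comp_of_left h.isCompl_subLieAlgebra _ _ (h.Ad_mem_right b),
    LinearMap.det_comp]; rfl

theorem blockB_coe_mul (h : IsDoubleLieGroup EG EA EB A B) (a : A) (g : G) :
    h.blockB (a * g) = h.blockB a * h.blockB g := by
  have := h.lieGroup
  rw [blockB, Ad_mul, diagBlock_comp_of_left h.isCompl_subLieAlgebra.symm _ _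
    (h.Ad_mem_left a), LinearMap.det_comp]; rfl

theorem blockA_one (h : IsDoubleLieGroup EG EA EB A B) : h.blockA 1 = 1 := by
  rw [blockA, Ad_one, diagBlock_id h.isCompl_subLieAlgebra, LinearMap.det_id]

theorem blockB_one (h : IsDoubleLieGroup EG EA EB A B) : h.blockB 1 = 1 := by
  rw [blockB, Ad_one, diagBlock_id h.isCompl_subLieAlgebra.symm, LinearMap.det_id]

theorem det_Ad_coe_left (h : IsDoubleLieGroup EG EA EB A B) (a : A) :
    LinearMap.det (Ad EG (a : G)) = h.blockA a * h.blockB a := by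
  have := h.finiteDimensional_tangentSpace_one
  exact det_eq_det_diagBlock_mul h.isCompl_subLieAlgebra _ (h.Ad_mem_left a)

theorem det_Ad_coe_right (h : IsDoubleLieGroup EG EA EB A B) (b : B) :
    LinearMap.det (Ad EG (b : G)) = h.blockA b * h.blockB b := by
  have := h.finiteDimensional_tangentSpace_one
  exact det_eq_det_diagBlock_mul' h.isCompl_subLieAlgebra _ (h.Ad_mem_right b)

theorem blockA_mul_blockB_left_ne_zero (h : IsDoubleLieGroup EG EA EB A B) (a : A) :
    h.blockA a * h.blockB a ≠ 0 := by
  have := h.lieGroup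
  rw [← h.det_Ad_coe_left]; exact det_Ad_ne_zero _

theorem blockA_mul_blockB_right_ne_zero (h : IsDoubleLieGroup EG EA EB A B) (b : B) :
    h.blockA b * h.blockB b ≠ 0 := by
  have := h.lieGroup
  rw [← h.det_Ad_coe_right]; exact det_Ad_ne_zero _

/-- A block of an invertible map may well be singular; here `g = b_L a_R` reduces to elements of `A`
and `B`, for which `Ad` is block triangular. -/
theorem blockA_ne_zero (h : IsDoubleLieGroup EG EA EB A B) (g : G) : h.blockA g ≠ 0 := by
  rw [← h.bL_mul_aR g, blockA_coe_mul]
  exact mul_ne_zero (left_ne_zero_of_mul (h.blockA_mul_blockB_right_ne_zero _))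
    (left_ne_zero_of_mul (h.blockA_mul_blockB_left_ne_zero _))

theorem blockB_ne_zero (h : IsDoubleLieGroup EG EA EB A B) (g : G) : h.blockB g ≠ 0 := by
  rw [← h.aL_mul_bR g, blockB_coe_mul]
  exact mul_ne_zero (right_ne_zero_of_mul (h.blockA_mul_blockB_left_ne_zero _))
    (right_ne_zero_of_mul (h.blockA_mul_blockB_right_ne_zero _))

theorem blockA_coe_inv_left (h : IsDoubleLieGroup EG EA EB A B) (a : A) :
    h.blockA ((a⁻¹ : A) : G) = (h.blockA a)⁻¹ := by
  apply eq_inv_of_mul_eq_one_left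
  rw [← blockA_mul_coe, Subgroup.coe_inv, inv_mul_cancel, blockA_one]

theorem blockA_coe_inv_right (h : IsDoubleLieGroup EG EA EB A B) (b : B) :
    h.blockA ((b⁻¹ : B) : G) = (h.blockA b)⁻¹ := by
  apply eq_inv_of_mul_eq_one_left
  rw [← blockA_coe_mul, Subgroup.coe_inv, inv_mul_cancel, blockA_one]

theorem blockB_coe_inv_left (h : IsDoubleLieGroup EG EA EB A B) (a : A) :
    h.blockB ((a⁻¹ : A) : G) = (h.blockB a)⁻¹ := by
  apply eq_inv_of_mul_eq_one_left
  rw [← blockB_coe_mul, Subgroup.coe_inv, inv_mul_cancel, blockB_one]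

/-- `det Ad` and `blockB` are expanded along `a_L b_R`, `blockA` along `b_L a_R`; all `B`-blocks
cancel. The result makes the behaviour of `Q` under groupoid operations visible. -/
theorem Q_eq_blockA (h : IsDoubleLieGroup EG EA EB A B) (g : G) :
    h.Q g = h.blockA (h.aL g) * h.blockA (h.bR g) / (h.blockA (h.aR g) * h.blockA (h.bL g)) := by
  have := h.lieGroup
  have h1 : LinearMap.det (Ad EG g) =
      (h.blockA (h.aL g) * h.blockB (h.aL g)) * (h.blockA (h.bR g) * h.blockB (h.bR g)) := by
    conv_lhs => rw [← h.aL_mul_bR g]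
    rw [det_Ad_mul, h.det_Ad_coe_left, h.det_Ad_coe_right]
  have h2 : h.blockA g = h.blockA (h.bL g) * h.blockA (h.aR g) := by
    rw [← blockA_coe_mul, bL_mul_aR]
  have h3 : h.blockB g = h.blockB (h.aL g) * h.blockB (h.bR g) := by
    rw [← blockB_coe_mul, aL_mul_bR]
  rw [Q_eq, h1, h2, h3]
  have h4 := h.blockB_ne_zero (h.aL g)
  have h5 := h.blockB_ne_zero (h.bR g)
  have h6 := h.blockA_ne_zero (h.aR g)
  have h7 := h.blockA_ne_zero (h.bL g)
  field_simp

theorem Q_ne_zero (h : IsDoubleLieGroup EG EA EB A B) (g : G) : h.Q g ≠ 0 := by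
  have := h.lieGroup
  exact div_ne_zero (det_Ad_ne_zero g) (mul_ne_zero (h.blockA_ne_zero g) (h.blockB_ne_zero g))

theorem Q_sA (h : IsDoubleLieGroup EG EA EB A B) (g : G) : h.Q (h.sA g) = (h.Q g)⁻¹ := by
  rw [Q_eq_blockA, Q_eq_blockA, aL_sA, bR_sA, bL_sA, aR_sA]
  rw [blockA_coe_inv_right, blockA_coe_inv_right]
  have := h.blockA_ne_zero (h.aL g)
  have := h.blockA_ne_zero (h.bR g)
  have := h.blockA_ne_zero (h.aR g)
  have := h.blockA_ne_zero (h.bL g)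
  field_simp

theorem Q_inv (h : IsDoubleLieGroup EG EA EB A B) (g : G) : h.Q g⁻¹ = h.Q g := by
  rw [Q_eq_blockA, Q_eq_blockA, aL_inv, bR_inv, bL_inv, aR_inv]
  rw [blockA_coe_inv_right, blockA_coe_inv_right, blockA_coe_inv_left, blockA_coe_inv_left]
  have := h.blockA_ne_zero (h.aL g)
  have := h.blockA_ne_zero (h.bR g)
  have := h.blockA_ne_zero (h.aR g)
  have := h.blockA_ne_zero (h.bL g)
  field_simp

/-- The cocycle identity for the groupoid product `y (s_A(y) g) = g`: the `B`-components multiply,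
and the intermediate base point `a_R(y)` cancels. -/
theorem Q_mul_Q (h : IsDoubleLieGroup EG EA EB A B) (g : G) (b : B) :
    h.Q (h.aL g * (b : G)) * h.Q ((h.bL (h.aL g * (b : G)) : G)⁻¹ * g) = h.Q g := by
  set y := h.aL g * (b : G) with hy
  have e1 := h.bL_inv_mul_eq g b
  rw [← hy] at e1
  have e2 : (h.bL y : G)⁻¹ * g = (((h.bL y)⁻¹ * h.bL g : B) : G) * h.aR g := by
    push_cast; rw [mul_assoc, bL_mul_aR]
  rw [Q_eq_blockA, Q_eq_blockA, Q_eq_blockA, h.aL_eq hy, h.bR_eq hy, h.aL_eq e1, h.bR_eq e1,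
    h.bL_eq e2, h.aR_eq e2]
  rw [Subgroup.coe_mul, Subgroup.coe_mul, blockA_coe_mul, blockA_coe_mul, blockA_coe_inv_right,
    blockA_coe_inv_right]
  have := h.blockA_ne_zero (h.aL g)
  have := h.blockA_ne_zero b
  have := h.blockA_ne_zero (h.aR g)
  have := h.blockA_ne_zero (h.bL g)
  have := h.blockA_ne_zero (h.aR y)
  have := h.blockA_ne_zero (h.bL y)
  field_simp

omit [FiniteDimensional ℝ EA] [FiniteDimensional ℝ EB] [SecondCountableTopology G] in
theorem contMDiff_det_comp_Ad (h : IsDoubleLieGroup EG EA EB A B) {W : Type*} [AddCommGroup W]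
    [Module ℝ W] [FiniteDimensional ℝ W] (ι : W →ₗ[ℝ] TangentSpace 𝓘(ℝ, EG) (1 : G))
    (D : TangentSpace 𝓘(ℝ, EG) (1 : G) →ₗ[ℝ] W) :
    ContMDiff 𝓘(ℝ, EG) 𝓘(ℝ, ℝ) ∞ fun g : G => LinearMap.det (D ∘ₗ Ad EG g ∘ₗ ι) := by
  have := h.lieGroup
  have := h.finiteDimensional_tangentSpace_one
  exact (contDiff_det_comp (E := EG) ι D).contMDiff.comp contMDiff_Ad

omit [FiniteDimensional ℝ EA] [FiniteDimensional ℝ EB] [SecondCountableTopology G] in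
theorem contMDiff_blockA (h : IsDoubleLieGroup EG EA EB A B) :
    ContMDiff 𝓘(ℝ, EG) 𝓘(ℝ, ℝ) ∞ h.blockA := by
  have := h.finiteDimensional_tangentSpace_one
  exact h.contMDiff_det_comp_Ad (subLieAlgebra EG EA A).subtype
    (projOnto (subLieAlgebra EG EA A) (subLieAlgebra EG EB B))

omit [FiniteDimensional ℝ EA] [FiniteDimensional ℝ EB] [SecondCountableTopology G] in
theorem contMDiff_blockB (h : IsDoubleLieGroup EG EA EB A B) :
    ContMDiff 𝓘(ℝ, EG) 𝓘(ℝ, ℝ) ∞ h.blockB := by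
  have := h.finiteDimensional_tangentSpace_one
  exact h.contMDiff_det_comp_Ad (subLieAlgebra EG EB B).subtype
    (projOnto (subLieAlgebra EG EB B) (subLieAlgebra EG EA A))

/-- `Q` is smooth. -/
theorem contMDiff_Q (h : IsDoubleLieGroup EG EA EB A B) :
    ContMDiff 𝓘(ℝ, EG) 𝓘(ℝ, ℝ) ∞ h.Q := by
  have := h.finiteDimensional_tangentSpace_one
  have h1 := h.contMDiff_det_comp_Ad LinearMap.id LinearMap.id
  intro g
  have h4 : ContMDiffAt 𝓘(ℝ, EG) 𝓘(ℝ, ℝ) ∞ (fun g => (h.blockA g * h.blockB g)⁻¹) g :=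
    ContMDiffAt.comp (I' := 𝓘(ℝ, ℝ)) g (g := fun x : ℝ => x⁻¹)
      (contDiffAt_inv ℝ (mul_ne_zero (h.blockA_ne_zero g) (h.blockB_ne_zero g))).contMDiffAt
      ((contDiff_mul (𝕜 := ℝ) (𝔸 := ℝ)).contMDiff.comp
        (h.contMDiff_blockA.prodMk_space h.contMDiff_blockB)).contMDiffAt
  exact (contDiff_mul (𝕜 := ℝ) (𝔸 := ℝ)).contMDiff.contMDiffAt.comp g (h1.contMDiffAt.prodMk_space h4)

end IsDoubleLieGroup

namespace IsDoubleLieGroup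

variable {EG EA EB : Type*}
  [NormedAddCommGroup EG] [NormedSpace ℝ EG]
  [NormedAddCommGroup EA] [NormedSpace ℝ EA]
  [NormedAddCommGroup EB] [NormedSpace ℝ EB]
  {G : Type*} [Group G] [TopologicalSpace G] [ChartedSpace EG G]
  {A B : Subgroup G} [ChartedSpace EA A] [ChartedSpace EB B]

/-! ### Tangent maps of translations, of the inversion and of the groupoid inverse -/

/-- `leftTrans` on the model spaces. -/
def leftDer (_h : IsDoubleLieGroup EG EA EB A B) (g : G) : EB →L[ℝ] EG :=
  tder EB EG (fun b : B => g * (b : G)) 1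

/-- `rightTrans` on the model spaces. -/
def rightDer (_h : IsDoubleLieGroup EG EA EB A B) (g : G) : EB →L[ℝ] EG :=
  tder EB EG (fun b : B => (b : G) * g) 1

theorem mdifferentiable_coe_right (h : IsDoubleLieGroup EG EA EB A B) :
    MDifferentiable 𝓘(ℝ, EB) 𝓘(ℝ, EG) (fun b : B => (b : G)) :=
  h.contMDiff_right.mdifferentiable (by simp)

theorem mdifferentiable_mul_left (h : IsDoubleLieGroup EG EA EB A B) (g : G) :
    MDifferentiable 𝓘(ℝ, EG) 𝓘(ℝ, EG) (fun x : G => g * x) := by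
  have := h.lieGroup
  exact (contMDiff_mul_left (n := ∞)).mdifferentiable (by simp)

theorem mdifferentiable_mul_right (h : IsDoubleLieGroup EG EA EB A B) (g : G) :
    MDifferentiable 𝓘(ℝ, EG) 𝓘(ℝ, EG) (fun x : G => x * g) := by
  have := h.lieGroup
  exact (contMDiff_mul_right (n := ∞)).mdifferentiable (by simp)

theorem mdifferentiable_inv (h : IsDoubleLieGroup EG EA EB A B) :
    MDifferentiable 𝓘(ℝ, EG) 𝓘(ℝ, EG) (fun x : G => x⁻¹) := by
  have := h.lieGroup
  exact (contMDiff_inv 𝓘(ℝ, EG) ∞).mdifferentiable (by simp)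

theorem mdifferentiable_inv_right (h : IsDoubleLieGroup EG EA EB A B) :
    MDifferentiable 𝓘(ℝ, EB) 𝓘(ℝ, EB) (fun x : B => x⁻¹) := by
  have := h.lieGroup_right
  exact (contMDiff_inv 𝓘(ℝ, EB) ∞).mdifferentiable (by simp)

theorem mdifferentiable_mul_coe (h : IsDoubleLieGroup EG EA EB A B) (g : G) :
    MDifferentiable 𝓘(ℝ, EB) 𝓘(ℝ, EG) (fun b : B => g * (b : G)) :=
  (h.mdifferentiable_mul_left g).comp h.mdifferentiable_coe_right

theorem mdifferentiable_coe_mul (h : IsDoubleLieGroup EG EA EB A B) (g : G) :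
    MDifferentiable 𝓘(ℝ, EB) 𝓘(ℝ, EG) (fun b : B => (b : G) * g) :=
  (h.mdifferentiable_mul_right g).comp h.mdifferentiable_coe_right

theorem leftDer_injective (h : IsDoubleLieGroup EG EA EB A B) (g : G) :
    Function.Injective (h.leftDer g) := by
  have h1 := tder_comp_of_eq (x := (1 : B)) (y := g) (f := fun b : B => g * (b : G)) (by simp)
    (h.mdifferentiable_mul_left g⁻¹ g) (h.mdifferentiable_mul_coe g 1)
  simp only [inv_mul_cancel_left] at h1
  have h2 := h.injective_tder_right 1
  rw [h1] at h2
  exact Function.Injective.of_comp h2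

/-- The tangent map at `e` of the inversion of `B`. -/
def invB (_h : IsDoubleLieGroup EG EA EB A B) : EB →L[ℝ] EB := tder EB EB (fun b : B => b⁻¹) 1

theorem invB_invB (h : IsDoubleLieGroup EG EA EB A B) (Y : EB) : h.invB (h.invB Y) = Y := by
  have h1 := tder_comp_of_eq (x := (1 : B)) (y := 1) (f := fun b : B => b⁻¹) (by simp)
    (h.mdifferentiable_inv_right 1) (h.mdifferentiable_inv_right 1)
  simp only [inv_inv, tder_id] at h1
  exact (congrArg (fun F : EB →L[ℝ] EB => F Y) h1).symm

theorem abs_det_invB (h : IsDoubleLieGroup EG EA EB A B) :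
    |LinearMap.det (h.invB : EB →ₗ[ℝ] EB)| = 1 := by
  have h1 : (h.invB : EB →ₗ[ℝ] EB) ∘ₗ (h.invB : EB →ₗ[ℝ] EB) = LinearMap.id := by
    ext Y; exact h.invB_invB Y
  have h2 := congrArg LinearMap.det h1
  rw [LinearMap.det_comp, LinearMap.det_id] at h2
  rcases mul_self_eq_one_iff.1 h2 with h3 | h3 <;> simp [h3]

/-- This is the derivative of `(g b)⁻¹ = b⁻¹ g⁻¹`: inversion carries left fibers to right fibers. -/
theorem tder_inv_leftDer (h : IsDoubleLieGroup EG EA EB A B) (g : G) (Y : EB) :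
    tder EG EG (fun x : G => x⁻¹) g (h.leftDer g Y) = h.rightDer g⁻¹ (h.invB Y) := by
  have h1 := tder_comp_of_eq (x := (1 : B)) (y := g) (f := fun b : B => g * (b : G)) (by simp)
    (h.mdifferentiable_inv g) (h.mdifferentiable_mul_coe g 1)
  have h2 := tder_comp_of_eq (x := (1 : B)) (y := 1) (f := fun b : B => b⁻¹)
    (g := fun b : B => (b : G) * g⁻¹) (by simp)
    (h.mdifferentiable_coe_mul g⁻¹ 1) (h.mdifferentiable_inv_right 1)
  simp only [mul_inv_rev, Subgroup.coe_inv] at h1 h2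
  rw [h1] at h2
  exact congrArg (fun F : EB →L[ℝ] EG => F Y) h2

theorem tder_inv_rightDer (h : IsDoubleLieGroup EG EA EB A B) (g : G) (Y : EB) :
    tder EG EG (fun x : G => x⁻¹) g (h.rightDer g Y) = h.leftDer g⁻¹ (h.invB Y) := by
  have h1 := tder_comp_of_eq (x := (1 : B)) (y := g) (f := fun b : B => (b : G) * g) (by simp)
    (h.mdifferentiable_inv g) (h.mdifferentiable_coe_mul g 1)
  have h2 := tder_comp_of_eq (x := (1 : B)) (y := 1) (f := fun b : B => b⁻¹)
    (g := fun b : B => g⁻¹ * (b : G)) (by simp)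
    (h.mdifferentiable_mul_coe g⁻¹ 1) (h.mdifferentiable_inv_right 1)
  simp only [mul_inv_rev, Subgroup.coe_inv] at h1 h2
  rw [h1] at h2
  exact congrArg (fun F : EB →L[ℝ] EG => F Y) h2

theorem tder_inv_inv (h : IsDoubleLieGroup EG EA EB A B) (g : G) (v : EG) :
    tder EG EG (fun x : G => x⁻¹) g⁻¹ (tder EG EG (fun x : G => x⁻¹) g v) = v := by
  have h1 := tder_comp (x := g) (f := fun x : G => x⁻¹) (h.mdifferentiable_inv g⁻¹)
    (h.mdifferentiable_inv g)
  simp only [inv_inv, tder_id] at h1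
  exact (congrArg (fun F : EG →L[ℝ] EG => F v) h1).symm

variable [FiniteDimensional ℝ EG] [FiniteDimensional ℝ EA] [FiniteDimensional ℝ EB]
  [SecondCountableTopology G]

theorem mdifferentiable_sA (h : IsDoubleLieGroup EG EA EB A B) :
    MDifferentiable 𝓘(ℝ, EG) 𝓘(ℝ, EG) h.sA := h.contMDiff_sA.mdifferentiable (by simp)

theorem tder_sA_sA (h : IsDoubleLieGroup EG EA EB A B) (g : G) (v : EG) :
    tder EG EG h.sA (h.sA g) (tder EG EG h.sA g v) = v := by
  have h1 := tder_comp (x := g) (f := h.sA) (h.mdifferentiable_sA (h.sA g))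
    (h.mdifferentiable_sA g)
  simp only [sA_sA, tder_id] at h1
  exact (congrArg (fun F : EG →L[ℝ] EG => F v) h1).symm

theorem tder_sA_inv (h : IsDoubleLieGroup EG EA EB A B) (g : G) (v : EG) :
    tder EG EG h.sA g⁻¹ (tder EG EG (fun x : G => x⁻¹) g v) =
      tder EG EG (fun x : G => x⁻¹) (h.sA g) (tder EG EG h.sA g v) := by
  have h1 := tder_comp (x := g) (f := fun x : G => x⁻¹) (h.mdifferentiable_sA g⁻¹)
    (h.mdifferentiable_inv g)
  have h2 := tder_comp (x := g) (f := h.sA) (h.mdifferentiable_inv (h.sA g))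
    (h.mdifferentiable_sA g)
  simp only [sA_inv] at h1
  rw [h1] at h2
  exact congrArg (fun F : EG →L[ℝ] EG => F v) h2

/-- The determinant of the `B`-block of `Ad a` is the determinant at `e` of `b ↦ p (a b a⁻¹)`, where
`p : G → B` is one of the projections `bL`, `bR`. -/
theorem blockB_eq_det (h : IsDoubleLieGroup EG EA EB A B) (p : G → B)
    (hp : ContMDiff 𝓘(ℝ, EG) 𝓘(ℝ, EB) ∞ p) (hpB : ∀ b : B, p b = b) (hpA : ∀ a : A, p a = 1)
    (g : G) :
    h.blockB g = LinearMap.det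
      (tder EB EB (fun b : B => p (g * b * g⁻¹)) 1 : EB →ₗ[ℝ] EB) := by
  have := h.lieGroup
  have hpd : MDifferentiable 𝓘(ℝ, EG) 𝓘(ℝ, EB) p := hp.mdifferentiable (by simp)
  have hpone : p 1 = 1 := by simpa using hpB 1
  rw [blockB, det_diagBlock_eq_det_comp h.isCompl_subLieAlgebra.symm
    (tder EB EG (fun b : B => (b : G)) 1 : EB →ₗ[ℝ] EG) (tder EG EB p 1 : EG →ₗ[ℝ] EB) rfl]
  · congr 1
    have h1 := tder_comp_of_eq (x := (1 : B)) (y := (1 : G)) (f := fun b : B => (b : G)) rfl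
      (mdifferentiable_conj g 1) (h.mdifferentiable_coe_right 1)
    have h2 := tder_comp_of_eq (x := (1 : B)) (y := (1 : G)) (g := p)
      (f := fun b : B => g * (b : G) * g⁻¹) (by simp) (hpd 1)
      (((mdifferentiable_conj g).comp h.mdifferentiable_coe_right) 1)
    rw [h2, h1]
    rfl
  -- The last two goals say that the derivative of `p` at `e` is a retraction onto `𝔟` killing `𝔞`;
  -- this holds because `p` is the identity on `B` and constant on `A`.
  · intro w
    have h1 := tder_comp_of_eq (x := (1 : B)) (y := (1 : G)) (f := fun b : B => (b : G)) rfl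
      (hpd 1) (h.mdifferentiable_coe_right 1)
    simp only [hpB, tder_id] at h1
    exact (congrArg (fun F : EB →L[ℝ] EB => F w) h1).symm
  · rintro _ ⟨w, rfl⟩
    have h1 := tder_comp_of_eq (x := (1 : A)) (y := (1 : G)) (f := fun a : A => (a : G)) rfl
      (hpd 1) (h.contMDiff_left.mdifferentiable (by simp) 1)
    simp only [hpA, tder_const] at h1
    exact (congrArg (fun F : EA →L[ℝ] EB => F w) h1).symm

/-- The map `b ↦ b_L(a b)` of `B` has the derivative determinant `det (Ad a)|_{𝔟}` at `e`. -/
theorem det_tder_bL_mul (h : IsDoubleLieGroup EG EA EB A B) (a : A) :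
    LinearMap.det (tder EB EB (fun b : B => h.bL (a * b)) 1 : EB →ₗ[ℝ] EB) = h.blockB a := by
  rw [h.blockB_eq_det h.bL h.contMDiff_bL h.bL_coe_right h.bL_coe_left]
  -- Right multiplication by an element of `A` does not change `b_L`.
  have h1 : (fun b : B => h.bL (a * (b : G))) = fun b : B => h.bL (a * (b : G) * (a : G)⁻¹) := by
    funext b
    refine (h.bL_eq (a := h.aR (a * (b : G)) * a⁻¹) ?_).symm
    push_cast
    rw [← mul_assoc, bL_mul_aR]
  rw [h1]

/-- The derivative at `e` of the map `b ↦ b_R(b a_L(g))⁻¹`, through which `s_A` acts on the right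
fiber of `g`. -/
def sADer (h : IsDoubleLieGroup EG EA EB A B) (g : G) : EB →L[ℝ] EB :=
  tder EB EB (fun b : B => (h.bR (b * h.aL g))⁻¹) 1

/-- This is the derivative at `b = e` of `s_A(b g) = s_A(g) b_R(b a_L(g))⁻¹`. -/
theorem tder_sA_rightDer (h : IsDoubleLieGroup EG EA EB A B) (g : G) (Y : EB) :
    tder EG EG h.sA g (h.rightDer g Y) = h.leftDer (h.sA g) (h.sADer g Y) := by
  have h1 := tder_comp_of_eq (x := (1 : B)) (y := g) (f := fun b : B => (b : G) * g) (by simp)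
    (h.mdifferentiable_sA g) (h.mdifferentiable_coe_mul g 1)
  have hd : MDifferentiableAt 𝓘(ℝ, EB) 𝓘(ℝ, EB) (fun b : B => (h.bR (b * h.aL g))⁻¹) 1 :=
    (h.mdifferentiable_inv_right.comp ((h.contMDiff_bR.mdifferentiable (by simp)).comp
      (h.mdifferentiable_coe_mul _))) 1
  have h2 := tder_comp_of_eq (x := (1 : B)) (y := 1)
    (f := fun b : B => (h.bR (b * h.aL g))⁻¹)
    (g := fun b : B => h.sA g * (b : G)) (by simp [h.bR_coe_left])
    (h.mdifferentiable_mul_coe (h.sA g) 1) hd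
  have e : (fun b : B => h.sA ((b : G) * g)) =
      fun b : B => h.sA g * (((h.bR (b * h.aL g))⁻¹ : B) : G) := by
    funext b
    have e1 : (b : G) * g = ((b * h.bL g : B) : G) * h.aR g := by
      push_cast; rw [mul_assoc, bL_mul_aR]
    have e2 : (b : G) * g = h.aL (b * h.aL g) * ((h.bR (b * h.aL g) * h.bR g : B) : G) := by
      push_cast; rw [← mul_assoc, aL_mul_bR, mul_assoc, aL_mul_bR]
    rw [sA, sA, h.aR_eq e1, h.bR_eq e2]
    push_cast; group
  rw [e, h2] at h1
  exact (congrArg (fun F : EB →L[ℝ] EG => F Y) h1).symm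

/-- Only the tangency to the right fiber is recorded; it serves to locate the support of `ρ₀`. -/
theorem tder_sA_leftDer_mem (h : IsDoubleLieGroup EG EA EB A B) (g : G) (Y : EB) :
    ∃ Z : EB, tder EG EG h.sA g (h.leftDer g Y) = h.rightDer (h.sA g) Z := by
  have h1 := tder_comp_of_eq (x := (1 : B)) (y := g) (f := fun b : B => g * (b : G)) (by simp)
    (h.mdifferentiable_sA g) (h.mdifferentiable_mul_coe g 1)
  have hd : MDifferentiableAt 𝓘(ℝ, EB) 𝓘(ℝ, EB) (fun b : B => (h.bL (h.aR g * b))⁻¹) 1 :=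
    (h.mdifferentiable_inv_right.comp ((h.contMDiff_bL.mdifferentiable (by simp)).comp
      (h.mdifferentiable_mul_coe _))) 1
  have h2 := tder_comp_of_eq (x := (1 : B)) (y := 1)
    (f := fun b : B => (h.bL (h.aR g * b))⁻¹)
    (g := fun b : B => (b : G) * h.sA g) (by simp [h.bL_coe_left])
    (h.mdifferentiable_coe_mul (h.sA g) 1) hd
  have e : (fun b : B => h.sA (g * (b : G))) =
      fun b : B => (((h.bL (h.aR g * b))⁻¹ : B) : G) * h.sA g := by
    funext b
    have e1 : g * (b : G) = h.aL g * ((h.bR g * b : B) : G) := by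
      push_cast; rw [← mul_assoc, aL_mul_bR]
    have e2 : g * (b : G) = ((h.bL g * h.bL (h.aR g * b) : B) : G) * h.aR (h.aR g * b) := by
      push_cast; rw [mul_assoc, bL_mul_aR, ← mul_assoc, bL_mul_aR]
    rw [sA_eq, sA_eq, h.aL_eq e1, h.bL_eq e2]
    push_cast; group
  rw [e, h2] at h1
  exact ⟨_, (congrArg (fun F : EB →L[ℝ] EG => F Y) h1).symm⟩

/-- With `a = a_L(g)`, the elements `b a` and `a⁻¹ b a` have the same `b_R`, so the derivative of `b
↦ b_R(b a)` has the determinant of the `𝔟`-block of `Ad a⁻¹`. The inversion of `B` contributes a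
sign. -/
theorem abs_det_sADer (h : IsDoubleLieGroup EG EA EB A B) (g : G) :
    |LinearMap.det (h.sADer g : EB →ₗ[ℝ] EB)| = |h.blockB (h.aL g)|⁻¹ := by
  have h0 := h.blockB_eq_det h.bR h.contMDiff_bR h.bR_coe_right h.bR_coe_left
    (((h.aL g)⁻¹ : A) : G)
  have h1 : (fun b : B => h.bR (b * (h.aL g : G))) = fun b : B =>
      h.bR ((((h.aL g)⁻¹ : A) : G) * b * (((h.aL g)⁻¹ : A) : G)⁻¹) := by
    funext b
    have := h.bR_mul_mul (h.aL g)⁻¹ ((b : G) * (h.aL g : G)) 1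
    push_cast at this ⊢
    simpa [mul_assoc] using this.symm
  rw [← h1, blockB_coe_inv_left] at h0
  have hd : MDifferentiableAt 𝓘(ℝ, EB) 𝓘(ℝ, EB) (fun b : B => h.bR (b * h.aL g)) 1 :=
    ((h.contMDiff_bR.mdifferentiable (by simp)).comp (h.mdifferentiable_coe_mul _)) 1
  have h2 := tder_comp_of_eq (x := (1 : B)) (y := 1)
    (f := fun b : B => h.bR (b * h.aL g)) (g := fun b : B => b⁻¹) (by simp [h.bR_coe_left])
    (h.mdifferentiable_inv_right 1) hd
  have h3 : (h.sADer g : EB →ₗ[ℝ] EB) = (h.invB : EB →ₗ[ℝ] EB) ∘ₗ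
      (tder EB EB (fun b : B => h.bR (b * h.aL g)) 1 : EB →ₗ[ℝ] EB) := by
    rw [sADer, h2]; rfl
  rw [h3, LinearMap.det_comp, abs_mul, h.abs_det_invB, one_mul, ← h0, abs_inv]

end IsDoubleLieGroup

/-! ### Haar measure on a Lie group: change of variables -/

section Haar

open MeasureTheory

variable {E : Type*} [NormedAddCommGroup E] [NormedSpace ℝ E]
  {K : Type*} [Group K] [TopologicalSpace K] [ChartedSpace E K]

omit [Group K] in
theorem mdifferentiableAt_chartAt [IsManifold 𝓘(ℝ, E) 1 K] {x y : K}
    (hy : y ∈ (chartAt E x).source) :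
    MDifferentiableAt 𝓘(ℝ, E) 𝓘(ℝ, E) (chartAt E x) y :=
  mdifferentiableAt_atlas (chart_mem_atlas E x) hy

omit [Group K] in
theorem mdifferentiableAt_chartAt_symm [IsManifold 𝓘(ℝ, E) 1 K] {x : K} {t : E}
    (ht : t ∈ (chartAt E x).target) :
    MDifferentiableAt 𝓘(ℝ, E) 𝓘(ℝ, E) (chartAt E x).symm t :=
  mdifferentiableAt_atlas_symm (chart_mem_atlas E x) ht

/-- The Jacobian at `e` of the left translation by `x`, in the preferred chart at `e`. -/
def leftJac (E : Type*) [NormedAddCommGroup E] [NormedSpace ℝ E]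
    {K : Type*} [Group K] [TopologicalSpace K] [ChartedSpace E K] (x : K) : ℝ :=
  LinearMap.det (tder E E (fun y : K => chartAt E (1 : K) (x * y)) 1 : E →ₗ[ℝ] E)

/-- The derivative at `e` of `f` in the left trivialization of the tangent bundle at `x`. -/
def trivDer (E : Type*) [NormedAddCommGroup E] [NormedSpace ℝ E]
    {K : Type*} [Group K] [TopologicalSpace K] [ChartedSpace E K] (f : K → K) (x : K) : E →L[ℝ] E :=
  tder E E (fun y : K => (f x)⁻¹ * f (x * y)) 1

variable [LieGroup 𝓘(ℝ, E) ∞ K]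

theorem mdifferentiable_mul_left_self (x : K) :
    MDifferentiable 𝓘(ℝ, E) 𝓘(ℝ, E) (fun y : K => x * y) :=
  (contMDiff_mul_left (n := ∞)).mdifferentiable (by simp)

theorem leftJac_ne_zero {x : K} (hx : x ∈ (chartAt E (1 : K)).source) : leftJac E x ≠ 0 := by
  have : IsManifold 𝓘(ℝ, E) 1 K := IsManifold.of_le (n := ∞) (by simp)
  set φ := chartAt E (1 : K)
  have hd1 : MDifferentiableAt 𝓘(ℝ, E) 𝓘(ℝ, E) (fun y : K => φ (x * y)) 1 := by
    refine MDifferentiableAt.comp (I' := 𝓘(ℝ, E)) (1 : K) (g := φ) ?_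
      (mdifferentiable_mul_left_self x 1)
    simpa using mdifferentiableAt_chartAt hx
  have hd2 : MDifferentiableAt 𝓘(ℝ, E) 𝓘(ℝ, E) (fun t : E => x⁻¹ * φ.symm t) (φ x) :=
    MDifferentiableAt.comp (I' := 𝓘(ℝ, E)) (φ x) (mdifferentiable_mul_left_self x⁻¹ _)
      (mdifferentiableAt_chartAt_symm (φ.map_source hx))
  have h1 := tder_comp_of_eq (x := φ x) (y := 1) (f := fun t : E => x⁻¹ * φ.symm t)
    (by simp [φ.left_inv hx]) hd1 hd2
  have h2 : (fun t => φ (x * (x⁻¹ * φ.symm t))) =ᶠ[𝓝 (φ x)] fun t => t := by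
    filter_upwards [φ.open_target.mem_nhds (φ.map_source hx)] with t ht
    simp [φ.right_inv ht]
  have h3 : tder E E (fun t => φ (x * (x⁻¹ * φ.symm t))) (φ x) = ContinuousLinearMap.id ℝ E := by
    rw [← tder_id (φ x)]; exact h2.mfderiv_eq
  rw [h3] at h1
  have h4 : LinearMap.id = (tder E E (fun y : K => φ (x * y)) 1 : E →ₗ[ℝ] E) ∘ₗ
      (tder E E (fun t : E => x⁻¹ * φ.symm t) (φ x) : E →ₗ[ℝ] E) :=
    congrArg (fun F : E →L[ℝ] E => (F : E →ₗ[ℝ] E)) h1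
  intro h0
  have h5 := congrArg LinearMap.det h4
  rw [LinearMap.det_comp, LinearMap.det_id] at h5
  rw [leftJac] at h0
  rw [h0, zero_mul] at h5
  exact one_ne_zero h5

/-- The chain rule for the Jacobians in the chart and in the left trivialization. -/
theorem det_tder_chart_mul_leftJac {f : K → K} {x : K} (hx : x ∈ (chartAt E (1 : K)).source)
    (hfx : f x ∈ (chartAt E (1 : K)).source) (hf : MDifferentiableAt 𝓘(ℝ, E) 𝓘(ℝ, E) f x) :
    LinearMap.det (tder E E (fun t => chartAt E (1 : K) (f ((chartAt E (1 : K)).symm t)))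
      (chartAt E (1 : K) x) : E →ₗ[ℝ] E) * leftJac E x =
    leftJac E (f x) * LinearMap.det (trivDer E f x : E →ₗ[ℝ] E) := by
  have : IsManifold 𝓘(ℝ, E) 1 K := IsManifold.of_le (n := ∞) (by simp)
  set φ := chartAt E (1 : K)
  have hf' : MDifferentiableAt 𝓘(ℝ, E) 𝓘(ℝ, E) (fun y => f (x * y)) 1 := by
    refine MDifferentiableAt.comp (I' := 𝓘(ℝ, E)) (1 : K) (g := f) ?_
      (mdifferentiable_mul_left_self x 1)
    simpa using hf
  -- Both sides are the determinant at `1` of `y ↦ φ (f (x * y))`, factored through the left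
  -- trivialization at `f x` or through the chart at `x`.
  have h1 := tder_comp_of_eq (x := (1 : K)) (y := 1) (f := fun y => (f x)⁻¹ * f (x * y))
    (g := fun y => φ (f x * y)) (by simp)
    (MDifferentiableAt.comp (I' := 𝓘(ℝ, E)) (1 : K) (g := φ)
      (by simpa using mdifferentiableAt_chartAt hfx) (mdifferentiable_mul_left_self (f x) 1))
    (MDifferentiableAt.comp (I' := 𝓘(ℝ, E)) (1 : K) (mdifferentiable_mul_left_self _ _) hf')
  simp only [mul_inv_cancel_left] at h1
  have hsymm : MDifferentiableAt 𝓘(ℝ, E) 𝓘(ℝ, E) φ.symm (φ x) :=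
    mdifferentiableAt_chartAt_symm (φ.map_source hx)
  have hfs : MDifferentiableAt 𝓘(ℝ, E) 𝓘(ℝ, E) (fun t => f (φ.symm t)) (φ x) :=
    MDifferentiableAt.comp (I' := 𝓘(ℝ, E)) (φ x) (g := f) (by simpa [φ.left_inv hx] using hf) hsymm
  have h2 := tder_comp_of_eq (x := (1 : K)) (y := φ x) (f := fun y => φ (x * y))
    (g := fun t => φ (f (φ.symm t))) (by simp)
    (MDifferentiableAt.comp (I' := 𝓘(ℝ, E)) (φ x) (g := φ)
      (by simpa [φ.left_inv hx] using mdifferentiableAt_chartAt hfx) hfs)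
    (MDifferentiableAt.comp (I' := 𝓘(ℝ, E)) (1 : K) (g := φ)
      (by simpa using mdifferentiableAt_chartAt hx) (mdifferentiable_mul_left_self x 1))
  have h3 : (fun y => φ (f (φ.symm (φ (x * y))))) =ᶠ[𝓝 (1 : K)] fun y => φ (f (x * y)) := by
    have hc : Filter.Tendsto (fun y => x * y) (𝓝 (1 : K)) (𝓝 x) := by
      have := (mdifferentiable_mul_left_self (E := E) x (1 : K)).continuousAt
      simpa [ContinuousAt] using this
    filter_upwards [hc (φ.open_source.mem_nhds hx)] with y hy
    rw [φ.left_inv hy]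
  have h4 : tder E E (fun y => φ (f (φ.symm (φ (x * y))))) (1 : K) =
      tder E E (fun y => φ (f (x * y))) (1 : K) := h3.mfderiv_eq
  rw [h4, h1] at h2
  have h5 := congrArg (fun F : E →L[ℝ] E => LinearMap.det (F : E →ₗ[ℝ] E)) h2
  simp only [ContinuousLinearMap.toLinearMap_comp, LinearMap.det_comp] at h5
  exact h5.symm

theorem inTangentCoordinates_const_model {E F M P : Type*} [NormedAddCommGroup E]
    [NormedSpace ℝ E] [NormedAddCommGroup F] [NormedSpace ℝ F] [TopologicalSpace M]
    [ChartedSpace E M] [IsManifold 𝓘(ℝ, E) 1 M] (x : M) (g : P → F) (φ : P → E →L[ℝ] F) (p₀ : P) :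
    inTangentCoordinates 𝓘(ℝ, E) 𝓘(ℝ, F) (fun _ => x) g φ p₀ = φ := by
  funext p
  rw [inTangentCoordinates_eq]
  · ext v
    simp only [ContinuousLinearMap.comp_apply]
    rw [(tangentBundleCore 𝓘(ℝ, E) M).coordChange_self _ _ (mem_chart_source E x),
      tangentBundleCore_coordChange_model_space]
    rfl
  · exact mem_chart_source E x
  · exact Set.mem_univ _

theorem continuousOn_leftJac [FiniteDimensional ℝ E] :
    ContinuousOn (leftJac E) (chartAt E (1 : K)).source := by
  have : IsManifold 𝓘(ℝ, E) 1 K := IsManifold.of_le (n := ∞) (by simp)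
  intro x₀ hx₀
  set φ := chartAt E (1 : K)
  have h1 : ContMDiffAt (𝓘(ℝ, E).prod 𝓘(ℝ, E)) 𝓘(ℝ, E) ∞
      (Function.uncurry fun x y : K => φ (x * y)) (x₀, 1) := by
    refine ContMDiffAt.comp (I' := 𝓘(ℝ, E)) (x₀, (1 : K)) (g := φ) ?_
      (contMDiff_fst.mul contMDiff_snd).contMDiffAt
    change ContMDiffAt 𝓘(ℝ, E) 𝓘(ℝ, E) ∞ φ (x₀ * 1)
    rw [mul_one]
    exact contMDiffAt_of_mem_maximalAtlas (IsManifold.chart_mem_maximalAtlas (1 : K)) hx₀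
  have h2 := ContMDiffAt.mfderiv (m := ∞) (x₀ := x₀) (fun x y : K => φ (x * y))
    (fun _ => (1 : K)) h1 contMDiffAt_const (by simp)
  have h3 : ContinuousAt (inTangentCoordinates 𝓘(ℝ, E) 𝓘(ℝ, E) (fun _ : K => (1 : K))
      (fun x => φ (x * 1)) (fun x => tder E E (fun y => φ (x * y)) 1) x₀) x₀ := h2.continuousAt
  rw [inTangentCoordinates_const_model] at h3
  have h4 := (contDiff_det_comp (E := E) LinearMap.id LinearMap.id).continuous
  exact (h4.continuousAt.comp h3).continuousWithinAt

end Haar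

/-! ### The invariant measure in the chart at the identity -/

section Haar

open MeasureTheory

variable {E : Type*} [NormedAddCommGroup E] [NormedSpace ℝ E] [FiniteDimensional ℝ E]
  [MeasurableSpace E] [BorelSpace E]
  {K : Type*} [Group K] [TopologicalSpace K] [ChartedSpace E K] [LieGroup 𝓘(ℝ, E) ∞ K]
  [MeasurableSpace K] [BorelSpace K]

/-- The density of Haar measure with respect to Lebesgue measure in the chart at `e`. -/
def haarDensity (E : Type*) [NormedAddCommGroup E] [NormedSpace ℝ E]
    {K : Type*} [Group K] [TopologicalSpace K] [ChartedSpace E K] : K → ENNReal :=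
  (chartAt E (1 : K)).source.indicator fun x => ENNReal.ofReal |leftJac E x|⁻¹

theorem haarDensity_of_mem {E K : Type*} [NormedAddCommGroup E] [NormedSpace ℝ E]
    [Group K] [TopologicalSpace K] [ChartedSpace E K] {x : K}
    (hx : x ∈ (chartAt E (1 : K)).source) :
    haarDensity E x = ENNReal.ofReal |leftJac E x|⁻¹ := Set.indicator_of_mem hx _

/-- The left-invariant measure on the domain of the chart at `e`. -/
def chartHaar (K : Type*) [Group K] [TopologicalSpace K] [ChartedSpace E K] [MeasurableSpace K]
    (μ : Measure E) : Measure K :=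
  ((μ.restrict (chartAt E (1 : K)).target).map (chartAt E (1 : K)).symm).withDensity
    (haarDensity E)

omit [MeasurableSpace E] [BorelSpace E] in
theorem measurable_haarDensity : Measurable (haarDensity E : K → ENNReal) := by
  classical
  have hU : MeasurableSet (chartAt E (1 : K)).source := (chartAt E (1 : K)).open_source.measurableSet
  have h1 : ContinuousOn (fun x : K => ENNReal.ofReal |leftJac E x|⁻¹)
      (chartAt E (1 : K)).source :=
    ENNReal.continuous_ofReal.comp_continuousOn
      (continuousOn_leftJac.abs.inv₀ fun x hx => abs_ne_zero.2 (leftJac_ne_zero hx))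
  have h2 := h1.measurable_piecewise (g := 0) continuousOn_const hU
  rwa [Set.piecewise_eq_indicator] at h2

omit [NormedSpace ℝ E] [FiniteDimensional ℝ E] [LieGroup 𝓘(ℝ, E) ∞ K] in
theorem aemeasurable_chartAt_symm (μ : Measure E) :
    AEMeasurable (chartAt E (1 : K)).symm (μ.restrict (chartAt E (1 : K)).target) :=
  (chartAt E (1 : K)).continuousOn_symm.aemeasurable (chartAt E (1 : K)).open_target.measurableSet

-- The inverse chart is continuous only on its target, so measurability is checked on the subtype.
omit [NormedSpace ℝ E] [FiniteDimensional ℝ E] [LieGroup 𝓘(ℝ, E) ∞ K] in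
theorem measurableSet_target_inter {S : Set K} (hS : MeasurableSet S) :
    MeasurableSet ((chartAt E (1 : K)).target ∩ (chartAt E (1 : K)).symm ⁻¹' S) := by
  have h1 := (continuousOn_iff_continuous_domRestrict.1
    (chartAt E (1 : K)).continuousOn_symm).measurable hS
  have h2 := (chartAt E (1 : K)).open_target.measurableSet.subtype_image h1
  rwa [Set.domRestrict_eq, Set.preimage_comp, Subtype.image_preimage_coe] at h2

theorem setLIntegral_chartHaar (μ : Measure E) {S : Set K} (hS : MeasurableSet S)
    {F : K → ENNReal} (hF : Measurable F) :
    ∫⁻ x in S, F x ∂(chartHaar K μ) =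
      ∫⁻ t in (chartAt E (1 : K)).target ∩ (chartAt E (1 : K)).symm ⁻¹' S,
        haarDensity E ((chartAt E (1 : K)).symm t) * F ((chartAt E (1 : K)).symm t) ∂μ := by
  rw [chartHaar, setLIntegral_withDensity_eq_setLIntegral_mul _ measurable_haarDensity hF hS,
    ← lintegral_indicator hS, lintegral_map'
      ((measurable_haarDensity.mul hF).indicator hS).aemeasurable (aemeasurable_chartAt_symm μ),
    ← lintegral_indicator (measurableSet_target_inter hS),
    ← lintegral_indicator (chartAt E (1 : K)).open_target.measurableSet]
  congr 1
  funext t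
  by_cases h1 : t ∈ (chartAt E (1 : K)).target <;>
    by_cases h2 : (chartAt E (1 : K)).symm t ∈ S <;> simp [h1, h2]

theorem chartHaar_apply (μ : Measure E) {S : Set K} (hS : MeasurableSet S) :
    chartHaar K μ S = ∫⁻ t in (chartAt E (1 : K)).target ∩ (chartAt E (1 : K)).symm ⁻¹' S,
        haarDensity E ((chartAt E (1 : K)).symm t) ∂μ := by
  rw [← setLIntegral_one, setLIntegral_chartHaar μ hS measurable_const]
  simp

/-- Change of variables for the invariant measure in the chart at `e`. -/
theorem chartHaar_image (μ : Measure E) [μ.IsAddHaarMeasure] {f : K → K} {S : Set K}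
    (hS : MeasurableSet S) (hfS : MeasurableSet (f '' S)) (hinj : Set.InjOn f S)
    (hSU : S ⊆ (chartAt E (1 : K)).source) (hfSU : Set.MapsTo f S (chartAt E (1 : K)).source)
    (hf : ∀ x ∈ S, MDifferentiableAt 𝓘(ℝ, E) 𝓘(ℝ, E) f x) {w : K → ENNReal} (hw : Measurable w)
    (hfw : ∀ x ∈ S, w x = ENNReal.ofReal |LinearMap.det (trivDer E f x : E →ₗ[ℝ] E)|) :
    chartHaar K μ (f '' S) = ∫⁻ x in S, w x ∂(chartHaar K μ) := by
  have : IsManifold 𝓘(ℝ, E) 1 K := IsManifold.of_le (n := ∞) (by simp)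
  rw [chartHaar_apply μ hfS, setLIntegral_chartHaar μ hS hw]
  set φ := chartAt E (1 : K)
  set T := φ.target ∩ φ.symm ⁻¹' S
  have hT : MeasurableSet T := measurableSet_target_inter hS
  have himage : φ.target ∩ φ.symm ⁻¹' (f '' S) = (fun t => φ (f (φ.symm t))) '' T := by
    ext t
    constructor
    · rintro ⟨ht, x, hx, hxt⟩
      refine ⟨φ x, ⟨φ.map_source (hSU hx), by simpa [φ.left_inv (hSU hx)] using hx⟩, ?_⟩
      simp only [φ.left_inv (hSU hx), hxt, φ.right_inv ht]
    · rintro ⟨t', ⟨ht', hx⟩, rfl⟩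
      have := hfSU hx
      exact ⟨φ.map_source this, φ.symm t', hx, (φ.left_inv this).symm⟩
  have hder : ∀ t ∈ T, HasFDerivWithinAt (fun t => φ (f (φ.symm t)))
      (tder E E (fun t => φ (f (φ.symm t))) t) T t := by
    intro t ht
    have h1 : MDifferentiableAt 𝓘(ℝ, E) 𝓘(ℝ, E) (fun t => φ (f (φ.symm t))) t :=
      MDifferentiableAt.comp (I' := 𝓘(ℝ, E)) t (g := φ) (mdifferentiableAt_chartAt (hfSU ht.2))
        (MDifferentiableAt.comp (I' := 𝓘(ℝ, E)) t (g := f) (hf _ ht.2)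
          (mdifferentiableAt_chartAt_symm ht.1))
    have h2 := (mdifferentiableAt_iff_differentiableAt.1 h1).hasFDerivAt
    rw [← mfderiv_eq_fderiv] at h2
    exact h2.hasFDerivWithinAt
  have hinj' : Set.InjOn (fun t => φ (f (φ.symm t))) T := by
    intro t ht t' ht' htt'
    exact φ.symm.injOn ht.1 ht'.1 (hinj ht.2 ht'.2 (φ.injOn (hfSU ht.2) (hfSU ht'.2) htt'))
  rw [himage, lintegral_image_eq_lintegral_abs_det_fderiv_mul μ hT hder hinj']
  refine setLIntegral_congr_fun hT fun t ht => ?_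
  have hx := hSU ht.2
  have hfx := hfSU ht.2
  -- The chain rule turns the Euclidean Jacobian times the density at the image point into the
  -- density at `x` times the Jacobian in the left trivialization.
  have h1 := det_tder_chart_mul_leftJac hx hfx (hf _ ht.2)
  rw [φ.right_inv ht.1] at h1
  simp only [φ.left_inv hfx, haarDensity_of_mem hx, haarDensity_of_mem hfx, hfw _ ht.2]
  rw [← ENNReal.ofReal_mul (abs_nonneg _), ← ENNReal.ofReal_mul (inv_nonneg.2 (abs_nonneg _))]
  congr 1
  have h2 := abs_ne_zero.2 (leftJac_ne_zero (E := E) hx)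
  have h3 := abs_ne_zero.2 (leftJac_ne_zero (E := E) hfx)
  rw [mul_inv_eq_iff_eq_mul₀ h3, inv_mul_eq_div, div_mul_eq_mul_div, eq_div_iff h2]
  have h4 := congrArg abs h1
  rw [abs_mul, abs_mul] at h4
  rw [mul_comm |LinearMap.det (trivDer E f _ : E →ₗ[ℝ] E)|]
  exact h4

omit [FiniteDimensional ℝ E] [MeasurableSpace E] [BorelSpace E] [LieGroup 𝓘(ℝ, E) ∞ K]
  [MeasurableSpace K] [BorelSpace K] in
theorem det_trivDer_mul_left (k x : K) :
    LinearMap.det (trivDer E (fun y : K => k * y) x : E →ₗ[ℝ] E) = 1 := by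
  have h1 : (fun y : K => (k * x)⁻¹ * (k * (x * y))) = fun y => y := by
    funext y; group
  rw [trivDer, h1, tder_id]
  exact LinearMap.det_id

/-- In the left trivialization a left translation has the identity as its derivative, so its
Jacobian is `1`. -/
theorem chartHaar_mul_left (μ : Measure E) [μ.IsAddHaarMeasure] (k : K) {S : Set K}
    (hS : MeasurableSet S) (hSU : S ⊆ (chartAt E (1 : K)).source)
    (hkS : ∀ x ∈ S, k * x ∈ (chartAt E (1 : K)).source) :
    chartHaar K μ ((fun x => k⁻¹ * x) ⁻¹' S) = chartHaar K μ S := by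
  have : IsTopologicalGroup K := topologicalGroup_of_lieGroup 𝓘(ℝ, E) ∞
  have h1 : (fun x => k⁻¹ * x) ⁻¹' S = (fun x => k * x) '' S := by
    ext x
    exact ⟨fun hx => ⟨_, hx, mul_inv_cancel_left k x⟩, by rintro ⟨y, hy, rfl⟩; simpa using hy⟩
  have h2 : MeasurableSet ((fun x => k⁻¹ * x) ⁻¹' S) :=
    (continuous_const_mul k⁻¹).measurable hS
  rw [h1] at h2 ⊢
  rw [chartHaar_image μ hS h2 (mul_right_injective k).injOn hSU hkS
    (fun x _ => mdifferentiable_mul_left_self k x) measurable_const (w := fun _ => 1)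
    (fun x _ => by rw [det_trivDer_mul_left]; simp), setLIntegral_one]

end Haar

/-! ### From the chart at the identity to Haar measure on the whole group -/

section Haar

open MeasureTheory

theorem measure_eq_tsum_inter_preimage {α β : Type*} [MeasurableSpace α] [MeasurableSpace β]
    (μ : Measure α) {f : α → β} (hf : Measurable f) {P : ℕ → Set β} (hP : ∀ n, MeasurableSet (P n))
    (hd : Pairwise (Function.onFun Disjoint P)) (hu : ⋃ n, P n = Set.univ) {T : Set α}
    (hT : MeasurableSet T) : μ T = ∑' n, μ (T ∩ f ⁻¹' P n) := by
  rw [← measure_iUnion]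
  · rw [← Set.inter_iUnion, ← Set.preimage_iUnion, hu, Set.preimage_univ, Set.inter_univ]
  · intro i j hij
    exact ((hd hij).preimage f).mono Set.inter_subset_right Set.inter_subset_right
  · exact fun n => hT.inter (hf (hP n))

variable {E : Type*} [NormedAddCommGroup E] [NormedSpace ℝ E] [FiniteDimensional ℝ E]
  [MeasurableSpace E] [BorelSpace E]
  {K : Type*} [Group K] [TopologicalSpace K] [ChartedSpace E K] [LieGroup 𝓘(ℝ, E) ∞ K]
  [MeasurableSpace K] [BorelSpace K] [SecondCountableTopology K]

/-- The invariant measure on the chart domain at `e` extends to a left-invariant measure. -/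
theorem exists_isMulLeftInvariant_eq_chartHaar (μ : Measure E) [μ.IsAddHaarMeasure] :
    ∃ m : Measure K, m.IsMulLeftInvariant ∧ ∀ S : Set K, MeasurableSet S →
      S ⊆ (chartAt E (1 : K)).source → m S = chartHaar K μ S := by
  have : IsTopologicalGroup K := topologicalGroup_of_lieGroup 𝓘(ℝ, E) ∞
  set U := (chartAt E (1 : K)).source with hU
  have hUo : IsOpen U := (chartAt E (1 : K)).open_source
  have hmul : ∀ k : K, Measurable fun x : K => k * x := fun k => (continuous_const_mul k).measurable
  obtain ⟨s, hsc, hsu⟩ := TopologicalSpace.countable_cover_nhds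
    (f := fun k : K => (fun x : K => k⁻¹ * x) ⁻¹' U) fun k =>
      (hUo.preimage (continuous_const_mul k⁻¹)).mem_nhds (by simp [hU, mem_chart_source])
  have hsne : s.Nonempty := by
    by_contra hne
    rw [Set.not_nonempty_iff_eq_empty] at hne
    have : (1 : K) ∈ (⋃ x ∈ s, (fun y : K => x⁻¹ * y) ⁻¹' U) := by rw [hsu]; trivial
    simp [hne] at this
  obtain ⟨b, rfl⟩ := hsc.exists_eq_range hsne
  set V : ℕ → Set K := fun n => (fun x : K => (b n)⁻¹ * x) ⁻¹' U with hV
  have hVm : ∀ n, MeasurableSet (V n) := fun n => hmul _ hUo.measurableSet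
  set P := disjointed V with hPdef
  have hPm : ∀ n, MeasurableSet (P n) := fun n => MeasurableSet.disjointed hVm n
  have hPd : Pairwise (Function.onFun Disjoint P) := disjoint_disjointed V
  have hPu : ⋃ n, P n = Set.univ := by
    rw [hPdef, iUnion_disjointed, ← hsu]; simp [hV]
  have hPV : ∀ n x, x ∈ P n → (b n)⁻¹ * x ∈ U := fun n x hx => disjointed_subset V n hx
  set l := chartHaar K μ
  -- Countably many translates `b n * U` of the chart domain cover the group. On the `n`-th piece of
  -- the resulting partition, `m` is the translate of the chart measure by `b n`.
  let m : Measure K := Measure.sum fun n => (l.map fun x => b n * x).restrict (P n)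
  have hm : ∀ S, MeasurableSet S → m S = ∑' n, l ((fun x => b n * x) ⁻¹' (S ∩ P n)) := by
    intro S hS
    rw [Measure.sum_apply _ hS]
    congr 1; funext n
    rw [Measure.restrict_apply hS, Measure.map_apply (hmul _) (hS.inter (hPm n))]
  refine ⟨m, ⟨fun c => ?_⟩, fun S hS hSU => ?_⟩
  · ext S hS
    have hcS : MeasurableSet ((fun x => c * x) ⁻¹' S) := hmul c hS
    rw [Measure.map_apply (hmul c) hS, hm _ hcS, hm _ hS]
    -- Both sides are cut along pairs of pieces: a point in `P j` whose translate by `c` is in `P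
    -- i`. For each pair the two sets differ by the translation by `(b i)⁻¹ * c * b j` inside the
    -- chart domain.
    have e1 : ∀ j, l ((fun x => b j * x) ⁻¹' ((fun x => c * x) ⁻¹' S ∩ P j)) =
        ∑' i, l ((fun x => b j * x) ⁻¹' ((fun x => c * x) ⁻¹' S ∩ P j) ∩
          (fun x => c * (b j * x)) ⁻¹' P i) := fun j =>
      measure_eq_tsum_inter_preimage l ((hmul c).comp (hmul (b j))) hPm hPd hPu
        (hmul _ (hcS.inter (hPm j)))
    have e2 : ∀ i, l ((fun x => b i * x) ⁻¹' (S ∩ P i)) =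
        ∑' j, l ((fun x => b i * x) ⁻¹' (S ∩ P i) ∩ (fun x => c⁻¹ * (b i * x)) ⁻¹' P j) := fun i =>
      measure_eq_tsum_inter_preimage l ((hmul c⁻¹).comp (hmul (b i))) hPm hPd hPu
        (hmul _ (hS.inter (hPm i)))
    simp_rw [e1, e2]
    rw [ENNReal.tsum_comm]
    congr 1; funext i; congr 1; funext j
    have hX : MeasurableSet ((fun x => b j * x) ⁻¹' ((fun x => c * x) ⁻¹' S ∩ P j) ∩
          (fun x => c * (b j * x)) ⁻¹' P i) :=
      (hmul _ (hcS.inter (hPm j))).inter (((hmul c).comp (hmul (b j))) (hPm i))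
    rw [← chartHaar_mul_left μ ((b i)⁻¹ * c * b j) hX]
    · congr 1
      ext x
      simp [mul_assoc]
      tauto
    · rintro x ⟨⟨_, hx⟩, _⟩
      simpa using hPV _ _ hx
    · rintro x ⟨_, hx⟩
      simpa [mul_assoc] using hPV _ _ hx
  · rw [hm S hS, measure_eq_tsum_inter_preimage l measurable_id hPm hPd hPu hS]
    congr 1; funext n
    have h1 := chartHaar_mul_left μ (b n)⁻¹ (hS.inter (hPm n))
      (Set.inter_subset_left.trans hSU) fun x hx => hPV n x hx.2
    rw [inv_inv] at h1
    exact h1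

-- The density is bounded near `1` by continuity. This gives local finiteness of the extended
-- measure, needed to compare it with a Haar measure.
omit [SecondCountableTopology K] in
theorem exists_nhds_chartHaar_lt_top (μ : Measure E) [μ.IsAddHaarMeasure] :
    ∃ N : Set K, IsOpen N ∧ (1 : K) ∈ N ∧ N ⊆ (chartAt E (1 : K)).source ∧
      chartHaar K μ N < ⊤ := by
  set φ := chartAt E (1 : K) with hφ
  have h1U : (1 : K) ∈ φ.source := mem_chart_source E (1 : K)
  have h1 : ContinuousAt (fun x : K => |leftJac E x|⁻¹) 1 :=
    (continuousOn_leftJac.continuousAt (φ.open_source.mem_nhds h1U)).abs.inv₀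
      (abs_ne_zero.2 (leftJac_ne_zero h1U))
  have h2 : ∀ᶠ x : K in 𝓝 1, |leftJac E x|⁻¹ < |leftJac E (1 : K)|⁻¹ + 1 :=
    h1.eventually_lt continuousAt_const (by simp)
  have h3 : ∀ᶠ x : K in 𝓝 1, φ x ∈ Metric.ball (φ 1) 1 :=
    (φ.continuousAt h1U).preimage_mem_nhds (Metric.ball_mem_nhds _ one_pos)
  obtain ⟨N, hN, hNo, hN1⟩ := eventually_nhds_iff.1
    (h2.and (h3.and (φ.open_source.mem_nhds h1U)))
  refine ⟨N, hNo, hN1, fun x hx => (hN x hx).2.2, ?_⟩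
  rw [chartHaar_apply μ hNo.measurableSet]
  calc _ ≤ ∫⁻ t in φ.target ∩ φ.symm ⁻¹' N, ENNReal.ofReal (|leftJac E (1 : K)|⁻¹ + 1) ∂μ := by
        refine setLIntegral_mono' (measurableSet_target_inter hNo.measurableSet) fun t ht => ?_
        rw [haarDensity_of_mem (hN _ ht.2).2.2]
        exact ENNReal.ofReal_le_ofReal (hN _ ht.2).1.le
    _ ≤ ∫⁻ t in Metric.ball (φ 1) 1, ENNReal.ofReal (|leftJac E (1 : K)|⁻¹ + 1) ∂μ := by
        refine lintegral_mono_set fun t ht => ?_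
        have := (hN _ ht.2).2.1
        rwa [φ.right_inv ht.1] at this
    _ < ⊤ := by
        rw [setLIntegral_const]
        exact ENNReal.mul_lt_top ENNReal.ofReal_lt_top measure_ball_lt_top

-- Nonvanishing makes the proportionality factor to Haar measure nonzero, so that it can be
-- cancelled.
omit [SecondCountableTopology K] in
theorem chartHaar_source_ne_zero (μ : Measure E) [μ.IsAddHaarMeasure] :
    chartHaar K μ (chartAt E (1 : K)).source ≠ 0 := by
  set φ := chartAt E (1 : K) with hφ
  rw [chartHaar_apply μ φ.open_source.measurableSet]
  have hT : φ.target ∩ φ.symm ⁻¹' φ.source = φ.target :=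
    Set.inter_eq_left.2 fun t ht => φ.map_target ht
  rw [hT]
  have hpos : ∀ t ∈ φ.target, haarDensity E (φ.symm t) ≠ 0 := by
    intro t ht
    rw [haarDensity_of_mem (φ.map_target ht), Ne, ENNReal.ofReal_eq_zero, not_le]
    exact inv_pos.2 (abs_pos.2 (leftJac_ne_zero (φ.map_target ht)))
  intro h0
  have hae : AEMeasurable (fun t => haarDensity E (φ.symm t)) (μ.restrict φ.target) :=
    measurable_haarDensity.comp_aemeasurable (aemeasurable_chartAt_symm μ)
  replace h0 := (lintegral_eq_zero_iff' hae).1 h0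
  have h1 : ∀ᵐ t ∂(μ.restrict φ.target), False := by
    filter_upwards [h0, ae_restrict_mem φ.open_target.measurableSet] with t h2 h3
    exact hpos t h3 h2
  have h2 : μ.restrict φ.target = 0 := by simpa using h1
  rw [Measure.restrict_eq_zero] at h2
  exact (φ.open_target.measure_pos μ ⟨φ 1, φ.map_source (mem_chart_source E (1 : K))⟩).ne' h2

/-- In the chart at `e`, a Haar measure has the density `1 / |leftJac|`, up to a factor. -/
theorem exists_chartHaar_eq_smul (μ : Measure E) [μ.IsAddHaarMeasure] (ν : Measure K)
    [ν.IsHaarMeasure] : ∃ c : NNReal, c ≠ 0 ∧ ∀ S : Set K, MeasurableSet S →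
      S ⊆ (chartAt E (1 : K)).source → chartHaar K μ S = c * ν S := by
  have : IsTopologicalGroup K := topologicalGroup_of_lieGroup 𝓘(ℝ, E) ∞
  have : LocallyCompactSpace K := Manifold.locallyCompact_of_finiteDimensional 𝓘(ℝ, E)
  obtain ⟨m, hm, hmS⟩ := exists_isMulLeftInvariant_eq_chartHaar (K := K) μ
  obtain ⟨N, hNo, hN1, hNU, hNfin⟩ := exists_nhds_chartHaar_lt_top (K := K) μ
  have : IsLocallyFiniteMeasure m := by
    refine ⟨fun x => ⟨(fun y => x⁻¹ * y) ⁻¹' N,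
      (hNo.preimage (continuous_const_mul x⁻¹)).mem_nhds (by simpa using hN1), ?_⟩⟩
    rw [measure_preimage_mul, hmS N hNo.measurableSet hNU]
    exact hNfin
  have h1 := Measure.isMulLeftInvariant_eq_smul m ν
  refine ⟨m.haarScalarFactor ν, fun h0 => ?_, fun S hS hSU => ?_⟩
  · rw [h0, zero_smul] at h1
    apply chartHaar_source_ne_zero (K := K) μ
    rw [← hmS _ (chartAt E (1 : K)).open_source.measurableSet subset_rfl, h1]
    rfl
  · rw [← hmS S hS hSU]
    conv_lhs => rw [h1]
    rfl

/-- Local change of variables for a Haar measure. -/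
theorem haar_image (ν : Measure K) [ν.IsHaarMeasure] {f : K → K} {S : Set K}
    (hS : MeasurableSet S) (hfS : MeasurableSet (f '' S)) (hinj : Set.InjOn f S)
    (hSU : S ⊆ (chartAt E (1 : K)).source) (hfSU : Set.MapsTo f S (chartAt E (1 : K)).source)
    (hf : ∀ x ∈ S, MDifferentiableAt 𝓘(ℝ, E) 𝓘(ℝ, E) f x) {w : K → ENNReal} (hw : Measurable w)
    (hfw : ∀ x ∈ S, w x = ENNReal.ofReal |LinearMap.det (trivDer E f x : E →ₗ[ℝ] E)|) :
    ν (f '' S) = ∫⁻ x in S, w x ∂ν := by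
  obtain ⟨c, hc, h1⟩ := exists_chartHaar_eq_smul (Measure.addHaar : Measure E) ν
  have h2 : (chartHaar K (Measure.addHaar : Measure E)).restrict S = (c • ν).restrict S := by
    ext T hT
    rw [Measure.restrict_apply hT, Measure.restrict_apply hT,
      h1 _ (hT.inter hS) (Set.inter_subset_right.trans hSU)]
    rfl
  have h3 := chartHaar_image (Measure.addHaar : Measure E) hS hfS hinj hSU hfSU hf hw hfw
  rw [h1 _ hfS hfSU.image_subset, h2, Measure.restrict_smul, lintegral_smul_measure] at h3
  exact (ENNReal.mul_right_inj (by simpa using hc) ENNReal.coe_ne_top).1 h3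

/-- Change of variables for a Haar measure and a diffeomorphism of the group. -/
theorem map_withDensity_trivDer (ν : Measure K) [ν.IsHaarMeasure] (ψ : K ≃ₜ K)
    (hψ : MDifferentiable 𝓘(ℝ, E) 𝓘(ℝ, E) ψ) {w : K → ENNReal} (hw : Measurable w)
    (hψw : ∀ x, w x = ENNReal.ofReal |LinearMap.det (trivDer E ψ x : E →ₗ[ℝ] E)|) :
    (ν.withDensity w).map ψ = ν := by
  have : IsTopologicalGroup K := topologicalGroup_of_lieGroup 𝓘(ℝ, E) ∞
  have hUo : IsOpen (chartAt E (1 : K)).source := (chartAt E (1 : K)).open_source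
  -- It suffices to compare both measures on countably many open sets `N`, so small that `k⁻¹ N` and
  -- `(ψ k)⁻¹ ψ(N)` lie in the chart domain at `1`.
  have key : ν.withDensity w = ν.map ψ.symm := by
    obtain ⟨s, hsc, hsu⟩ := TopologicalSpace.countable_cover_nhds
      (f := fun k : K => ((fun x : K => k⁻¹ * x) ⁻¹' (chartAt E (1 : K)).source) ∩
        ((fun x : K => (ψ k)⁻¹ * ψ x) ⁻¹' (chartAt E (1 : K)).source)) fun k =>
      Filter.inter_mem ((hUo.preimage (continuous_const_mul k⁻¹)).mem_nhds (by simp))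
        ((hUo.preimage ((continuous_const_mul (ψ k)⁻¹).comp ψ.continuous)).mem_nhds (by simp))
    have := hsc.to_subtype
    rw [Set.biUnion_eq_iUnion] at hsu
    rw [Measure.ext_iff_of_iUnion_eq_univ hsu]
    rintro ⟨k, -⟩
    ext S hS
    set N := ((fun x : K => k⁻¹ * x) ⁻¹' (chartAt E (1 : K)).source) ∩
        ((fun x : K => (ψ k)⁻¹ * ψ x) ⁻¹' (chartAt E (1 : K)).source)
    have hN : MeasurableSet N := ((hUo.preimage (continuous_const_mul k⁻¹)).inter
      (hUo.preimage ((continuous_const_mul (ψ k)⁻¹).comp ψ.continuous))).measurableSet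
    have hSN := hS.inter hN
    rw [Measure.restrict_apply hS, Measure.restrict_apply hS, withDensity_apply _ hSN,
      Measure.map_apply ψ.symm.continuous.measurable hSN]
    -- Left translations on both sides move the problem to the chart at `1`. They alter neither `ν`
    -- nor the Jacobian in the left trivialization.
    let f : K → K := fun x => (ψ k)⁻¹ * ψ (k * x)
    set T := (fun x => k * x) ⁻¹' (S ∩ N)
    have hT : MeasurableSet T := (continuous_const_mul k).measurable hSN
    have hfT : (fun x => ψ k * x) ⁻¹' (ψ.symm ⁻¹' (S ∩ N)) = f '' T := by
      ext x
      constructor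
      · intro hx
        refine ⟨k⁻¹ * ψ.symm (ψ k * x), by simpa [T] using hx, by simp [f]⟩
      · rintro ⟨y, hy, rfl⟩
        simpa [f, T] using hy
    have hfTm : MeasurableSet (f '' T) := by
      rw [← hfT]
      exact (continuous_const_mul _).measurable (ψ.symm.continuous.measurable hSN)
    have hfd : MDifferentiable 𝓘(ℝ, E) 𝓘(ℝ, E) f :=
      (mdifferentiable_mul_left_self _).comp (hψ.comp (mdifferentiable_mul_left_self k))
    have h1 := haar_image ν hT hfTm
      (fun x _ y _ hxy => mul_left_cancel (ψ.injective (mul_left_cancel hxy)))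
      (fun x hx => by simpa using hx.2.1) (fun x hx => hx.2.2) (fun x _ => hfd x)
      (hw.comp (continuous_const_mul k).measurable) (fun x _ => by
        have : trivDer E f x = trivDer E ψ (k * x) := by
          rw [trivDer, trivDer]
          congr 1
          funext y
          simp [f, mul_assoc]
        rw [this, ← hψw]; rfl)
    rw [← measure_preimage_mul ν (ψ k), hfT, h1]
    conv_lhs => rw [← map_mul_left_eq_self ν k]
    rw [setLIntegral_map hSN hw (continuous_const_mul k).measurable]
    rfl
  rw [key, Measure.map_map ψ.continuous.measurable ψ.symm.continuous.measurable]
  simp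

/-- The underlying identity is one of measures and `ψ` is a measurable embedding, so `F` may be
arbitrary, integrable or not. -/
theorem integral_comp_mul_trivDer (ν : Measure K) [ν.IsHaarMeasure] (ψ : K ≃ₜ K)
    (hψ : MDifferentiable 𝓘(ℝ, E) 𝓘(ℝ, E) ψ) {w : K → ℝ} (hw : Measurable w)
    (hψw : ∀ x, w x = |LinearMap.det (trivDer E ψ x : E →ₗ[ℝ] E)|) (F : K → ℂ) :
    ∫ x, (w x : ℂ) * F (ψ x) ∂ν = ∫ x, F x ∂ν := by
  have hw0 : ∀ x, 0 ≤ w x := fun x => hψw x ▸ abs_nonneg _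
  have h1 := map_withDensity_trivDer (E := E) ν ψ hψ (w := fun x => ((w x).toNNReal : ENNReal))
    hw.real_toNNReal.coe_nnreal_ennreal (fun x => by rw [← hψw]; rfl)
  conv_rhs => rw [← h1]
  rw [ψ.measurableEmbedding.integral_map,
    integral_withDensity_eq_integral_smul hw.real_toNNReal]
  congr 1; funext x
  rw [NNReal.smul_def, Real.coe_toNNReal _ (hw0 x), Complex.real_smul]

end Haar

namespace IsDoubleLieGroup

open MeasureTheory

variable {EG EA EB : Type*}
  [NormedAddCommGroup EG] [NormedSpace ℝ EG]
  [NormedAddCommGroup EA] [NormedSpace ℝ EA]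
  [NormedAddCommGroup EB] [NormedSpace ℝ EB]
  {G : Type*} [Group G] [TopologicalSpace G] [ChartedSpace EG G]
  {A B : Subgroup G} [ChartedSpace EA A] [ChartedSpace EB B]

/-! ### The action of `A` on `B` and the Haar measure of `B` -/

/-- `b_L` identifies `G / A` with `B`, and left multiplication by `a` descends to the quotient. -/
theorem bL_mul_bL (h : IsDoubleLieGroup EG EA EB A B) (a : A) (g : G) :
    h.bL (a * (h.bL g : G)) = h.bL (a * g) := by
  refine (h.bL_eq (a := h.aR (a * (h.bL g : G)) * h.aR g) ?_).symm
  push_cast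
  rw [← mul_assoc, bL_mul_aR, mul_assoc, bL_mul_aR]

variable [FiniteDimensional ℝ EG] [FiniteDimensional ℝ EA] [FiniteDimensional ℝ EB]
  [SecondCountableTopology G]

/-- The action of `a ∈ A` on `B ≃ G / A`: it maps `b` to `b_L(a b)`. -/
def dressing (h : IsDoubleLieGroup EG EA EB A B) (a : A) : B ≃ₜ B where
  toFun b := h.bL (a * b)
  invFun b := h.bL ((a⁻¹ : A) * b)
  left_inv b := by
    simp only [bL_mul_bL]
    simp [bL_coe_right]
  right_inv b := by
    simp only [bL_mul_bL]
    simp [bL_coe_right]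
  continuous_toFun := by
    have := h.lieGroup
    exact h.contMDiff_bL.continuous.comp
      ((contMDiff_mul_left (n := ∞) (I := 𝓘(ℝ, EG))).continuous.comp continuous_subtype_val)
  continuous_invFun := by
    have := h.lieGroup
    exact h.contMDiff_bL.continuous.comp
      ((contMDiff_mul_left (n := ∞) (I := 𝓘(ℝ, EG))).continuous.comp continuous_subtype_val)

/-- The identity `b_L(a b c) = b_L(a b) b_L(a_R(a b) c)` moves the derivative at `b` to the
derivative at `e` of the action of `a_R(a b)`. -/
theorem trivDer_dressing (h : IsDoubleLieGroup EG EA EB A B) (a : A) (b : B) :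
    LinearMap.det (trivDer EB (h.dressing a) b : EB →ₗ[ℝ] EB) =
      h.blockB (h.aR (a * (b : G))) := by
  rw [← h.det_tder_bL_mul, trivDer]
  congr 3
  funext c
  change (h.bL (a * (b : G)))⁻¹ * h.bL (a * ((b * c : B) : G)) = _
  rw [inv_mul_eq_iff_eq_mul]
  refine h.bL_eq (a := h.aR (h.aR (a * (b : G)) * c)) ?_
  push_cast
  rw [mul_assoc (h.bL (a * (b : G)) : G), bL_mul_aR, ← mul_assoc (h.bL (a * (b : G)) : G), bL_mul_aR, mul_assoc]

theorem integral_bL_mul (h : IsDoubleLieGroup EG EA EB A B) [MeasurableSpace B] [BorelSpace B]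
    (ν : Measure B) [ν.IsHaarMeasure] (a : A) (F : B → ℂ) :
    ∫ b : B, (|h.blockB (h.aR (a * (b : G)))| : ℝ) * F (h.bL (a * (b : G))) ∂ν =
      ∫ b : B, F b ∂ν := by
  have := h.lieGroup
  have := h.lieGroup_right
  have : SecondCountableTopology B := inferInstanceAs (SecondCountableTopology (B : Set G))
  borelize EB
  have hc : Continuous fun b : B => (a : G) * b :=
    (contMDiff_mul_left (n := ∞) (I := 𝓘(ℝ, EG))).continuous.comp continuous_subtype_val
  refine integral_comp_mul_trivDer (E := EB) ν (h.dressing a) ?_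
    (w := fun b => |h.blockB (h.aR (a * (b : G)))|) ?_ (fun b => ?_) F
  · exact (h.contMDiff_bL.mdifferentiable (by simp)).comp (h.mdifferentiable_mul_coe _)
  · exact (h.contMDiff_blockB.continuous.comp (continuous_subtype_val.comp
      (h.contMDiff_aR.continuous.comp hc))).abs.measurable
  · rw [trivDer_dressing]

/-- Inversion of the left fiber through `g`, up to a modular factor: with `y = a_L(g) b`, the
measure `|det (Ad a_R(y))|_𝔟| db` is carried by `b ↦ b_L(g)⁻¹ b_L(y)` to `db`. -/
theorem integral_bL_inv_mul_bL (h : IsDoubleLieGroup EG EA EB A B) [MeasurableSpace B]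
    [BorelSpace B] (ν : Measure B) [ν.IsHaarMeasure] (g : G) (F : B → ℂ) :
    ∫ b : B, (|h.blockB (h.aR (h.aL g * (b : G)))| : ℝ) *
      F ((h.bL g)⁻¹ * h.bL (h.aL g * (b : G))) ∂ν = ∫ b : B, F b ∂ν := by
  have := h.lieGroup_right
  have : IsTopologicalGroup B := topologicalGroup_of_lieGroup 𝓘(ℝ, EB) ∞
  -- The Jacobian comes entirely from the action of `a_L(g)`; the remaining left translation
  -- preserves `ν`.
  rw [h.integral_bL_mul ν (h.aL g) fun b => F ((h.bL g)⁻¹ * b)]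
  exact integral_mul_left_eq_self F (h.bL g)⁻¹

end IsDoubleLieGroup

theorem IsLinearBijectionOn.of_invOn {V : Type*} [AddCommGroup V] [Module ℂ V]
    {𝒜 : Submodule ℂ V} {T S : V → V} (hT : ∀ x ∈ 𝒜, T x ∈ 𝒜) (hS : ∀ x ∈ 𝒜, S x ∈ 𝒜)
    (hST : ∀ x, S (T x) = x) (hTS : ∀ x, T (S x) = x) (hadd : ∀ x y, T (x + y) = T x + T y)
    (hsmul : ∀ (c : ℂ) x, T (c • x) = c • T x) : IsLinearBijectionOn 𝒜 T where
  bijOn := Set.InvOn.bijOn (f' := S) ⟨fun x _ => hST x, fun x _ => hTS x⟩ hT hS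
  map_add x _ y _ := hadd x y
  map_smul c x _ := hsmul c x

namespace IsDoubleLieGroup

open MeasureTheory

variable {EG EA EB : Type*}
  [NormedAddCommGroup EG] [NormedSpace ℝ EG]
  [NormedAddCommGroup EA] [NormedSpace ℝ EA]
  [NormedAddCommGroup EB] [NormedSpace ℝ EB]
  {G : Type*} [Group G] [TopologicalSpace G] [ChartedSpace EG G]
  {A B : Subgroup G} [ChartedSpace EA A] [ChartedSpace EB B]

/-! ### Bidensities on the model spaces -/

/-- The value `η(g)(v ⊗ w)`, for vectors of the model space. -/
def ev (h : IsDoubleLieGroup EG EA EB A B) (η : h.Sect) (g : G)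
    (v w : Fin (Module.finrank ℝ EB) → EG) : ℂ := η g v w

/-- `leftTangent` in the model space. -/
def leftSpace (h : IsDoubleLieGroup EG EA EB A B) (g : G) : Submodule ℝ EG :=
  LinearMap.range (h.leftDer g : EB →ₗ[ℝ] EG)

/-- `rightTangent` in the model space. -/
def rightSpace (h : IsDoubleLieGroup EG EA EB A B) (g : G) : Submodule ℝ EG :=
  LinearMap.range (h.rightDer g : EB →ₗ[ℝ] EG)

theorem ev_ext (h : IsDoubleLieGroup EG EA EB A B) {η η' : h.Sect}
    (hη : ∀ g v w, h.ev η g v w = h.ev η' g v w) : η = η' :=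
  funext fun g => funext fun v => funext fun w => hη g v w

theorem mem_bidensities_iff (h : IsDoubleLieGroup EG EA EB A B) {η : h.Sect} :
    η ∈ h.bidensities ↔
      (∀ g, IsBidensityAt (h.leftSpace g) (h.rightSpace g) (h.ev η g)) ∧
      (∀ Y Z : Fin (Module.finrank ℝ EB) → EB, ContMDiff 𝓘(ℝ, EG) 𝓘(ℝ, ℂ) ∞ fun g : G =>
        h.ev η g (fun i => h.leftDer g (Y i)) (fun i => h.rightDer g (Z i))) ∧
      ∃ K : Set G, IsCompact K ∧ ∀ g ∉ K, h.ev η g = 0 := Iff.rfl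

theorem ev_R (h : IsDoubleLieGroup EG EA EB A B) (η : h.Sect) (g : G)
    (v w : Fin (Module.finrank ℝ EB) → EG) :
    h.ev (h.R η) g v w = h.ev η g⁻¹ (fun i => tder EG EG (fun x : G => x⁻¹) g (w i))
      (fun i => tder EG EG (fun x : G => x⁻¹) g (v i)) := rfl

theorem ev_star (h : IsDoubleLieGroup EG EA EB A B) (η : h.Sect) (g : G)
    (v w : Fin (Module.finrank ℝ EB) → EG) :
    h.ev (h.star η) g v w = (starRingEnd ℂ) (h.ev η (h.sA g)
      (fun i => tder EG EG h.sA g (w i)) (fun i => tder EG EG h.sA g (v i))) := rfl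

theorem ev_tau (h : IsDoubleLieGroup EG EA EB A B) (z : ℂ) (η : h.Sect) (g : G)
    (v w : Fin (Module.finrank ℝ EB) → EG) :
    h.ev (h.tau z η) g v w = ((|h.Q g| : ℝ) : ℂ) ^ (Complex.I * z) * h.ev η g v w := rfl

/-! ### The map `R` -/

theorem tder_inv_mem_leftSpace (h : IsDoubleLieGroup EG EA EB A B) {g : G} {v : EG}
    (hv : v ∈ h.rightSpace g) : tder EG EG (fun x : G => x⁻¹) g v ∈ h.leftSpace g⁻¹ := by
  obtain ⟨Y, rfl⟩ := hv
  exact ⟨h.invB Y, (h.tder_inv_rightDer g Y).symm⟩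

theorem tder_inv_mem_rightSpace (h : IsDoubleLieGroup EG EA EB A B) {g : G} {v : EG}
    (hv : v ∈ h.leftSpace g) : tder EG EG (fun x : G => x⁻¹) g v ∈ h.rightSpace g⁻¹ := by
  obtain ⟨Y, rfl⟩ := hv
  exact ⟨h.invB Y, (h.tder_inv_leftDer g Y).symm⟩

theorem mem_rightSpace_of_tder_inv (h : IsDoubleLieGroup EG EA EB A B) {g : G} {v : EG}
    (hv : tder EG EG (fun x : G => x⁻¹) g v ∈ h.leftSpace g⁻¹) : v ∈ h.rightSpace g := by
  have h1 := h.tder_inv_mem_rightSpace hv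
  rwa [h.tder_inv_inv, inv_inv] at h1

theorem mem_leftSpace_of_tder_inv (h : IsDoubleLieGroup EG EA EB A B) {g : G} {v : EG}
    (hv : tder EG EG (fun x : G => x⁻¹) g v ∈ h.rightSpace g⁻¹) : v ∈ h.leftSpace g := by
  have h1 := h.tder_inv_mem_leftSpace hv
  rwa [h.tder_inv_inv, inv_inv] at h1

theorem R_R (h : IsDoubleLieGroup EG EA EB A B) (η : h.Sect) : h.R (h.R η) = η := by
  refine h.ev_ext fun g v w => ?_
  rw [ev_R, ev_R]
  simp only [h.tder_inv_inv, inv_inv]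

theorem ev_R_frame (h : IsDoubleLieGroup EG EA EB A B) (η : h.Sect) (g : G)
    (Y Z : Fin (Module.finrank ℝ EB) → EB) :
    h.ev (h.R η) g (fun i => h.leftDer g (Y i)) (fun i => h.rightDer g (Z i)) =
      h.ev η g⁻¹ (fun i => h.leftDer g⁻¹ (h.invB (Z i)))
        (fun i => h.rightDer g⁻¹ (h.invB (Y i))) := by
  rw [ev_R]
  simp only [tder_inv_leftDer, tder_inv_rightDer]

theorem R_mem_bidensities (h : IsDoubleLieGroup EG EA EB A B) {η : h.Sect}
    (hη : η ∈ h.bidensities) : h.R η ∈ h.bidensities := by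
  have := h.lieGroup
  have : IsTopologicalGroup G := topologicalGroup_of_lieGroup 𝓘(ℝ, EG) ∞
  rw [mem_bidensities_iff] at hη ⊢
  obtain ⟨h1, h2, K, hK, h3⟩ := hη
  refine ⟨fun g => ⟨fun M v w hv hw => ?_, fun M v w hv hw => ?_, fun v w hvw => ?_⟩,
    fun X Y => ?_, K⁻¹, hK.inv, fun g hg => ?_⟩
  -- `R` exchanges the two slots, so the left rule for `R η` is the right rule for `η`.
  · have h4 := (h1 g⁻¹).right M (fun i => tder EG EG (fun x : G => x⁻¹) g (w i))
      (fun i => tder EG EG (fun x : G => x⁻¹) g (v i))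
      (fun i => h.tder_inv_mem_leftSpace (hw i)) (fun i => h.tder_inv_mem_rightSpace (hv i))
    rw [ev_R, ev_R, ← h4]
    simp only [map_sum, map_smul]
  · have h4 := (h1 g⁻¹).left M (fun i => tder EG EG (fun x : G => x⁻¹) g (w i))
      (fun i => tder EG EG (fun x : G => x⁻¹) g (v i))
      (fun i => h.tder_inv_mem_leftSpace (hw i)) (fun i => h.tder_inv_mem_rightSpace (hv i))
    rw [ev_R, ev_R, ← h4]
    simp only [map_sum, map_smul]
  · have h4 := (h1 g⁻¹).support _ _ hvw
    exact ⟨fun i => h.mem_leftSpace_of_tder_inv (h4.2 i),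
      fun i => h.mem_rightSpace_of_tder_inv (h4.1 i)⟩
  · exact ((h2 (fun i => h.invB (Y i)) (fun i => h.invB (X i))).comp
      (contMDiff_inv 𝓘(ℝ, EG) ∞)).congr fun g => h.ev_R_frame η g X Y
  · funext v w
    rw [ev_R, h3 g⁻¹ hg]
    rfl

theorem R_isLinearBijectionOn (h : IsDoubleLieGroup EG EA EB A B) :
    IsLinearBijectionOn h.bidensities h.R :=
  .of_invOn (fun _ => h.R_mem_bidensities) (fun _ => h.R_mem_bidensities) h.R_R h.R_R
    (fun _ _ => rfl) (fun _ _ => rfl)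

/-! ### The star operation and the group `τ` -/

variable [FiniteDimensional ℝ EG] [FiniteDimensional ℝ EA] [FiniteDimensional ℝ EB]
  [SecondCountableTopology G]

theorem star_star (h : IsDoubleLieGroup EG EA EB A B) (η : h.Sect) :
    h.star (h.star η) = η := by
  refine h.ev_ext fun g v w => ?_
  rw [ev_star, ev_star, Complex.conj_conj]
  simp only [h.tder_sA_sA, sA_sA]

theorem R_star (h : IsDoubleLieGroup EG EA EB A B) (η : h.Sect) :
    h.R (h.star η) = h.star (h.R η) := by
  refine h.ev_ext fun g v w => ?_
  rw [ev_R, ev_star, ev_star, ev_R]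
  simp only [h.tder_sA_inv, sA_inv]

theorem R_tau (h : IsDoubleLieGroup EG EA EB A B) (z : ℂ) (η : h.Sect) :
    h.R (h.tau z η) = h.tau z (h.R η) := by
  refine h.ev_ext fun g v w => ?_
  rw [ev_R, ev_tau, ev_tau, ev_R, Q_inv]

theorem conj_cpow_ofReal {x : ℝ} (hx : 0 ≤ x) (z : ℂ) :
    (starRingEnd ℂ) ((x : ℂ) ^ z) = (x : ℂ) ^ (starRingEnd ℂ) z := by
  rw [Complex.cpow_conj _ _ (by
    rw [Complex.arg_ofReal_of_nonneg hx]; exact Real.pi_ne_zero.symm), Complex.conj_ofReal]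

/-- Two signs cancel: conjugation turns the exponent `i z̄` into `-i z`, and `Q ∘ s_A = Q⁻¹` turns
it back. -/
theorem tau_star (h : IsDoubleLieGroup EG EA EB A B) (z : ℂ) (η : h.Sect) :
    h.tau z (h.star η) = h.star (h.tau ((starRingEnd ℂ) z) η) := by
  refine h.ev_ext fun g v w => ?_
  rw [ev_tau, ev_star, ev_star, ev_tau, map_mul, conj_cpow_ofReal (abs_nonneg _),
    Q_sA, abs_inv, Complex.ofReal_inv, Complex.inv_cpow, ← Complex.cpow_neg]
  · congr 2
    simp
  · rw [Complex.arg_ofReal_of_nonneg (abs_nonneg _)]; exact Real.pi_ne_zero.symm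

omit [FiniteDimensional ℝ EG] [FiniteDimensional ℝ EA] [FiniteDimensional ℝ EB]
  [SecondCountableTopology G] in
theorem tau_zero (h : IsDoubleLieGroup EG EA EB A B) (η : h.Sect) : h.tau 0 η = η := by
  refine h.ev_ext fun g v w => ?_
  rw [ev_tau, mul_zero, Complex.cpow_zero, one_mul]

theorem tau_add (h : IsDoubleLieGroup EG EA EB A B) (z w : ℂ) (η : h.Sect) :
    h.tau (z + w) η = h.tau z (h.tau w η) := by
  refine h.ev_ext fun g u v => ?_
  rw [ev_tau, ev_tau, ev_tau, mul_add, Complex.cpow_add, mul_assoc]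
  simpa using h.Q_ne_zero g

/-- `Real.log` ignores the sign of its argument, so the power is `exp (z * log Q)`, smooth because
`Q` never vanishes; the absolute value need not be differentiated. -/
theorem contMDiff_abs_Q_cpow (h : IsDoubleLieGroup EG EA EB A B) (z : ℂ) :
    ContMDiff 𝓘(ℝ, EG) 𝓘(ℝ, ℂ) ∞ (fun g => ((|h.Q g| : ℝ) : ℂ) ^ z) := by
  have h1 : (fun g => ((|h.Q g| : ℝ) : ℂ) ^ z) =
      (fun x : ℝ => Complex.exp ((Real.log x : ℂ) * z)) ∘ h.Q := by
    funext g
    rw [Complex.cpow_def_of_ne_zero (by simpa using h.Q_ne_zero g),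
      ← Complex.ofReal_log (abs_nonneg _), Real.log_abs]
    rfl
  rw [h1]
  intro g
  refine ContMDiffAt.comp (I' := 𝓘(ℝ, ℝ)) g (ContDiffAt.contMDiffAt ?_) (h.contMDiff_Q g)
  exact Complex.contDiff_exp.contDiffAt.comp _
    ((Complex.ofRealCLM.contDiff.contDiffAt.comp _
      (Real.contDiffAt_log.2 (h.Q_ne_zero g))).mul contDiffAt_const)

theorem tau_mem_bidensities (h : IsDoubleLieGroup EG EA EB A B) (z : ℂ) {η : h.Sect}
    (hη : η ∈ h.bidensities) : h.tau z η ∈ h.bidensities := by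
  rw [mem_bidensities_iff] at hη ⊢
  obtain ⟨h1, h2, K, hK, h3⟩ := hη
  refine ⟨fun g => ⟨fun M v w hv hw => ?_, fun M v w hv hw => ?_, fun v w hvw => ?_⟩,
    fun X Y => ?_, K, hK, fun g hg => ?_⟩
  · rw [ev_tau, ev_tau, (h1 g).left M v w hv hw]; ring
  · rw [ev_tau, ev_tau, (h1 g).right M v w hv hw]; ring
  · exact (h1 g).support v w (right_ne_zero_of_mul hvw)
  · exact (contDiff_mul (𝕜 := ℝ) (𝔸 := ℂ)).contMDiff.comp
      ((h.contMDiff_abs_Q_cpow (Complex.I * z)).prodMk_space (h2 X Y))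
  · funext v w
    rw [ev_tau, h3 g hg]
    exact mul_zero _

theorem tau_isLinearBijectionOn (h : IsDoubleLieGroup EG EA EB A B) (z : ℂ) :
    IsLinearBijectionOn h.bidensities (h.tau z) := by
  refine .of_invOn (S := h.tau (-z)) (fun _ => h.tau_mem_bidensities z)
    (fun _ => h.tau_mem_bidensities (-z)) (fun η => ?_) (fun η => ?_) (fun η₁ η₂ => ?_)
    (fun c η => ?_)
  · rw [← tau_add, neg_add_cancel, tau_zero]
  · rw [← tau_add, add_neg_cancel, tau_zero]
  · funext g v w
    exact mul_add _ _ _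
  · funext g v w
    exact mul_left_comm _ _ _

/-! ### Compatibility of `τ` with the product -/

omit [FiniteDimensional ℝ EG] [FiniteDimensional ℝ EA] [FiniteDimensional ℝ EB]
  [SecondCountableTopology G] in
theorem coeff_tau (h : IsDoubleLieGroup EG EA EB A B)
    (X : Module.Basis (Fin (Module.finrank ℝ EB)) ℝ EB)
    (z : ℂ) (η : h.Sect) (g : G) :
    h.coeff X (h.tau z η) g = ((|h.Q g| : ℝ) : ℂ) ^ (Complex.I * z) * h.coeff X η g :=
  mul_div_assoc _ _ _

omit [FiniteDimensional ℝ EG] [FiniteDimensional ℝ EA] [FiniteDimensional ℝ EB]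
  [SecondCountableTopology G] in
theorem ev_mul (h : IsDoubleLieGroup EG EA EB A B)
    (X : Module.Basis (Fin (Module.finrank ℝ EB)) ℝ EB)
    [MeasurableSpace B] (ν : Measure B) (η₁ η₂ : h.Sect) (g : G)
    (v w : Fin (Module.finrank ℝ EB) → EG) :
    h.ev (h.mul X ν η₁ η₂) g v w = (∫ b : B, h.coeff X η₁ (h.aL g * (b : G)) *
      h.coeff X η₂ ((h.bL (h.aL g * (b : G)) : G)⁻¹ * g) ∂ν) * h.ev (h.omega0 X) g v w := rfl

/-- By the cocycle identity for `Q` the two powers in the integrand multiply to `|Q(g)|^{iz}`, a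
constant for the integration over the fiber. -/
theorem tau_mul (h : IsDoubleLieGroup EG EA EB A B)
    (X : Module.Basis (Fin (Module.finrank ℝ EB)) ℝ EB)
    [MeasurableSpace B] (ν : Measure B) (z : ℂ) (η₁ η₂ : h.Sect) :
    h.tau z (h.mul X ν η₁ η₂) = h.mul X ν (h.tau z η₁) (h.tau z η₂) := by
  refine h.ev_ext fun g v w => ?_
  rw [ev_tau, ev_mul, ev_mul, ← mul_assoc, ← integral_const_mul]
  congr 2; funext b
  rw [coeff_tau, coeff_tau]
  rw [← h.Q_mul_Q g b, abs_mul, Complex.ofReal_mul,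
    Complex.mul_cpow_ofReal_nonneg (abs_nonneg _) (abs_nonneg _)]
  ring

/-! ### The standard bidensity -/

section Standard

variable (h : IsDoubleLieGroup EG EA EB A B)
    (X : Module.Basis (Fin (Module.finrank ℝ EB)) ℝ EB)

omit [FiniteDimensional ℝ EB] in
theorem abs_det_comp (L : EB →L[ℝ] EB) (Y : Fin (Module.finrank ℝ EB) → EB) :
    |X.det (fun i => L (Y i))| = |LinearMap.det (L : EB →ₗ[ℝ] EB)| * |X.det Y| := by
  rw [← abs_mul]
  congr 1
  exact X.det_comp (L : EB →ₗ[ℝ] EB) Y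

/-- `lambda0` on the model space. -/
def lam (g : G) (v : Fin (Module.finrank ℝ EB) → EG) : ℝ := h.lambda0 X g v

/-- `rho0` on the model space. -/
def rho (g : G) (w : Fin (Module.finrank ℝ EB) → EG) : ℝ :=
  h.lam X (h.sA g) fun i => tder EG EG h.sA g (w i)

omit [FiniteDimensional ℝ EG] [FiniteDimensional ℝ EA] [FiniteDimensional ℝ EB]
  [SecondCountableTopology G] in
theorem ev_omega0 (g : G) (v w : Fin (Module.finrank ℝ EB) → EG) :
    h.ev (h.omega0 X) g v w = ((h.lam X g v * h.rho X g w : ℝ) : ℂ) := rfl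

omit [FiniteDimensional ℝ EG] [FiniteDimensional ℝ EA] [FiniteDimensional ℝ EB]
  [SecondCountableTopology G] in
theorem lam_leftDer (g : G) (Y : Fin (Module.finrank ℝ EB) → EB) :
    h.lam X g (fun i => h.leftDer g (Y i)) = √|X.det Y| := by
  have h1 : ∃ Z : Fin (Module.finrank ℝ EB) → TangentSpace 𝓘(ℝ, EB) (1 : B),
      ∀ i, h.leftDer g (Y i) = h.leftTrans g (Z i) := ⟨Y, fun _ => rfl⟩
  have h2 : h1.choose = Y :=
    funext fun i => (h.leftDer_injective g (h1.choose_spec i)).symm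
  exact (dif_pos h1).trans
    (congrArg (fun Z : Fin (Module.finrank ℝ EB) → EB => √|X.det Z|) h2)

omit [FiniteDimensional ℝ EG] [FiniteDimensional ℝ EA] [FiniteDimensional ℝ EB]
  [SecondCountableTopology G] in
theorem lam_eq_zero {g : G} {v : Fin (Module.finrank ℝ EB) → EG}
    (hv : ¬ ∀ i, v i ∈ h.leftSpace g) : h.lam X g v = 0 := by
  refine dif_neg ?_
  rintro ⟨Y, hY⟩
  exact hv fun i => ⟨Y i, (hY i).symm⟩

/-- `ρ₀` is `λ₀` transported by `s_A`; the factor is the square root of the Jacobian of `s_A` from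
the right fiber to the left fiber. -/
theorem rho_rightDer (g : G) (Y : Fin (Module.finrank ℝ EB) → EB) :
    h.rho X g (fun i => h.rightDer g (Y i)) = (√|h.blockB (h.aL g)|)⁻¹ * √|X.det Y| := by
  rw [rho]
  simp only [h.tder_sA_rightDer]
  rw [lam_leftDer, abs_det_comp, abs_det_sADer, Real.sqrt_mul (by positivity), Real.sqrt_inv]

theorem rho_eq_zero {g : G} {w : Fin (Module.finrank ℝ EB) → EG}
    (hw : ¬ ∀ i, w i ∈ h.rightSpace g) : h.rho X g w = 0 := by
  refine h.lam_eq_zero X fun h1 => hw fun i => ?_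
  obtain ⟨Y, hY⟩ := h1 i
  obtain ⟨Z, hZ⟩ := h.tder_sA_leftDer_mem (h.sA g) Y
  have h2 : tder EG EG h.sA (h.sA g) (h.leftDer (h.sA g) Y) = w i :=
    (congrArg (tder EG EG h.sA (h.sA g)) hY).trans (h.tder_sA_sA g (w i))
  rw [h2, sA_sA] at hZ
  exact ⟨Z, hZ.symm⟩

/-- The factor by which `R` changes the standard bidensity. -/
def modR (g : G) : ℝ := √|h.blockB (h.aL g)| * √|h.blockB (h.aR g)|

theorem sqrt_blockB_ne_zero (g : G) : √|h.blockB g| ≠ 0 :=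
  (Real.sqrt_pos.2 (abs_pos.2 (h.blockB_ne_zero g))).ne'

/-- Off the fiber directions both sides vanish. On frames, `R` replaces the factor
`|blockB(a_L(g))|^{-1/2}` of `ρ₀` by its value at `g⁻¹`, which is `|blockB(a_R(g))|^{1/2}` as
`a_L(g⁻¹) = a_R(g)⁻¹`. -/
theorem ev_R_omega0 (g : G) (v w : Fin (Module.finrank ℝ EB) → EG) :
    h.ev (h.R (h.omega0 X)) g v w = (h.modR g : ℂ) * h.ev (h.omega0 X) g v w := by
  rw [ev_R, ev_omega0, ev_omega0, ← Complex.ofReal_mul]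
  congr 1
  by_cases hv : ∀ i, v i ∈ h.leftSpace g
  · by_cases hw : ∀ i, w i ∈ h.rightSpace g
    · choose Y hY using hv
      choose Z hZ using hw
      obtain rfl : (fun i => h.leftDer g (Y i)) = v := funext hY
      obtain rfl : (fun i => h.rightDer g (Z i)) = w := funext hZ
      simp only [tder_inv_leftDer, tder_inv_rightDer]
      rw [lam_leftDer, rho_rightDer, lam_leftDer, rho_rightDer, abs_det_comp,
        abs_det_comp, abs_det_invB, aL_inv, blockB_coe_inv_left, abs_inv, Real.sqrt_inv, inv_inv,
        modR]
      have := h.sqrt_blockB_ne_zero (h.aL g)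
      field_simp
    · rw [h.rho_eq_zero X hw, h.lam_eq_zero X fun h1 =>
        hw fun i => h.mem_rightSpace_of_tder_inv (h1 i)]
      ring
  · rw [h.lam_eq_zero X hv, h.rho_eq_zero X fun h1 =>
      hv fun i => h.mem_leftSpace_of_tder_inv (h1 i)]
    ring

theorem coeff_eq (η : h.Sect) (g : G) :
    h.coeff X η g = h.ev η g (fun i => h.leftDer g (X i)) (fun i => h.rightDer g (X i)) *
      (√|h.blockB (h.aL g)| : ℝ) := by
  have h1 : h.coeff X η g =
      h.ev η g (fun i => h.leftDer g (X i)) (fun i => h.rightDer g (X i)) /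
      h.ev (h.omega0 X) g (fun i => h.leftDer g (X i)) (fun i => h.rightDer g (X i)) := rfl
  rw [h1, ev_omega0, lam_leftDer, rho_rightDer, X.det_self, div_eq_mul_inv]
  simp

/-- The half-density rule for `η` is needed to return from the frame `invB X` to `X`; the
determinant there is `±1`, so only `modR` remains. -/
theorem coeff_R {η : h.Sect} (hη : η ∈ h.bidensities) (g : G) :
    h.coeff X (h.R η) g = h.modR g * h.coeff X η g⁻¹ := by
  have h1 := ((h.mem_bidensities_iff.1 hη).1 g⁻¹).apply_comp X (h.leftDer g⁻¹ : EB →ₗ[ℝ] EG)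
    (h.rightDer g⁻¹ : EB →ₗ[ℝ] EG) (fun Y => ⟨Y, rfl⟩) (fun Y => ⟨Y, rfl⟩)
    (fun i => h.invB (X i)) (fun i => h.invB (X i))
  rw [abs_det_comp, abs_det_invB, X.det_self] at h1
  simp only [ContinuousLinearMap.coe_coe] at h1
  rw [coeff_eq, coeff_eq, ev_R_frame, h1, aL_inv, blockB_coe_inv_left, abs_inv, Real.sqrt_inv,
    modR]
  have : ((√|h.blockB (h.aR g)| : ℝ) : ℂ) ≠ 0 := by
    exact_mod_cast h.sqrt_blockB_ne_zero (h.aR g)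
  push_cast
  field_simp
  simp

-- The intermediate base point `a_R(y)`, the source of `y` and the target of `s_A(y) g`, enters both
-- factors, and its two square roots combine. The excess is the Jacobian of
-- `integral_bL_inv_mul_bL`.
omit [FiniteDimensional ℝ EG] [FiniteDimensional ℝ EA] [FiniteDimensional ℝ EB]
  [SecondCountableTopology G] in
theorem modR_mul_modR (g : G) (b : B) :
    h.modR (h.aL g * (b : G)) * h.modR ((h.bL (h.aL g * (b : G)) : G)⁻¹ * g) =
      h.modR g * |h.blockB (h.aR (h.aL g * (b : G)))| := by
  have e1 := h.bL_inv_mul_eq g b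
  have e2 : (h.bL (h.aL g * (b : G)) : G)⁻¹ * g =
      (((h.bL (h.aL g * (b : G)))⁻¹ * h.bL g : B) : G) * h.aR g := by
    push_cast; rw [mul_assoc, bL_mul_aR]
  rw [modR, modR, modR, h.aL_eq rfl, h.aL_eq e1, h.aR_eq e2]
  have := Real.mul_self_sqrt (abs_nonneg (h.blockB (h.aR (h.aL g * (b : G)))))
  linear_combination (√|h.blockB (h.aL g)| * √|h.blockB (h.aR g)|) * this

theorem R_mul [MeasurableSpace B] [BorelSpace B] (ν : Measure B) [ν.IsHaarMeasure]
    {η₁ η₂ : h.Sect} (h₁ : η₁ ∈ h.bidensities) (h₂ : η₂ ∈ h.bidensities) :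
    h.R (h.mul X ν η₁ η₂) = h.mul X ν (h.R η₂) (h.R η₁) := by
  refine h.ev_ext fun g v w => ?_
  have h3 := h.ev_R_omega0 X g v w
  rw [ev_R] at h3 ⊢
  -- The convolution at `g⁻¹` is pulled back to the left fiber of `g`. With `y = a_L(g) b`, the
  -- arguments of `η₁` and `η₂` become `(s_A(y) g)⁻¹` and `y⁻¹`, as on the other side.
  rw [ev_mul, ev_mul, h3, ← h.integral_bL_inv_mul_bL ν g, ← mul_assoc, mul_comm _ (h.modR g : ℂ),
    ← integral_const_mul]
  congr 2; funext b
  have e1 : (h.aL g⁻¹ : G) * (((h.bL g)⁻¹ * h.bL (h.aL g * (b : G)) : B) : G) =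
      ((h.bL (h.aL g * (b : G)) : G)⁻¹ * g)⁻¹ := by
    rw [aL_inv]; push_cast
    rw [← mul_assoc, ← mul_inv_rev, bL_mul_aR, mul_inv_rev, inv_inv]
  have e2 : (h.bL ((h.bL (h.aL g * (b : G)) : G)⁻¹ * g)⁻¹ : G)⁻¹ * g⁻¹ =
      (h.aL g * (b : G))⁻¹ := by
    rw [bL_inv, h.bR_eq (h.bL_inv_mul_eq g b)]
    push_cast
    rw [inv_inv, mul_assoc, mul_inv_rev]
    congr 1
    nth_rewrite 2 [← h.aL_mul_bR g]
    group
  have e3 := congrArg (fun x : ℝ => (x : ℂ)) (h.modR_mul_modR g b)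
  rw [e1, e2, h.coeff_R X h₂, h.coeff_R X h₁]
  push_cast at e3 ⊢
  linear_combination (-(h.coeff X η₂ (h.aL g * (b : G))⁻¹ *
    h.coeff X η₁ ((h.bL (h.aL g * (b : G)) : G)⁻¹ * g)⁻¹)) * e3

end Standard

/-! ### The map `κ` -/

theorem kappa_mul (h : IsDoubleLieGroup EG EA EB A B)
    (X : Module.Basis (Fin (Module.finrank ℝ EB)) ℝ EB)
    [MeasurableSpace B] [BorelSpace B] (ν : Measure B) [ν.IsHaarMeasure]
    {η₁ η₂ : h.Sect} (h₁ : η₁ ∈ h.bidensities) (h₂ : η₂ ∈ h.bidensities) :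
    h.kappa (h.mul X ν η₁ η₂) = h.mul X ν (h.kappa η₂) (h.kappa η₁) := by
  rw [kappa, tau_mul, h.R_mul X ν (h.tau_mem_bidensities _ h₁) (h.tau_mem_bidensities _ h₂)]
  rfl

/-- Moving the star past `τ_{i/2}` conjugates the parameter to `-i/2`. Since `R` commutes with the
star and with `τ`, the two copies of `R` cancel and so do `τ_{i/2}` and `τ_{-i/2}`. -/
theorem kappa_star_kappa_star (h : IsDoubleLieGroup EG EA EB A B) (η : h.Sect) :
    h.kappa (h.star (h.kappa (h.star η))) = η := by
  have h1 := h.tau_star (-(Complex.I / 2)) (h.star η)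
  have h2 : (starRingEnd ℂ) (-(Complex.I / 2)) = Complex.I / 2 := by
    simp [neg_div, Complex.conj_ofNat]
  rw [h2, star_star] at h1
  rw [kappa, kappa, ← R_star, ← h1, ← R_tau, R_R, ← tau_add, add_neg_cancel, tau_zero]

end IsDoubleLieGroup

end DLG

end

theorem proposition5p1
    {EG EA EB : Type*}
    [NormedAddCommGroup EG] [NormedSpace ℝ EG] [FiniteDimensional ℝ EG]
    [NormedAddCommGroup EA] [NormedSpace ℝ EA] [FiniteDimensional ℝ EA]
    [NormedAddCommGroup EB] [NormedSpace ℝ EB] [FiniteDimensional ℝ EB]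
    {G : Type*} [Group G] [TopologicalSpace G] [T2Space G] [SecondCountableTopology G]
    [ChartedSpace EG G]
    (A B : Subgroup G) [ChartedSpace EA A] [ChartedSpace EB B]
    (h : DLG.IsDoubleLieGroup EG EA EB A B)
    (X : Module.Basis (Fin (Module.finrank ℝ EB)) ℝ (TangentSpace 𝓘(ℝ, EB) (1 : B)))
    [MeasurableSpace B] [BorelSpace B] (ν : MeasureTheory.Measure B)
    (hν : h.IsLeftDensityMeasure X ν) :
    -- `z ↦ τ_z` is a complex one-parameter group of automorphisms of the algebra `𝒜(G_A)`
    ((∀ z : ℂ, DLG.IsLinearBijectionOn h.bidensities (h.tau z) ∧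
        ∀ η₁ ∈ h.bidensities, ∀ η₂ ∈ h.bidensities,
          h.tau z (h.mul X ν η₁ η₂) = h.mul X ν (h.tau z η₁) (h.tau z η₂)) ∧
      (∀ η ∈ h.bidensities, h.tau 0 η = η) ∧
      (∀ z w : ℂ, ∀ η ∈ h.bidensities, h.tau (z + w) η = h.tau z (h.tau w η))) ∧
    -- `τ_z ∘ * = * ∘ τ_{z̄}`
    (∀ z : ℂ, ∀ η ∈ h.bidensities,
      h.tau z (h.star η) = h.star (h.tau ((starRingEnd ℂ) z) η)) ∧
    -- `R` is an involutive `*`-antiautomorphism of `𝒜(G_A)`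
    (DLG.IsLinearBijectionOn h.bidensities h.R ∧
      (∀ η ∈ h.bidensities, h.R (h.R η) = η) ∧
      (∀ η₁ ∈ h.bidensities, ∀ η₂ ∈ h.bidensities,
        h.R (h.mul X ν η₁ η₂) = h.mul X ν (h.R η₂) (h.R η₁)) ∧
      (∀ η ∈ h.bidensities, h.R (h.star η) = h.star (h.R η))) ∧
    -- `R ∘ τ_z = τ_z ∘ R`
    (∀ z : ℂ, ∀ η ∈ h.bidensities, h.R (h.tau z η) = h.tau z (h.R η)) ∧
    -- `κ` is antimultiplicative
    (∀ η₁ ∈ h.bidensities, ∀ η₂ ∈ h.bidensities,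
      h.kappa (h.mul X ν η₁ η₂) = h.mul X ν (h.kappa η₂) (h.kappa η₁)) ∧
    -- `κ ∘ * ∘ κ ∘ * = id`
    (∀ η ∈ h.bidensities, h.kappa (h.star (h.kappa (h.star η))) = η) := by
  have := hν.isHaarMeasure
  exact ⟨⟨fun z => ⟨h.tau_isLinearBijectionOn z, fun η₁ _ η₂ _ => h.tau_mul X ν z η₁ η₂⟩,
      fun η _ => h.tau_zero η, fun z w η _ => h.tau_add z w η⟩,
    fun z η _ => h.tau_star z η,
    ⟨h.R_isLinearBijectionOn, fun η _ => h.R_R η, fun _ h₁ _ h₂ => h.R_mul X ν h₁ h₂,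
      fun η _ => h.R_star η⟩,
    fun z η _ => h.R_tau z η, fun _ h₁ _ h₂ => h.kappa_mul X ν h₁ h₂,
    fun η _ => h.kappa_star_kappa_star η⟩
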